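/- All graphs are finite and simple. A \emph{hexagon} of a graph is a subgraph that is a cycle of length 6. A \emph{benzenoid graph} is a 2-connected graph that has a plane embedding in which every inner face is bounded by a hexagon and every hexagon is the boundary of an inner face, such that two distinct hexagons are either disjoint or have exactly one common edge, and no three hexagons share a common edge. It is \emph{catacondensed} if no vertex belongs to three hexagons. The \emph{Clar number} ${\rm Cl}(B)$ of $B$ is the largest number of pairwise disjoint hexagons of $B$ for which there is a perfect matching $M$ of $B$ that contains exactly three edges of each of them. The \emph{dualist graph} $T(B)$ has the hexagons of $B$ as vertices, two of them being adjacent if and only if they have a common edge; for catacondensed $B$ it is a tree. A hexagon that is adjacent to exactly two other hexagons is \emph{angular} if its two vertices of degree 2 in $B$ are adjacent. For $k\ge 2$, let $T_k$ be the tree that consists of a path on the vertices $v_1,\dots,v_{2k+1}$ and of $k-2$ additional leaves, one attached to each of $v_4,v_6,\dots,v_{2k-2}$. Let $\mathcal{B}$ be the smallest isomorphism-closed family of graphs such that: (i) the catacondensed benzenoid graphs with one or with two hexagons belong to $\mathcal{B}$, and so does the catacondensed benzenoid graph $B_1$ with three hexagons in which the hexagon adjacent to the two others is angular; (ii) every catacondensed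 benzenoid graph $B$ for which there are an integer $k\ge 2$ and an isomorphism $T(B)\simeq T_k$ such that the hexagons corresponding to $v_2$ and $v_{2k}$ are both angular belongs to $\mathcal{B}$; (iii) if $B'\in\mathcal{B}$ is a catacondensed benzenoid graph, $e'$ is an edge of $B'$ both of whose end-vertices have degree 2 in $B'$, and $e_1$ is the edge of the angular hexagon of $B_1$ both of whose end-vertices have degree 2 in $B_1$, then every graph obtained from disjoint copies of $B'$ and $B_1$ by identifying $e'$ with $e_1$ belongs to $\mathcal{B}$. \textbf{Theorem.} Let $B$ be a catacondensed benzenoid graph with $n$ hexagons. Then $${\rm Cl}(B)\le\left\lfloor\frac{2n+1}{3}\right\rfloor,$$ and equality holds if and only if $B$ belongs to $\mathcal{B}$. -/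

import Mathlib

universe u

namespace Benzenoid

/-! ### Plane embeddings, given combinatorially -/

/-- A rotation system of `G`: at every vertex, a cyclic order of the darts (oriented edges) that
start there. -/
structure RotationSystem {V : Type u} (G : SimpleGraph V) where
  /-- The dart that follows a given dart around their common source. -/
  next : Equiv.Perm G.Dart
  fst_next : ∀ d : G.Dart, (next d).fst = d.fst
  sameCycle_of_fst_eq : ∀ d e : G.Dart, d.fst = e.fst → next.SameCycle d e

namespace RotationSystem

variable {V : Type u} {G : SimpleGraph V} (R : RotationSystem G)

/-- One step of face tracing: walk along the dart `d`, then leave its end-vertex along the dart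
that follows the reverse of `d` there. -/
def facePerm : Equiv.Perm G.Dart :=
  (SimpleGraph.Dart.symm_involutive (G := G)).toPerm.trans R.next

/-- The faces are the orbits of face tracing. -/
abbrev Face : Type u := Quotient (Equiv.Perm.SameCycle.setoid R.facePerm)

/-- The face to which a dart belongs. -/
def faceOf (d : G.Dart) : R.Face := Quotient.mk (Equiv.Perm.SameCycle.setoid R.facePerm) d

/-- The boundary of a face: the vertices and the edges that face tracing meets. -/
def boundary (f : R.Face) : G.Subgraph where
  verts := {v | ∃ d : G.Dart, R.faceOf d = f ∧ v ∈ d.edge}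
  Adj u v := ∃ d : G.Dart, R.faceOf d = f ∧ d.edge = s(u, v)
  adj_sub := by
    rintro u v ⟨d, -, h⟩
    have hd := d.edge_mem
    rwa [h] at hd
  edge_vert := by
    rintro u v ⟨d, hd, h⟩
    exact ⟨d, hd, by simp [h]⟩
  symm := ⟨by
    rintro u v ⟨d, hd, h⟩
    exact ⟨d, hd, h.trans Sym2.eq_swap⟩⟩

/-- Euler's formula. For a connected graph with at least one edge, it says that the surface
defined by the rotation system is the sphere. -/
def IsSpherical : Prop :=
  (Nat.card V : ℤ) - Nat.card G.edgeSet + Nat.card R.Face = 2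

end RotationSystem

/-! ### Benzenoid graphs -/

section Graphs

variable {V : Type u} (G : SimpleGraph V)

/-- A 2-connected graph: at least three vertices, connected, and no cut-vertex. -/
def IsTwoConnected : Prop :=
  3 ≤ Nat.card V ∧ G.Connected ∧ ∀ v : V, (G.induce {v}ᶜ).Connected

/-- A hexagon of `G` is a subgraph that is a cycle of length 6. -/
def Hexagon : Type u := {H : G.Subgraph // Nonempty (H.coe ≃g SimpleGraph.cycleGraph 6)}

/-- The number of hexagons. -/
noncomputable def numHexagons : ℕ := Nat.card (Hexagon G)

/-- A benzenoid graph: a finite 2-connected graph that has a plane embedding (an embedding into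
the sphere with a distinguished outer face) whose inner faces are hexagons, each hexagon being the
boundary of an inner face, such that two distinct hexagons are disjoint or have exactly one common
edge, and no three hexagons have a common edge. -/
structure IsBenzenoid : Prop where
  finite : Finite V
  twoConnected : IsTwoConnected G
  exists_embedding : ∃ (R : RotationSystem G) (outer : R.Face), R.IsSpherical ∧
    (∀ f : R.Face, f ≠ outer → Nonempty ((R.boundary f).coe ≃g SimpleGraph.cycleGraph 6)) ∧
    (∀ h : Hexagon G, ∃ f : R.Face, f ≠ outer ∧ R.boundary f = h.1)
  disjoint_or_common_edge : ∀ h h' : Hexagon G, h ≠ h' →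
    Disjoint h.1.verts h'.1.verts ∨ ∃! e : Sym2 V, e ∈ h.1.edgeSet ∧ e ∈ h'.1.edgeSet
  no_three_common_edge : ¬ ∃ (h₁ h₂ h₃ : Hexagon G) (e : Sym2 V),
    h₁ ≠ h₂ ∧ h₁ ≠ h₃ ∧ h₂ ≠ h₃ ∧ e ∈ h₁.1.edgeSet ∧ e ∈ h₂.1.edgeSet ∧ e ∈ h₃.1.edgeSet

/-- An internal vertex is shared by three hexagons. -/
def IsInternal (v : V) : Prop :=
  ∃ h₁ h₂ h₃ : Hexagon G, h₁ ≠ h₂ ∧ h₁ ≠ h₃ ∧ h₂ ≠ h₃ ∧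
    v ∈ h₁.1.verts ∧ v ∈ h₂.1.verts ∧ v ∈ h₃.1.verts

/-- A catacondensed benzenoid graph has no internal vertices. -/
structure IsCatacondensed : Prop where
  isBenzenoid : IsBenzenoid G
  no_internal : ∀ v : V, ¬ IsInternal G v

/-! ### The Clar number -/

variable {G} in
/-- The hexagon `h` is `M`-alternating if `M` contains exactly three of its edges. -/
def IsAlternating (M : G.Subgraph) (h : Hexagon G) : Prop :=
  (M.edgeSet ∩ h.1.edgeSet).ncard = 3

variable {G} in
/-- The hexagons in `C` are independent, and some perfect matching makes all of them
alternating. -/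
def IsResonant (C : Finset (Hexagon G)) : Prop :=
  (∀ h ∈ C, ∀ h' ∈ C, h ≠ h' → Disjoint h.1.verts h'.1.verts) ∧
  ∃ M : G.Subgraph, M.IsPerfectMatching ∧ ∀ h ∈ C, IsAlternating M h

/-- The Clar number: the largest number of independent `M`-alternating hexagons over all perfect
matchings `M`. -/
noncomputable def clarNumber : ℕ :=
  sSup {k | ∃ C : Finset (Hexagon G), IsResonant C ∧ C.card = k}

/-! ### Dualist graph, angular hexagons, and the trees `T_k` -/

/-- The dualist graph: its vertices are the hexagons, two of which are adjacent if they have a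
common edge. -/
def dualist : SimpleGraph (Hexagon G) where
  Adj h h' := h ≠ h' ∧ ∃ e : Sym2 V, e ∈ h.1.edgeSet ∧ e ∈ h'.1.edgeSet
  symm := ⟨fun _ _ ⟨hne, e, he, he'⟩ => ⟨hne.symm, e, he', he⟩⟩
  loopless := ⟨fun _ h => h.1 rfl⟩

/-- The vertex `v` has degree 2. -/
def HasDegreeTwo (v : V) : Prop := (G.neighborSet v).ncard = 2

/-- A hexagon is angular if it is adjacent to exactly two other hexagons, and its two vertices of
degree 2 are adjacent. -/
def IsAngular (h : Hexagon G) : Prop :=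
  ((dualist G).neighborSet h).ncard = 2 ∧
  ∃ u v : V, {w | w ∈ h.1.verts ∧ HasDegreeTwo G w} = {u, v} ∧ G.Adj u v

end Graphs

/-- The tree `T_k` for `k ≥ 2`: a path `v_1, …, v_{2k+1}`, where `v_i` is `Sum.inl` of `i - 1`,
with one further leaf attached to each of `v_4, v_6, …, v_{2k-2}`; the leaf `Sum.inr j` hangs at
`v_{2j+4}`. -/
def treeT (k : ℕ) : SimpleGraph (Fin (2 * k + 1) ⊕ Fin (k - 2)) :=
  SimpleGraph.fromRel fun x y =>
    match x, y with
    | Sum.inl a, Sum.inl b => a.val + 1 = b.val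
    | Sum.inl a, Sum.inr j => a.val = 2 * j.val + 3
    | Sum.inr _, _ => False

/-! ### The family of extremal graphs -/

/-- `B` is obtained from (disjoint copies of) `B'` and `B₁` by identifying the edge `ab` of `B'`
with the edge `cd` of `B₁`, where `a` is identified with `c` and `b` with `d`. -/
def IsEdgeGluing {U W V : Type u} (B' : SimpleGraph U) (a b : U) (B₁ : SimpleGraph W) (c d : W)
    (B : SimpleGraph V) : Prop :=
  ∃ (f : U ↪ V) (g : W ↪ V), f a = g c ∧ f b = g d ∧
    Set.range f ∪ Set.range g = Set.univ ∧
    Set.range f ∩ Set.range g = {f a, f b} ∧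
    B = B'.map f ⊔ B₁.map g

/-- `B₁` is a catacondensed benzenoid graph with three hexagons, and `h` is a hexagon of it that
is adjacent to the two others and angular. -/
def IsAngularTriple {W : Type u} (B₁ : SimpleGraph W) (h : Hexagon B₁) : Prop :=
  IsCatacondensed B₁ ∧ numHexagons B₁ = 3 ∧ IsAngular B₁ h

/-- The family of extremal graphs, closed under isomorphism. -/
inductive InFamily : ∀ {V : Type u}, SimpleGraph V → Prop
  | one {V : Type u} (B : SimpleGraph V) (hB : IsCatacondensed B) (hn : numHexagons B = 1) :
      InFamily B
  | two {V : Type u} (B : SimpleGraph V) (hB : IsCatacondensed B) (hn : numHexagons B = 2) :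
      InFamily B
  | three {V : Type u} (B : SimpleGraph V) (h : Hexagon B) (hB : IsAngularTriple B h) :
      InFamily B
  | tree {V : Type u} (B : SimpleGraph V) (hB : IsCatacondensed B) (k : ℕ) (hk : 2 ≤ k)
      (φ : treeT k ≃g dualist B)
      (h_first : IsAngular B (φ (Sum.inl ⟨1, by omega⟩)))
      (h_last : IsAngular B (φ (Sum.inl ⟨2 * k - 1, by omega⟩))) :
      InFamily B
  | glue {U W V : Type u} (B' : SimpleGraph U) (hB' : IsCatacondensed B') (hmem : InFamily B')
      (a b : U) (hab : B'.Adj a b) (ha : HasDegreeTwo B' a) (hb : HasDegreeTwo B' b)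
      (B₁ : SimpleGraph W) (h : Hexagon B₁) (hB₁ : IsAngularTriple B₁ h)
      (c d : W) (hcd : h.1.Adj c d) (hc : HasDegreeTwo B₁ c) (hd : HasDegreeTwo B₁ d)
      (B : SimpleGraph V) (hB : IsEdgeGluing B' a b B₁ c d B) :
      InFamily B

end Benzenoid

/-! The upper bound needs only two facts: the dualist graph is a tree of maximum degree at most 3,
and a resonant set `C` is independent in it. Give each hexagon `x` outside `C` the slack 2(3 - deg
x) plus the number of its neighbours outside `C`. An edge of the tree lowers the total of 6(n - |C|)
by 2, whether one or both of its ends lie outside `C`. So the slacks sum to 2(2n + 1 - 3|C|)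
(`sum_slack`), and they are nonnegative.

In the case of equality the total slack is at most 4. If some hexagon with three neighbours has two
leaves among them, the graph is cut along the edge to the third neighbour. This splits off an
angular triple; `C` loses at most two members and a parity argument restricts the perfect matching
to the other side, so induction applies (`IsCatacondensed.exists_gluing`). Otherwise each end of the
tree pruned of its leaves has degree 2 and carries one leaf. There are at least two such ends, each
must lie outside `C`, and each uses slack 2. Hence there are exactly two, the pruned tree is a path
along which membership in `C` alternates, and the tree is some T_k (`exists_ends`,
`exists_iso_treeT_of_isTree`). Here the matching enters: a hexagon with exactly two neighbours, both
in `C`, is angular (`IsCatacondensed.isAngular_of_isResonant`).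

Conversely, in T_k the hexagons other than v_2, v_4, …, v_{2k} form a resonant set of the right
size, and gluing an angular triple adds two hexagons to a resonant set while n grows by 3.

Planarity is used through homology modulo 2: on the sphere every cycle is the boundary of a set of
faces (`RotationSystem.IsSpherical.exists_potential`). It follows that every edge lies in a hexagon
and that two hexagons with a common vertex share an edge there. With Euler's formula and
inclusion-exclusion this makes the dualist graph a tree. The two sides of a cut are recognised as
catacondensed by counting: a 2-connected induced subgraph has at most E - V + 1 hexagons, and
equality makes it catacondensed (`IsCatacondensed.induce`). -/

namespace Benzenoid

/-! ### Hexagons and their cyclic labellings -/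

section HexagonBasics

variable {V : Type u} {G : SimpleGraph V}

theorem cycleGraph_six_adj (i j : Fin 6) :
    (SimpleGraph.cycleGraph 6).Adj i j ↔ (j = i + 1 ∨ i = j + 1) := by
  rw [SimpleGraph.cycleGraph_adj]
  revert i j; decide

/-- A cyclic labelling of the vertices of a hexagonal subgraph. -/
theorem exists_labelling {H : G.Subgraph} (hH : Nonempty (H.coe ≃g SimpleGraph.cycleGraph 6)) :
    ∃ p : Fin 6 → V, Function.Injective p ∧ H.verts = Set.range p ∧
      ∀ i j, H.Adj (p i) (p j) ↔ (j = i + 1 ∨ i = j + 1) := by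
  obtain ⟨φ⟩ := hH
  refine ⟨fun i => (φ.symm i : V), ?_, ?_, ?_⟩
  · exact Subtype.val_injective.comp φ.symm.injective
  · ext x
    constructor
    · intro hx
      exact ⟨φ ⟨x, hx⟩, by simp⟩
    · rintro ⟨i, rfl⟩
      exact (φ.symm i).2
  · intro i j
    rw [← cycleGraph_six_adj, ← φ.symm.map_adj_iff]
    rfl

/-- A subgraph with a cyclic labelling by `Fin 6` is a cycle of length 6. -/
theorem nonempty_iso_cycleGraph_six {H : G.Subgraph} (p : Fin 6 → V) (hp : Function.Injective p)
    (hv : H.verts = Set.range p)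
    (ha : ∀ i j, H.Adj (p i) (p j) ↔ (j = i + 1 ∨ i = j + 1)) :
    Nonempty (H.coe ≃g SimpleGraph.cycleGraph 6) := by
  have hmem : ∀ i, p i ∈ H.verts := fun i => hv ▸ ⟨i, rfl⟩
  let e : Fin 6 ≃ H.verts := Equiv.ofBijective (fun i => ⟨p i, hmem i⟩) ⟨fun i j h =>
    hp (congrArg Subtype.val h), by
      rintro ⟨x, hx⟩
      obtain ⟨i, rfl⟩ := hv ▸ hx
      exact ⟨i, rfl⟩⟩
  refine ⟨SimpleGraph.Iso.symm ⟨e, ?_⟩⟩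
  intro i j
  rw [cycleGraph_six_adj, ← ha]
  rfl

instance [Finite V] : Finite (Hexagon G) := by
  unfold Hexagon; infer_instance

theorem Hexagon.ext {h h' : Hexagon G} (e : h.1 = h'.1) : h = h' := Subtype.ext e

theorem Hexagon.ncard_verts (h : Hexagon G) : h.1.verts.ncard = 6 := by
  obtain ⟨p, hp, hv, -⟩ := exists_labelling h.2
  rw [hv, ← Set.image_univ, Set.ncard_image_of_injective _ hp, Set.ncard_univ]
  simp

theorem edgeSet_eq_range_of_labelling {H : G.Subgraph} {p : Fin 6 → V}
    (hv : H.verts = Set.range p)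
    (ha : ∀ i j, H.Adj (p i) (p j) ↔ (j = i + 1 ∨ i = j + 1)) :
    H.edgeSet = Set.range fun i => s(p i, p (i + 1)) := by
  ext e
  induction e with | _ x y => ?_
  rw [SimpleGraph.Subgraph.mem_edgeSet]
  constructor
  · intro h
    obtain ⟨i, rfl⟩ := hv ▸ H.edge_vert h
    obtain ⟨j, rfl⟩ := hv ▸ H.edge_vert h.symm
    rcases (ha i j).1 h with rfl | rfl
    · exact ⟨i, rfl⟩
    · exact ⟨j, Sym2.eq_swap⟩
  · rintro ⟨i, hi⟩
    have : H.Adj (p i) (p (i + 1)) := (ha _ _).2 (Or.inl rfl)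
    rw [← SimpleGraph.Subgraph.mem_edgeSet] at this ⊢
    rwa [← hi]

theorem injective_edge_of_labelling {p : Fin 6 → V} (hp : Function.Injective p) :
    Function.Injective fun i => s(p i, p (i + 1)) := by
  intro i j hij
  simp only [Sym2.eq_iff] at hij
  rcases hij with ⟨h, -⟩ | ⟨h, h'⟩
  · exact hp h
  · have h1 := hp h
    have h2 := hp h'
    subst h1
    exact absurd h2 ((by decide : ∀ j : Fin 6, j + 1 + 1 ≠ j) j)

theorem Hexagon.ncard_edgeSet (h : Hexagon G) : h.1.edgeSet.ncard = 6 := by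
  obtain ⟨p, hp, hv, ha⟩ := exists_labelling h.2
  rw [edgeSet_eq_range_of_labelling hv ha, ← Set.image_univ,
    Set.ncard_image_of_injective _ (injective_edge_of_labelling hp), Set.ncard_univ]
  simp

/-- Every vertex of a hexagon has exactly two neighbours in it. -/
theorem exists_neighbors_of_labelling {H : G.Subgraph} {p : Fin 6 → V}
    (hp : Function.Injective p) (hv : H.verts = Set.range p)
    (ha : ∀ i j, H.Adj (p i) (p j) ↔ (j = i + 1 ∨ i = j + 1)) {x : V} (hx : x ∈ H.verts) :
    ∃ y z, y ≠ z ∧ ∀ w, H.Adj x w ↔ w = y ∨ w = z := by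
  obtain ⟨i, rfl⟩ := hv ▸ hx
  refine ⟨p (i + 1), p (i - 1), ?_, fun w => ?_⟩
  · intro h
    exact absurd (hp h) ((by decide : ∀ i : Fin 6, i + 1 ≠ i - 1) i)
  · constructor
    · intro h
      obtain ⟨j, rfl⟩ := hv ▸ H.edge_vert h.symm
      rcases (ha i j).1 h with rfl | rfl
      · exact Or.inl rfl
      · exact Or.inr (congrArg p ((by decide : ∀ j : Fin 6, j = j + 1 - 1) j))
    · rintro (rfl | rfl)
      · exact (ha _ _).2 (Or.inl rfl)
      · exact (ha _ _).2 (Or.inr ((by decide : ∀ i : Fin 6, i = i - 1 + 1) i))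

theorem Hexagon.exists_neighbors (h : Hexagon G) {x : V} (hx : x ∈ h.1.verts) :
    ∃ y z, y ≠ z ∧ ∀ w, h.1.Adj x w ↔ w = y ∨ w = z := by
  obtain ⟨p, hp, hv, ha⟩ := exists_labelling h.2
  exact exists_neighbors_of_labelling hp hv ha hx

theorem Hexagon.exists_adj (h : Hexagon G) {x : V} (hx : x ∈ h.1.verts) : ∃ y, h.1.Adj x y := by
  obtain ⟨y, z, -, hyz⟩ := h.exists_neighbors hx
  exact ⟨y, (hyz y).2 (Or.inl rfl)⟩

theorem Hexagon.exists_adj_ne (h : Hexagon G) {x : V} (hx : x ∈ h.1.verts) (w : V) :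
    ∃ y, y ≠ w ∧ h.1.Adj x y := by
  obtain ⟨y, z, hne, hyz⟩ := h.exists_neighbors hx
  by_cases hy : y = w
  · exact ⟨z, fun hz => hne (hy.trans hz.symm), (hyz z).2 (Or.inr rfl)⟩
  · exact ⟨y, hy, (hyz y).2 (Or.inl rfl)⟩

theorem Hexagon.eq_or_eq_of_adj (h : Hexagon G) {x y z w : V} (hy : h.1.Adj x y)
    (hz : h.1.Adj x z) (hne : y ≠ z) (hw : h.1.Adj x w) : w = y ∨ w = z := by
  obtain ⟨a, b, -, hab⟩ := h.exists_neighbors (h.1.edge_vert hy)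
  rw [hab] at hy hz hw
  grind

theorem Hexagon.nonempty_verts (h : Hexagon G) : h.1.verts.Nonempty := by
  obtain ⟨p, hp, hv, ha⟩ := exists_labelling h.2
  exact ⟨p 0, hv ▸ ⟨0, rfl⟩⟩

theorem Hexagon.not_verts_subset_pair (h : Hexagon G) {a b : V} :
    ¬ h.1.verts ⊆ {a, b} := by
  intro hs
  have h1 := Set.ncard_le_ncard hs (Set.toFinite _)
  have h2 := Set.ncard_insert_le a {b}
  rw [h.ncard_verts] at h1
  simp at h2
  omega

end HexagonBasics

/-! ### Faces of a rotation system -/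

section Faces

variable {V : Type u} {G : SimpleGraph V}

namespace RotationSystem

theorem faceOf_facePerm (R : RotationSystem G) (d : G.Dart) :
    R.faceOf (R.facePerm d) = R.faceOf d :=
  Quotient.sound (s := Equiv.Perm.SameCycle.setoid R.facePerm)
    (Equiv.Perm.sameCycle_apply_left.2 (Equiv.Perm.SameCycle.refl _ _))

theorem facePerm_apply (R : RotationSystem G) (d : G.Dart) : R.facePerm d = R.next d.symm := rfl

/-- `next d` is the face-tracing successor of `d.symm`. Thus the two sides of an edge can be read
off from consecutive darts at one vertex. -/
theorem faceOf_next (R : RotationSystem G) (d : G.Dart) :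
    R.faceOf (R.next d) = R.faceOf d.symm := by
  rw [← R.faceOf_facePerm d.symm, facePerm_apply, SimpleGraph.Dart.symm_symm]

end RotationSystem

/-- In a connected graph, a function on the faces that agrees on both sides of every edge is
constant. -/
theorem RotationSystem.eq_of_forall_symm (R : RotationSystem G) (hG : G.Connected) {α : Type*}
    (ψ : R.Face → α) (h : ∀ d, ψ (R.faceOf d) = ψ (R.faceOf d.symm)) (f f' : R.Face) :
    ψ f = ψ f' := by
  have hnext : ∀ d, ψ (R.faceOf (R.next d)) = ψ (R.faceOf d) := fun d => by
    rw [R.faceOf_next, ← h]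
  have hpow : ∀ (k : ℤ) d, ψ (R.faceOf ((R.next ^ k) d)) = ψ (R.faceOf d) := by
    intro k
    induction k with
    | zero => simp
    | succ k ih => intro d; rw [zpow_add_one, Equiv.Perm.mul_apply, ih, hnext]
    | pred k ih =>
      intro d
      rw [zpow_sub_one, Equiv.Perm.mul_apply, ih, ← hnext (R.next⁻¹ d)]
      simp
  have hfst : ∀ d e : G.Dart, d.fst = e.fst → ψ (R.faceOf d) = ψ (R.faceOf e) := by
    intro d e hde
    obtain ⟨k, rfl⟩ := R.sameCycle_of_fst_eq d e hde
    rw [hpow]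
  have hreach : ∀ x y : V, G.Reachable x y → ∀ d e : G.Dart, d.fst = x → e.fst = y →
      ψ (R.faceOf d) = ψ (R.faceOf e) := by
    rintro x y ⟨w⟩
    induction w with
    | nil => exact fun d e hd he => hfst d e (hd.trans he.symm)
    | cons hadj _ ih =>
      intro d e hd he
      rw [hfst d ⟨(_, _), hadj⟩ hd, h]
      exact ih _ e rfl he
  induction f using Quotient.inductionOn with | _ d => ?_
  induction f' using Quotient.inductionOn with | _ e => ?_
  exact hreach d.fst e.fst (hG.preconnected _ _) d e rfl rfl

end Faces

/-! ### Homology modulo 2 of a rotation system -/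

section Homology

variable {V : Type u} {G : SimpleGraph V} [Fintype V] [DecidableEq V] [DecidableRel G.Adj]

/-- The boundary map from 1-chains to 0-chains modulo 2. -/
def edgeBoundary (G : SimpleGraph V) [DecidableRel G.Adj] :
    (G.edgeSet → ZMod 2) →ₗ[ZMod 2] (V → ZMod 2) where
  toFun c x := ∑ d : G.Dart with d.fst = x, c ⟨d.edge, d.edge_mem⟩
  map_add' c c' := by ext x; simp [Finset.sum_add_distrib]
  map_smul' r c := by ext x; simp [Finset.mul_sum]

/-- The boundary map from 2-chains to 1-chains modulo 2. -/
def faceBoundary (R : RotationSystem G) :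
    (R.Face → ZMod 2) →ₗ[ZMod 2] (G.edgeSet → ZMod 2) where
  toFun ψ e := ∑ d : G.Dart with d.edge = (e : Sym2 V), ψ (R.faceOf d)
  map_add' ψ ψ' := by ext x; simp [Finset.sum_add_distrib]
  map_smul' r ψ := by ext x; simp [Finset.mul_sum]


theorem faceBoundary_apply (R : RotationSystem G) (ψ : R.Face → ZMod 2) (d : G.Dart) :
    faceBoundary R ψ ⟨d.edge, d.edge_mem⟩ = ψ (R.faceOf d) + ψ (R.faceOf d.symm) := by
  simp only [faceBoundary, LinearMap.coe_mk, AddHom.coe_mk]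
  rw [SimpleGraph.Dart.edge_fiber, Finset.sum_pair d.symm_ne.symm]

/-- The faces on the two sides of `d` are those of `d` and of `next d`. Over the darts at one
vertex, the second terms are a permutation of the first, so everything cancels modulo 2. -/
theorem edgeBoundary_faceBoundary (R : RotationSystem G) (ψ : R.Face → ZMod 2) :
    edgeBoundary G (faceBoundary R ψ) = 0 := by
  ext x
  simp only [edgeBoundary, LinearMap.coe_mk, AddHom.coe_mk, Pi.zero_apply, faceBoundary_apply,
    ← R.faceOf_next]
  rw [Finset.sum_add_distrib]
  have : ∑ d : G.Dart with d.fst = x, ψ (R.faceOf (R.next d)) =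
      ∑ d : G.Dart with d.fst = x, ψ (R.faceOf d) :=
    Finset.sum_equiv R.next (by simp [R.fst_next]) (fun _ _ => rfl)
  rw [this]
  exact CharTwo.add_self_eq_zero _

theorem chain_add_self {α : Type*} (f : α → ZMod 2) : f + f = 0 :=
  funext fun x => CharTwo.add_self_eq_zero (f x)

theorem edgeBoundary_single {x y : V} (hxy : G.Adj x y) :
    edgeBoundary G (Pi.single ⟨s(x, y), G.mem_edgeSet.2 hxy⟩ 1) = Pi.single x 1 + Pi.single y 1 := by
  ext z
  simp only [edgeBoundary, LinearMap.coe_mk, AddHom.coe_mk, Pi.add_apply, Pi.single_apply,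
    Subtype.mk.injEq]
  rw [Finset.sum_filter]
  simp only [← ite_and]
  have key : ∀ d : G.Dart, (if d.fst = z ∧ d.edge = s(x, y) then (1 : ZMod 2) else 0) =
      (if d = ⟨(x, y), hxy⟩ then (if z = x then 1 else 0) else 0) +
      (if d = ⟨(y, x), hxy.symm⟩ then (if z = y then 1 else 0) else 0) := by
    intro d
    have hne := hxy.ne
    have e1 : d = ⟨(x, y), hxy⟩ ↔ d.toProd = (x, y) := SimpleGraph.Dart.ext_iff _ _
    have e2 : d = ⟨(y, x), hxy.symm⟩ ↔ d.toProd = (y, x) := SimpleGraph.Dart.ext_iff _ _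
    simp only [e1, e2, SimpleGraph.dart_edge_eq_mk'_iff]
    have : d.fst = d.toProd.1 := rfl
    generalize d.toProd = q at *
    obtain ⟨a, b⟩ := q
    simp only [Prod.mk.injEq]
    grind
  rw [Finset.sum_congr rfl fun d _ => key d, Finset.sum_add_distrib]
  simp

/-- Reachability along edges avoiding a set of edges `E` provides a chain avoiding `E` whose
boundary consists of the two ends. -/
theorem exists_chain_of_reachable {G' : SimpleGraph V} (hle : G' ≤ G) {x y : V}
    (h : G'.Reachable x y) :
    ∃ c : G.edgeSet → ZMod 2, edgeBoundary G c = Pi.single x 1 + Pi.single y 1 ∧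
      ∀ e : G.edgeSet, (e : Sym2 V) ∉ G'.edgeSet → c e = 0 := by
  obtain ⟨w⟩ := h
  induction w with
  | nil => exact ⟨0, by rw [map_zero, chain_add_self], fun _ _ => rfl⟩
  | @cons u v t hadj _ ih =>
    obtain ⟨c, hc, hc'⟩ := ih
    refine ⟨Pi.single ⟨s(u, v), G.mem_edgeSet.2 (hle hadj)⟩ 1 + c, ?_, ?_⟩
    · rw [map_add, hc, edgeBoundary_single (hle hadj)]
      calc _ = (Pi.single u 1 + Pi.single t 1 : V → ZMod 2) +
            (Pi.single v 1 + Pi.single v 1) := by abel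
        _ = _ := by rw [chain_add_self, add_zero]
    · intro e he
      have : e ≠ ⟨s(u, v), G.mem_edgeSet.2 (hle hadj)⟩ := by
        rintro rfl
        exact he hadj
      simp [this, hc' e he]

/-- By connectedness, any `Pi.single x 1` differs from a fixed `Pi.single x₀ 1` by the boundary of a
path, so the range has codimension at most 1. -/
theorem card_le_finrank_range_edgeBoundary (hG : G.Connected) :
    Fintype.card V ≤ Module.finrank (ZMod 2) (LinearMap.range (edgeBoundary G)) + 1 := by
  obtain ⟨x₀⟩ := hG.nonempty
  set S := LinearMap.range (edgeBoundary G) ⊔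
    Submodule.span (ZMod 2) {(Pi.single x₀ 1 : V → ZMod 2)} with hS
  have hmem : ∀ x, (Pi.single x 1 : V → ZMod 2) ∈ S := by
    intro x
    obtain ⟨c, hc, -⟩ := exists_chain_of_reachable (le_refl G) (hG.preconnected x x₀)
    have : (Pi.single x 1 : V → ZMod 2) = edgeBoundary G c + Pi.single x₀ 1 := by
      rw [hc, add_assoc, chain_add_self, add_zero]
    rw [this]
    exact add_mem (Submodule.mem_sup_left ⟨c, rfl⟩)
      (Submodule.mem_sup_right (Submodule.mem_span_singleton_self _))
  have htop : S = ⊤ := by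
    rw [eq_top_iff]
    intro f _
    rw [pi_eq_sum_univ' f]
    exact sum_mem fun x _ => S.smul_mem _ (by simpa [Pi.single_apply, funext_iff, Pi.single] using hmem x)
  have h1 := Submodule.finrank_add_le_finrank_add_finrank (LinearMap.range (edgeBoundary G))
    (Submodule.span (ZMod 2) {(Pi.single x₀ 1 : V → ZMod 2)})
  rw [← hS, htop, finrank_top, Module.finrank_fintype_fun_eq_card] at h1
  have h2 := finrank_span_le_card (R := ZMod 2) {(Pi.single x₀ 1 : V → ZMod 2)}
  simp at h2
  omega

theorem finrank_ker_edgeBoundary_le (hG : G.Connected) :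
    Module.finrank (ZMod 2) (LinearMap.ker (edgeBoundary G)) + Fintype.card V ≤
      Nat.card G.edgeSet + 1 := by
  have h1 := LinearMap.finrank_range_add_finrank_ker (edgeBoundary G)
  have h2 := card_le_finrank_range_edgeBoundary hG
  rw [Module.finrank_fintype_fun_eq_card, ← Nat.card_eq_fintype_card] at h1
  omega

/-- A 2-chain with zero boundary agrees on both sides of every edge and is therefore constant, so
the kernel has dimension at most 1. -/
theorem card_face_le_finrank_range (R : RotationSystem G) (hG : G.Connected) :
    Nat.card R.Face ≤ Module.finrank (ZMod 2) (LinearMap.range (faceBoundary R)) + 1 := by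
  have : Fintype R.Face := Fintype.ofFinite _
  have h1 := LinearMap.finrank_range_add_finrank_ker (faceBoundary R)
  rw [Module.finrank_fintype_fun_eq_card, ← Nat.card_eq_fintype_card] at h1
  have h2 : LinearMap.ker (faceBoundary R) ≤
      Submodule.span (ZMod 2) {(fun _ => 1 : R.Face → ZMod 2)} := by
    intro ψ hψ
    have hc := R.eq_of_forall_symm hG ψ (fun d => by
      have := congrFun (LinearMap.mem_ker.1 hψ) ⟨d.edge, d.edge_mem⟩
      rw [faceBoundary_apply] at this
      exact CharTwo.add_eq_zero.1 this)
    rw [Submodule.mem_span_singleton]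
    rcases isEmpty_or_nonempty R.Face with hE | ⟨⟨f⟩⟩
    · exact ⟨0, funext fun f => hE.elim f⟩
    · exact ⟨ψ f, funext fun f' => by simp [hc f f']⟩
  have h3 := Submodule.finrank_mono h2
  have h4 := finrank_span_le_card (R := ZMod 2) {(fun _ => 1 : R.Face → ZMod 2)}
  simp at h4
  omega

theorem range_faceBoundary_le (R : RotationSystem G) :
    LinearMap.range (faceBoundary R) ≤ LinearMap.ker (edgeBoundary G) := by
  rintro _ ⟨ψ, rfl⟩
  exact edgeBoundary_faceBoundary R ψ

/-- On the sphere, every cycle modulo 2 bounds a set of faces. -/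
theorem RotationSystem.IsSpherical.exists_potential {R : RotationSystem G} (hR : R.IsSpherical)
    (hG : G.Connected) {c : G.edgeSet → ZMod 2} (hc : edgeBoundary G c = 0) :
    ∃ ψ : R.Face → ZMod 2, ∀ d : G.Dart,
      c ⟨d.edge, d.edge_mem⟩ = ψ (R.faceOf d) + ψ (R.faceOf d.symm) := by
  have h2 := card_face_le_finrank_range R hG
  have h3 := finrank_ker_edgeBoundary_le hG
  unfold IsSpherical at hR
  rw [Nat.card_eq_fintype_card (α := V)] at hR
  -- Euler's formula gives dim ker ≤ E - V + 1 = F - 1 ≤ dim range, so every cycle is a boundary.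
  have heq := Submodule.eq_of_le_of_finrank_le (range_faceBoundary_le R) (by omega)
  have : c ∈ LinearMap.range (faceBoundary R) := heq ▸ LinearMap.mem_ker.2 hc
  obtain ⟨ψ, rfl⟩ := this
  exact ⟨ψ, faceBoundary_apply R ψ⟩

end Homology

/-- The Euler characteristic of a connected rotation system is at most 2. -/
theorem RotationSystem.card_face_add_card_le {V : Type u} {G : SimpleGraph V} [Finite V]
    (R : RotationSystem G)
    (hG : G.Connected) : Nat.card R.Face + Nat.card V ≤ Nat.card G.edgeSet + 2 := by
  classical
  have : Fintype V := Fintype.ofFinite V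
  have h1 := Submodule.finrank_mono (range_faceBoundary_le R)
  have h2 := card_face_le_finrank_range R hG
  have h3 := finrank_ker_edgeBoundary_le hG
  rw [Nat.card_eq_fintype_card (α := V)]
  omega

/-! ### 2-connected graphs -/

section TwoConnected

variable {V : Type u} {G : SimpleGraph V}

theorem IsTwoConnected.exists_adj_ne (h : IsTwoConnected G) {x u : V} (hxu : x ≠ u) :
    ∃ y, y ≠ u ∧ G.Adj x y := by
  obtain ⟨hcard, -, hconn⟩ := h
  have : ∃ z, z ≠ x ∧ z ≠ u := by
    by_contra! hcon
    have hs : (Set.univ : Set V) ⊆ {x, u} := fun z _ => by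
      by_cases hz : z = x
      · exact Or.inl hz
      · exact Or.inr (hcon z hz)
    have h1 := Set.ncard_le_ncard hs (Set.toFinite _)
    rw [Set.ncard_univ, Set.ncard_pair hxu] at h1
    omega
  obtain ⟨z, hzx, hzu⟩ := this
  obtain ⟨w⟩ := (hconn u).preconnected ⟨x, hxu⟩ ⟨z, hzu⟩
  cases w with
  | nil => exact absurd rfl hzx
  | @cons _ v _ hadj _ => exact ⟨v, v.2, hadj⟩

theorem IsTwoConnected.exists_adj (h : IsTwoConnected G) (x : V) : ∃ y, G.Adj x y := by
  have : ∃ u, x ≠ u := by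
    by_contra! hcon
    have h1 := h.1
    have : Subsingleton V := ⟨fun a b => (hcon a).symm.trans (hcon b)⟩
    have := Finite.card_le_one_iff_subsingleton.2 this
    omega
  obtain ⟨u, hu⟩ := this
  obtain ⟨y, -, hy⟩ := h.exists_adj_ne hu
  exact ⟨y, hy⟩

/-- A fixed dart would be the only one at its source, but 2-connectedness gives a second neighbour
there. Consequently face tracing never turns back along the edge it came by. -/
theorem RotationSystem.next_ne (R : RotationSystem G) (h : IsTwoConnected G) (d : G.Dart) :
    R.next d ≠ d := by
  intro hd
  obtain ⟨y, hy, hadj⟩ := h.exists_adj_ne d.fst_ne_snd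
  obtain ⟨k, hk⟩ := R.sameCycle_of_fst_eq d ⟨(d.fst, y), hadj⟩ rfl
  rw [Equiv.Perm.zpow_apply_eq_self_of_apply_eq_self hd] at hk
  exact hy (congrArg (fun e : G.Dart => e.snd) hk).symm

/-- A cycle modulo 2 that uses two prescribed edges at a vertex and no other edge there. -/
theorem IsTwoConnected.exists_cycle [Fintype V] [DecidableEq V] [DecidableRel G.Adj]
    (h : IsTwoConnected G) {x y z : V} (hy : G.Adj x y) (hz : G.Adj x z) (hyz : y ≠ z) :
    ∃ c : G.edgeSet → ZMod 2, edgeBoundary G c = 0 ∧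
      ∀ w (hw : G.Adj x w), c ⟨s(x, w), G.mem_edgeSet.2 hw⟩ = if w = y ∨ w = z then 1 else 0 := by
  -- The cycle is a path from `y` to `z` that avoids `x`, closed up by the edges `xy` and `xz`.
  set G' : SimpleGraph V := (G.induce {x}ᶜ).spanningCoe with hG'
  have hle : G' ≤ G := G.spanningCoe_induce_le _
  have hreach : G'.Reachable y z :=
    ((h.2.2 x).preconnected ⟨y, hy.ne'⟩ ⟨z, hz.ne'⟩).map
      (SimpleGraph.Embedding.spanningCoe (G.induce {x}ᶜ)).toHom
  obtain ⟨c, hc, hc'⟩ := exists_chain_of_reachable hle hreach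
  have hx : ∀ w (hw : G.Adj x w), c ⟨s(x, w), G.mem_edgeSet.2 hw⟩ = 0 := by
    intro w hw
    apply hc'
    rw [SimpleGraph.mem_edgeSet, hG', SimpleGraph.map_adj]
    rintro ⟨a, b, -, ha, -⟩
    exact a.2 ha
  refine ⟨c + Pi.single ⟨s(x, y), G.mem_edgeSet.2 hy⟩ 1 +
    Pi.single ⟨s(x, z), G.mem_edgeSet.2 hz⟩ 1, ?_, ?_⟩
  · rw [map_add, map_add, hc, edgeBoundary_single hy, edgeBoundary_single hz]
    calc _ = (Pi.single x 1 + Pi.single x 1 : V → ZMod 2) + (Pi.single y 1 + Pi.single y 1) +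
          (Pi.single z 1 + Pi.single z 1) := by abel
      _ = 0 := by simp only [chain_add_self, add_zero]
  · intro w hw
    have hinj : ∀ t, s(x, w) = s(x, t) ↔ w = t := fun t => Sym2.congr_right
    simp only [Pi.add_apply, hx w hw, Pi.single_apply, Subtype.mk.injEq, hinj, zero_add]
    grind

end TwoConnected

/-! ### Inner faces correspond to hexagons -/

section Faces

variable {V : Type u} {G : SimpleGraph V}

theorem RotationSystem.mem_edgeSet_boundary (R : RotationSystem G) (f : R.Face) (d : G.Dart) :
    d.edge ∈ (R.boundary f).edgeSet ↔ R.faceOf d = f ∨ R.faceOf d.symm = f := by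
  have : d.edge = s(d.fst, d.snd) := rfl
  rw [this, SimpleGraph.Subgraph.mem_edgeSet]
  constructor
  · rintro ⟨d', hd', he⟩
    rcases (SimpleGraph.dart_edge_eq_iff d' d).1 he with rfl | rfl
    · exact Or.inl hd'
    · exact Or.inr hd'
  · rintro (h | h)
    · exact ⟨d, h, rfl⟩
    · exact ⟨d.symm, h, d.edge_symm⟩

/-- Face tracing runs along a hexagonal face in one direction only. -/
theorem RotationSystem.faceOf_symm_ne (R : RotationSystem G) (hnext : ∀ d, R.next d ≠ d)
    {f : R.Face} (hf : Nonempty ((R.boundary f).coe ≃g SimpleGraph.cycleGraph 6))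
    {d : G.Dart} (hd : R.faceOf d = f) : R.faceOf d.symm ≠ f := by
  obtain ⟨p, hp, hv, ha⟩ := exists_labelling hf
  -- `P` says that a dart runs in the direction of increasing labels. As face tracing does not turn
  -- back, `P` is invariant along the face, whereas a dart and its reverse disagree about it.
  let P : G.Dart → Prop := fun d => ∃ i, d.fst = p i ∧ d.snd = p (i + 1)
  have hcases : ∀ d, R.faceOf d = f → ∃ i, (d.fst = p i ∧ d.snd = p (i + 1)) ∨
      (d.snd = p i ∧ d.fst = p (i + 1)) := by
    intro d hd
    have hadj : (R.boundary f).Adj d.fst d.snd := ⟨d, hd, rfl⟩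
    have h1 := (R.boundary f).edge_vert hadj
    have h2 := (R.boundary f).edge_vert hadj.symm
    rw [hv] at h1 h2
    obtain ⟨i, hi⟩ := h1
    obtain ⟨j, hj⟩ := h2
    rw [← hi, ← hj, ha] at hadj
    rcases hadj with rfl | rfl
    · exact ⟨i, Or.inl ⟨hi.symm, hj.symm⟩⟩
    · exact ⟨j, Or.inr ⟨hj.symm, hi.symm⟩⟩
  have hnot : ∀ i j : Fin 6, p i = p (j + 1) → p (i + 1) = p j → False := fun i j h1 h2 =>
    (by decide : ∀ i j : Fin 6, i = j + 1 → i + 1 = j → False) i j (hp h1) (hp h2)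
  have hstep : ∀ d, R.faceOf d = f → (P (R.facePerm d) ↔ P d) := by
    intro d hd
    have hd' : R.faceOf (R.facePerm d) = f := (R.faceOf_facePerm d).trans hd
    have hfst : (R.facePerm d).fst = d.snd := R.fst_next d.symm
    have hsnd : (R.facePerm d).snd ≠ d.fst := by
      intro h
      apply hnext d.symm
      rw [← R.facePerm_apply]
      exact SimpleGraph.Dart.ext _ _ (Prod.ext hfst h)
    obtain ⟨i, hi⟩ := hcases d hd
    obtain ⟨j, hj⟩ := hcases _ hd'
    rw [hfst] at hj
    rcases hi with ⟨hi1, hi2⟩ | ⟨hi1, hi2⟩ <;> rcases hj with ⟨hj1, hj2⟩ | ⟨hj1, hj2⟩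
    · exact ⟨fun _ => ⟨i, hi1, hi2⟩, fun _ => ⟨j, hfst.trans hj1, hj2⟩⟩
    · exfalso
      have := hp (hi2.symm.trans hj2)
      exact hsnd (by rw [hj1, hi1, add_right_cancel this])
    · exfalso
      have := hp (hi1.symm.trans hj1)
      exact hsnd (by rw [hj2, hi2, this])
    · constructor
      · rintro ⟨k, hk1, hk2⟩
        exact (hnot k j (hk1.symm.trans (hfst.trans hj2)) (hk2.symm.trans hj1)).elim
      · rintro ⟨k, hk1, hk2⟩
        exact (hnot k i (hk1.symm.trans hi2) (hk2.symm.trans hi1)).elim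
  have hpow : ∀ (k : ℤ) d, R.faceOf d = f →
      R.faceOf ((R.facePerm ^ k) d) = f ∧ (P ((R.facePerm ^ k) d) ↔ P d) := by
    intro k
    induction k with
    | zero => simp
    | succ k ih =>
      intro d hd
      rw [zpow_add_one, Equiv.Perm.mul_apply]
      have := ih (R.facePerm d) ((R.faceOf_facePerm d).trans hd)
      exact ⟨this.1, this.2.trans (hstep d hd)⟩
    | pred k ih =>
      intro d hd
      rw [zpow_sub_one, Equiv.Perm.mul_apply]
      have hinv : R.facePerm (R.facePerm⁻¹ d) = d := by simp
      have h1 : R.faceOf (R.facePerm⁻¹ d) = f := by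
        rw [← R.faceOf_facePerm, hinv, hd]
      have := ih _ h1
      refine ⟨this.1, this.2.trans ?_⟩
      rw [← hstep _ h1, hinv]
  intro hds
  have hsc : R.facePerm.SameCycle d d.symm :=
    Quotient.exact (s := Equiv.Perm.SameCycle.setoid R.facePerm) (hd.trans hds.symm)
  obtain ⟨k, hk⟩ := hsc
  have hiff := (hpow k d hd).2
  rw [hk] at hiff
  obtain ⟨i, ⟨hi1, hi2⟩ | ⟨hi1, hi2⟩⟩ := hcases d hd
  · obtain ⟨j, hj1, hj2⟩ := hiff.2 ⟨i, hi1, hi2⟩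
    exact hnot i j (hi1.symm.trans hj2) (hi2.symm.trans hj1)
  · obtain ⟨j, hj1, hj2⟩ := hiff.1 ⟨i, hi1, hi2⟩
    exact hnot j i (hj1.symm.trans hi2) (hj2.symm.trans hi1)

/-- Two distinct inner faces have distinct boundaries. -/
theorem RotationSystem.eq_of_boundary_eq (R : RotationSystem G) (hG : G.Connected)
    {f f' outer : R.Face} (hf : f ≠ outer) (hf' : f' ≠ outer)
    (hb : R.boundary f = R.boundary f') : f = f' := by
  by_contra hne
  -- Each boundary edge has `f` on one side and `f'` on the other. The pair is thus closed under
  -- crossing edges, so it would consist of all faces, including `outer`.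
  have key : ∀ d, (R.faceOf d = f ∨ R.faceOf d = f') →
      (R.faceOf d.symm = f ∨ R.faceOf d.symm = f') := by
    intro d hd
    have h1 : d.edge ∈ (R.boundary f).edgeSet := by
      rcases hd with hd | hd
      · exact (R.mem_edgeSet_boundary _ _).2 (Or.inl hd)
      · rw [hb]
        exact (R.mem_edgeSet_boundary _ _).2 (Or.inl hd)
    have h2 := h1
    rw [hb] at h2
    rw [R.mem_edgeSet_boundary] at h1 h2
    grind
  have := R.eq_of_forall_symm hG (fun g => g = f ∨ g = f')
    (fun d => propext ⟨key d, fun h => by simpa using key d.symm h⟩) f outer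
  have h2 : (outer = f ∨ outer = f') := this ▸ Or.inl rfl
  grind

/-- The inner faces of a benzenoid graph correspond to its hexagons. -/
theorem IsBenzenoid.exists_faces (hB : IsBenzenoid G) :
    ∃ (R : RotationSystem G) (outer : R.Face) (F : Hexagon G → R.Face), R.IsSpherical ∧
      Function.Injective F ∧ (∀ f, f ≠ outer ↔ ∃ h, F h = f) ∧
      (∀ h, R.boundary (F h) = h.1) ∧
      (∀ h d, R.faceOf d = F h → R.faceOf d.symm ≠ F h) := by
  obtain ⟨R, outer, hS, hinner, hhex⟩ := hB.exists_embedding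
  choose F hF1 hF2 using hhex
  refine ⟨R, outer, F, hS, ?_, ?_, hF2, ?_⟩
  · intro h h' hh
    apply Hexagon.ext
    rw [← hF2, ← hF2, hh]
  · intro f
    constructor
    · intro hf
      refine ⟨⟨R.boundary f, hinner f hf⟩, ?_⟩
      exact R.eq_of_boundary_eq hB.twoConnected.2.1 (hF1 _) hf (hF2 _)
    · rintro ⟨h, rfl⟩
      exact hF1 h
  · intro h d hd
    exact R.faceOf_symm_ne (R.next_ne hB.twoConnected) (hinner _ (hF1 h)) hd

/-- This is Euler's formula, the faces being the hexagons and the outer face. -/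
theorem IsBenzenoid.card_edgeSet_add_one (hB : IsBenzenoid G) :
    Nat.card G.edgeSet + 1 = Nat.card V + numHexagons G := by
  obtain ⟨R, outer, F, hS, hFinj, hFr, -, -⟩ := hB.exists_faces
  have := hB.finite
  have hcard : Nat.card R.Face = numHexagons G + 1 := by
    have hbij : Function.Bijective (fun o : Option (Hexagon G) => o.elim outer F) := by
      constructor
      · rintro (_ | h) (_ | h') heq
        · rfl
        · exact absurd heq.symm ((hFr _).2 ⟨h', rfl⟩)
        · exact absurd heq ((hFr _).2 ⟨h, rfl⟩)
        · exact congrArg some (hFinj heq)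
      · intro f
        by_cases hf : f = outer
        · exact ⟨none, hf.symm⟩
        · obtain ⟨h, rfl⟩ := (hFr f).1 hf
          exact ⟨some h, rfl⟩
    rw [← Nat.card_congr (Equiv.ofBijective _ hbij), Finite.card_option]
    rfl
  unfold RotationSystem.IsSpherical at hS
  omega

end Faces

/-! ### Local structure at an edge and at a vertex -/

section Local

variable {V : Type u} {G : SimpleGraph V}

/-- Every edge of a benzenoid graph belongs to a hexagon. -/
theorem IsBenzenoid.exists_hexagon_adj (hB : IsBenzenoid G) {x y : V} (hxy : G.Adj x y) :
    ∃ h : Hexagon G, h.1.Adj x y := by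
  classical
  have := hB.finite
  have : Fintype V := Fintype.ofFinite V
  obtain ⟨R, outer, F, hS, hFinj, hFr, hFb, -⟩ := hB.exists_faces
  obtain ⟨z, hz, hxz⟩ := hB.twoConnected.exists_adj_ne hxy.ne
  -- The potential of a cycle through `xy` takes different values on the two sides of `xy`. These
  -- are then different faces, and one of them is not `outer`.
  obtain ⟨c, hc, hcx⟩ := hB.twoConnected.exists_cycle hxy hxz hz.symm
  obtain ⟨ψ, hψ⟩ := hS.exists_potential hB.twoConnected.2.1 hc
  set d : G.Dart := ⟨(x, y), hxy⟩
  have h1 : ψ (R.faceOf d) + ψ (R.faceOf d.symm) = 1 := by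
    rw [← hψ]
    have := hcx y hxy
    simp only [true_or, if_true] at this
    exact this
  have hmem : ∀ h : Hexagon G, d.edge ∈ (R.boundary (F h)).edgeSet → h.1.Adj x y := by
    intro h hd
    rw [hFb] at hd
    exact hd
  by_cases ho : R.faceOf d = outer
  · by_cases ho' : R.faceOf d.symm = outer
    · rw [ho, ho', CharTwo.add_self_eq_zero] at h1
      exact absurd h1 (by decide)
    · obtain ⟨h, hh⟩ := (hFr _).1 ho'
      exact ⟨h, hmem h ((R.mem_edgeSet_boundary _ _).2 (Or.inr hh.symm))⟩
  · obtain ⟨h, hh⟩ := (hFr _).1 ho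
    exact ⟨h, hmem h ((R.mem_edgeSet_boundary _ _).2 (Or.inl hh.symm))⟩

theorem IsBenzenoid.exists_hexagon_mem (hB : IsBenzenoid G) (x : V) :
    ∃ h : Hexagon G, x ∈ h.1.verts := by
  obtain ⟨y, hy⟩ := hB.twoConnected.exists_adj x
  obtain ⟨h, hh⟩ := hB.exists_hexagon_adj hy
  exact ⟨h, h.1.edge_vert hh⟩

theorem IsCatacondensed.eq_or_eq (hB : IsCatacondensed G) {x : V} {h h' k : Hexagon G}
    (hne : h ≠ h') (hx : x ∈ h.1.verts) (hx' : x ∈ h'.1.verts) (hk : x ∈ k.1.verts) :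
    k = h ∨ k = h' := by
  by_contra! hcon
  exact hB.no_internal x ⟨h, h', k, hne, hcon.1.symm, hcon.2.symm, hx, hx', hk⟩

/-- Two hexagons that share a vertex share an edge at this vertex. -/
theorem IsCatacondensed.exists_common_adj (hB : IsCatacondensed G) {x : V} {h h' : Hexagon G}
    (hne : h ≠ h') (hx : x ∈ h.1.verts) (hx' : x ∈ h'.1.verts) :
    ∃ y, h.1.Adj x y ∧ h'.1.Adj x y := by
  classical
  by_contra! hcon
  have hBb := hB.isBenzenoid
  have := hBb.finite
  have : Fintype V := Fintype.ofFinite V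
  obtain ⟨R, outer, F, hS, hFinj, hFr, hFb, hFs⟩ := hBb.exists_faces
  obtain ⟨y, z, hyz, hnb⟩ := h.exists_neighbors hx
  obtain ⟨t, ht⟩ := h'.exists_adj hx'
  have hy := (hnb y).2 (Or.inl rfl)
  have hz := (hnb z).2 (Or.inr rfl)
  have hty : y ≠ t := fun e => hcon t (e ▸ hy) ht
  have htz : z ≠ t := fun e => hcon t (e ▸ hz) ht
  obtain ⟨c, hc, hcx⟩ := hBb.twoConnected.exists_cycle hy.adj_sub ht.adj_sub hty
  obtain ⟨ψ, hψ⟩ := hS.exists_potential hBb.twoConnected.2.1 hc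
  -- Only `h` and `h'` contain `x`, and they share no edge there, so both edges of `h` at `x` have
  -- `h` on one side and the outer face on the other. The cycle must take the same value on `xy` and
  -- `xz`, but at `x` it uses only `xy` and `xt`.
  have key : ∀ w (hw : h.1.Adj x w),
      c ⟨s(x, w), G.mem_edgeSet.2 hw.adj_sub⟩ = ψ (F h) + ψ outer := by
    intro w hw
    set d : G.Dart := ⟨(x, w), hw.adj_sub⟩ with hd
    have hside : ∀ d' : G.Dart, d'.edge = d.edge → R.faceOf d' = F h ∨ R.faceOf d' = outer := by
      intro d' hd'
      by_contra! hcon'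
      obtain ⟨k, hk⟩ := (hFr _).1 hcon'.2
      have hkadj : k.1.Adj x w := by
        have h1 := (R.mem_edgeSet_boundary (F k) d').2 (Or.inl hk.symm)
        rw [hFb, hd'] at h1
        exact h1
      rcases hB.eq_or_eq hne hx hx' (k.1.edge_vert hkadj) with rfl | rfl
      · exact hcon'.1 hk.symm
      · exact hcon w hw hkadj
    have hsum : c ⟨s(x, w), G.mem_edgeSet.2 hw.adj_sub⟩ =
      ψ (R.faceOf d) + ψ (R.faceOf d.symm) := hψ d
    have hin := (R.mem_edgeSet_boundary (F h) d).1 (by rw [hFb]; exact hw)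
    rcases hin with hin | hin
    · have h2 := (hside d.symm d.edge_symm).resolve_left (hFs h d hin)
      rw [hsum, hin, h2]
    · have h2 := (hside d rfl).resolve_left (fun h3 => hFs h d h3 hin)
      rw [hsum, hin, h2, add_comm]
  have h1 := hcx y hy.adj_sub
  have h2 := hcx z hz.adj_sub
  rw [key y hy] at h1
  rw [key z hz, h1] at h2
  simp [hyz.symm, htz] at h2

/-- Two distinct hexagons that share a vertex meet in the ends of an edge common to both. -/
theorem IsCatacondensed.exists_inter_eq (hB : IsCatacondensed G) {x : V} {h h' : Hexagon G}
    (hne : h ≠ h') (hx : x ∈ h.1.verts) (hx' : x ∈ h'.1.verts) :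
    ∃ y, h.1.Adj x y ∧ h'.1.Adj x y ∧ h.1.verts ∩ h'.1.verts = {x, y} ∧
      h.1.edgeSet ∩ h'.1.edgeSet = {s(x, y)} := by
  obtain ⟨y, hy, hy'⟩ := hB.exists_common_adj hne hx hx'
  have huniq : ∃! e : Sym2 V, e ∈ h.1.edgeSet ∧ e ∈ h'.1.edgeSet :=
    (hB.isBenzenoid.disjoint_or_common_edge h h' hne).resolve_left
      (Set.not_disjoint_iff.2 ⟨x, hx, hx'⟩)
  refine ⟨y, hy, hy', ?_, ?_⟩
  · ext z
    constructor
    · rintro ⟨hz, hz'⟩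
      obtain ⟨t, ht, ht'⟩ := hB.exists_common_adj hne hz hz'
      have heq : s(z, t) = s(x, y) := huniq.unique ⟨ht, ht'⟩ ⟨hy, hy'⟩
      have : z ∈ s(x, y) := heq ▸ Sym2.mem_mk_left z t
      simpa using this
    · rintro (rfl | rfl)
      · exact ⟨hx, hx'⟩
      · exact ⟨h.1.edge_vert hy.symm, h'.1.edge_vert hy'.symm⟩
  · ext e
    constructor
    · rintro ⟨he, he'⟩
      exact huniq.unique ⟨he, he'⟩ ⟨hy, hy'⟩
    · rintro rfl
      exact ⟨hy, hy'⟩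

theorem dualist_adj_of_mem (hB : IsBenzenoid G) {x : V} {h h' : Hexagon G}
    (hne : h ≠ h') (hx : x ∈ h.1.verts) (hx' : x ∈ h'.1.verts) : (dualist G).Adj h h' := by
  refine ⟨hne, ?_⟩
  obtain ⟨e, he, -⟩ := (hB.disjoint_or_common_edge h h' hne).resolve_left
      (Set.not_disjoint_iff.2 ⟨x, hx, hx'⟩)
  exact ⟨e, he⟩

theorem exists_adj_of_dualist_adj {h h' : Hexagon G} (hadj : (dualist G).Adj h h') :
    ∃ x y, h.1.Adj x y ∧ h'.1.Adj x y := by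
  obtain ⟨-, e, he, he'⟩ := hadj
  induction e with | _ x y => exact ⟨x, y, he, he'⟩

theorem dualist_adj_iff (hB : IsBenzenoid G) {h h' : Hexagon G} :
    (dualist G).Adj h h' ↔ h ≠ h' ∧ ∃ x, x ∈ h.1.verts ∧ x ∈ h'.1.verts := by
  constructor
  · intro hadj
    obtain ⟨x, y, hx, hy⟩ := exists_adj_of_dualist_adj hadj
    exact ⟨hadj.1, x, h.1.edge_vert hx, h'.1.edge_vert hy⟩
  · rintro ⟨hne, x, hx, hx'⟩
    exact dualist_adj_of_mem hB hne hx hx'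

theorem disjoint_verts_iff (hB : IsBenzenoid G) {h h' : Hexagon G} (hne : h ≠ h') :
    Disjoint h.1.verts h'.1.verts ↔ ¬ (dualist G).Adj h h' := by
  rw [dualist_adj_iff hB, Set.disjoint_left]
  grind

theorem IsCatacondensed.neighborSet_eq_of_unique (hB : IsCatacondensed G) {x : V} {h : Hexagon G}
    (hu : ∀ k : Hexagon G, x ∈ k.1.verts → k = h) : G.neighborSet x = h.1.neighborSet x := by
  ext y
  constructor
  · intro hy
    obtain ⟨k, hk⟩ := hB.isBenzenoid.exists_hexagon_adj hy
    rw [← hu k (k.1.edge_vert hk)]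
    exact hk
  · intro hy
    exact h.1.adj_sub hy

theorem IsCatacondensed.ncard_neighborSet_of_unique (hB : IsCatacondensed G) {x : V}
    {h : Hexagon G} (hx : x ∈ h.1.verts)
    (hu : ∀ k : Hexagon G, x ∈ k.1.verts → k = h) : (G.neighborSet x).ncard = 2 := by
  rw [hB.neighborSet_eq_of_unique hu]
  obtain ⟨y, z, hyz, hnb⟩ := h.exists_neighbors hx
  rw [show h.1.neighborSet x = {y, z} from Set.ext hnb, Set.ncard_pair hyz]

/-- Each of the two hexagons has two edges at `x`, exactly one is common, and there are no others: 2
+ 2 - 1 = 3. -/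
theorem IsCatacondensed.ncard_neighborSet_of_ne (hB : IsCatacondensed G) {x : V}
    {h h' : Hexagon G} (hne : h ≠ h') (hx : x ∈ h.1.verts) (hx' : x ∈ h'.1.verts) :
    (G.neighborSet x).ncard = 3 := by
  obtain ⟨y, hy, hy', -, hE⟩ := hB.exists_inter_eq hne hx hx'
  obtain ⟨z, hzy, hz⟩ := h.exists_adj_ne hx y
  obtain ⟨t, hty, ht⟩ := h'.exists_adj_ne hx' y
  have hzt : z ≠ t := by
    rintro rfl
    have : s(x, z) ∈ h.1.edgeSet ∩ h'.1.edgeSet := ⟨hz, ht⟩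
    rw [hE, Set.mem_singleton_iff, Sym2.congr_right] at this
    exact hzy this
  rw [Set.ncard_eq_three]
  refine ⟨y, z, t, hzy.symm, hty.symm, hzt, ?_⟩
  ext w
  constructor
  · intro hw
    obtain ⟨k, hk⟩ := hB.isBenzenoid.exists_hexagon_adj hw
    rcases hB.eq_or_eq hne hx hx' (k.1.edge_vert hk) with rfl | rfl
    · rcases k.eq_or_eq_of_adj hy hz hzy.symm hk with rfl | rfl <;> simp
    · rcases k.eq_or_eq_of_adj hy' ht hty.symm hk with rfl | rfl <;> simp
  · rintro (rfl | rfl | rfl)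
    · exact hy.adj_sub
    · exact hz.adj_sub
    · exact ht.adj_sub

theorem IsCatacondensed.hasDegreeTwo_iff (hB : IsCatacondensed G) {x : V} {h : Hexagon G}
    (hx : x ∈ h.1.verts) :
    HasDegreeTwo G x ↔ ∀ k : Hexagon G, x ∈ k.1.verts → k = h := by
  constructor
  · intro hd k hk
    by_contra hne
    have := hB.ncard_neighborSet_of_ne hne hk hx
    unfold HasDegreeTwo at hd
    omega
  · exact hB.ncard_neighborSet_of_unique hx

theorem IsCatacondensed.ncard_neighborSet_le (hB : IsCatacondensed G) (x : V) :
    (G.neighborSet x).ncard ≤ 3 := by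
  obtain ⟨h, hx⟩ := hB.isBenzenoid.exists_hexagon_mem x
  by_cases hu : ∀ k : Hexagon G, x ∈ k.1.verts → k = h
  · rw [hB.ncard_neighborSet_of_unique hx hu]
    norm_num
  · push Not at hu
    obtain ⟨k, hk, hne⟩ := hu
    rw [hB.ncard_neighborSet_of_ne hne hk hx]

/-- Choose a hexagon for each edge of a walk in `G`; consecutive choices share a vertex, so they are
equal or adjacent. -/
theorem IsCatacondensed.dualist_connected (hB : IsCatacondensed G) : (dualist G).Connected := by
  have hBb := hB.isBenzenoid
  have hconn := hBb.twoConnected.2.1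
  have key : ∀ x y, G.Reachable x y → ∀ h h' : Hexagon G, x ∈ h.1.verts → y ∈ h'.1.verts →
      (dualist G).Reachable h h' := by
    have hsame : ∀ (x : V) (h h' : Hexagon G), x ∈ h.1.verts → x ∈ h'.1.verts →
        (dualist G).Reachable h h' := by
      intro x h h' hx hx'
      by_cases hne : h = h'
      · rw [hne]
      · exact (dualist_adj_of_mem hBb hne hx hx').reachable
    rintro x y ⟨w⟩
    induction w with
    | nil => exact fun h h' => hsame _ h h'
    | cons hadj _ ih =>
      intro h h' hh hh'
      obtain ⟨k, hk⟩ := hBb.exists_hexagon_adj hadj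
      exact (hsame _ h k hh (k.1.edge_vert hk)).trans (ih k h' (k.1.edge_vert hk.symm) hh')
  obtain ⟨x⟩ := hconn.nonempty
  obtain ⟨h₀, -⟩ := hBb.exists_hexagon_mem x
  have : Nonempty (Hexagon G) := ⟨h₀⟩
  refine ⟨fun h h' => ?_⟩
  obtain ⟨x, hx⟩ := h.nonempty_verts
  obtain ⟨y, hy⟩ := h'.nonempty_verts
  exact key x y (hconn.preconnected x y) h h' hx hy

end Local

/-! ### Inclusion-exclusion: the dualist graph is a tree -/

section Counting

/-- Inclusion-exclusion for a family that covers every element once or twice. -/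
theorem two_mul_card_add_sum_inter {ι α : Type*} [Fintype ι] [DecidableEq α] (A : ι → Finset α)
    (S : Finset α) (hsub : ∀ i, A i ⊆ S)
    (hcov : ∀ x ∈ S, (∃ i, x ∈ A i) ∧ ∀ i j k, x ∈ A i → x ∈ A j → x ∈ A k →
      i = j ∨ i = k ∨ j = k) :
    2 * S.card + ∑ i, ∑ j, (A i ∩ A j).card = 3 * ∑ i, (A i).card := by
  classical
  have h1 : ∀ i, (A i).card = ∑ x ∈ S, if x ∈ A i then 1 else 0 := by
    intro i
    rw [← Finset.card_filter, Finset.filter_mem_eq_inter, Finset.inter_eq_right.2 (hsub i)]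
  have h2 : ∀ i j, (A i ∩ A j).card =
      ∑ x ∈ S, (if x ∈ A i then 1 else 0) * (if x ∈ A j then 1 else 0) := by
    intro i j
    simp only [← ite_and, mul_ite, mul_one, mul_zero]
    rw [← Finset.card_filter]
    congr 1
    ext x
    have := @hsub i x
    simp only [Finset.mem_inter, Finset.mem_filter]
    tauto
  have h3 : ∑ i, (A i).card = ∑ x ∈ S, ∑ i, if x ∈ A i then 1 else 0 := by
    rw [Finset.sum_comm]
    exact Finset.sum_congr rfl fun i _ => h1 i
  have h4 : ∑ i, ∑ j, (A i ∩ A j).card =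
      ∑ x ∈ S, (∑ i, if x ∈ A i then 1 else 0) * ∑ i, if x ∈ A i then 1 else 0 := by
    simp only [h2, Finset.sum_mul_sum]
    rw [Finset.sum_comm]
    conv_rhs => rw [Finset.sum_comm]
    rw [Finset.sum_comm]
    exact Finset.sum_congr rfl fun i _ => Finset.sum_comm
  rw [h3, h4, Finset.card_eq_sum_ones, Finset.mul_sum, Finset.mul_sum, ← Finset.sum_add_distrib]
  refine Finset.sum_congr rfl fun x hx => ?_
  obtain ⟨⟨i, hi⟩, hthree⟩ := hcov x hx
  rw [← Finset.card_filter]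
  set T := Finset.univ.filter fun i => x ∈ A i with hT
  have hpos : 0 < T.card := Finset.card_pos.2 ⟨i, by simp [hT, hi]⟩
  have hle : T.card ≤ 2 := by
    by_contra! hlt
    obtain ⟨a, b, c, ha, hb, hc, hab, hac, hbc⟩ := Finset.two_lt_card_iff.1 hlt
    simp only [hT, Finset.mem_filter, Finset.mem_univ, true_and] at ha hb hc
    rcases hthree a b c ha hb hc with h | h | h
    · exact hab h
    · exact hac h
    · exact hbc h
  -- For an element covered `m` times the claim is 2 + m² = 3m, which holds exactly for `m = 1` and
  -- `m = 2`.
  interval_cases T.card <;> rfl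

variable {V : Type u} {G : SimpleGraph V}

theorem IsCatacondensed.ncard_inter_verts (hB : IsCatacondensed G) {h h' : Hexagon G}
    (hadj : (dualist G).Adj h h') : (h.1.verts ∩ h'.1.verts).ncard = 2 := by
  obtain ⟨x, y, hx, hx'⟩ := exists_adj_of_dualist_adj hadj
  obtain ⟨z, hz, -, hi, -⟩ := hB.exists_inter_eq hadj.1 (h.1.edge_vert hx) (h'.1.edge_vert hx')
  rw [hi, Set.ncard_pair hz.ne]

theorem IsCatacondensed.ncard_inter_edgeSet (hB : IsCatacondensed G) {h h' : Hexagon G}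
    (hadj : (dualist G).Adj h h') : (h.1.edgeSet ∩ h'.1.edgeSet).ncard = 1 := by
  obtain ⟨x, y, hx, hx'⟩ := exists_adj_of_dualist_adj hadj
  obtain ⟨z, hz, -, -, hi⟩ := hB.exists_inter_eq hadj.1 (h.1.edge_vert hx) (h'.1.edge_vert hx')
  rw [hi, Set.ncard_singleton]

theorem disjoint_edgeSet_of_not_adj {h h' : Hexagon G} (hne : h ≠ h')
    (hadj : ¬ (dualist G).Adj h h') : h.1.edgeSet ∩ h'.1.edgeSet = ∅ := by
  ext e
  simp only [Set.mem_inter_iff, Set.mem_empty_iff_false, iff_false, not_and]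
  exact fun he he' => hadj ⟨hne, e, he, he'⟩

theorem sum_sum_inter_card {ι α : Type*} [Fintype ι] [DecidableEq α]
    (D : SimpleGraph ι) [DecidableRel D.Adj] (A : ι → Finset α) (a b : ℕ)
    (hcard : ∀ i, (A i).card = a) (hadj : ∀ i j, D.Adj i j → (A i ∩ A j).card = b)
    (hnot : ∀ i j, i ≠ j → ¬ D.Adj i j → A i ∩ A j = ∅) :
    ∑ i, ∑ j, (A i ∩ A j).card = a * Fintype.card ι + b * (2 * D.edgeFinset.card) := by
  classical
  have hterm : ∀ i j, (A i ∩ A j).card =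
      (if i = j then a else 0) + (if D.Adj i j then b else 0) := by
    intro i j
    by_cases hij : i = j
    · subst hij
      simp [hcard]
    · by_cases had : D.Adj i j
      · simp [hij, had, hadj]
      · simp [hij, had, hnot]
  simp only [hterm, Finset.sum_add_distrib, Finset.sum_ite_eq, Finset.mem_univ, if_true]
  rw [Finset.sum_const, smul_eq_mul, Finset.card_univ, mul_comm,
    ← D.sum_degrees_eq_twice_card_edges, Finset.mul_sum]
  congr 1
  refine Finset.sum_congr rfl fun i _ => ?_
  rw [← Finset.sum_filter, Finset.sum_const, smul_eq_mul, mul_comm, ← SimpleGraph.card_neighborFinset_eq_degree,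
    SimpleGraph.neighborFinset_eq_filter]

/-- With N hexagons and D adjacent pairs, inclusion-exclusion gives V = 6N - 2D and E = 6N - D. Then
E + 1 = V + N becomes D + 1 = N. -/
theorem IsCatacondensed.card_edgeSet_dualist (hB : IsCatacondensed G) :
    Nat.card (dualist G).edgeSet + 1 = Nat.card (Hexagon G) := by
  classical
  have hBb := hB.isBenzenoid
  have := hBb.finite
  have : Fintype V := Fintype.ofFinite V
  have : Fintype (Hexagon G) := Fintype.ofFinite _
  have hE := hBb.card_edgeSet_add_one
  unfold numHexagons at hE
  have hthree : ∀ (x : V) (i j k : Hexagon G), x ∈ i.1.verts → x ∈ j.1.verts → x ∈ k.1.verts →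
      i = j ∨ i = k ∨ j = k := by
    intro x i j k hi hj hk
    by_contra! hcon
    exact hB.no_internal x ⟨i, j, k, hcon.1, hcon.2.1, hcon.2.2, hi, hj, hk⟩
  have hv := two_mul_card_add_sum_inter (fun h : Hexagon G => h.1.verts.toFinset) Finset.univ
    (fun _ => Finset.subset_univ _) (fun x _ => ⟨by
      obtain ⟨h, hh⟩ := hBb.exists_hexagon_mem x
      exact ⟨h, by simpa using hh⟩, fun i j k hi hj hk => hthree x i j k (by simpa using hi)
        (by simpa using hj) (by simpa using hk)⟩)
  have he := two_mul_card_add_sum_inter (fun h : Hexagon G => h.1.edgeSet.toFinset) G.edgeFinset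
    (fun h e he => by
      rw [Set.mem_toFinset] at he
      simpa using h.1.edgeSet_subset he) (fun e he => by
      induction e with | _ x y => ?_
      rw [SimpleGraph.mem_edgeFinset, SimpleGraph.mem_edgeSet] at he
      obtain ⟨h, hh⟩ := hBb.exists_hexagon_adj he
      refine ⟨⟨h, by simpa using hh⟩, fun i j k hi hj hk => hthree x i j k ?_ ?_ ?_⟩
      · exact i.1.edge_vert (by simpa using hi)
      · exact j.1.edge_vert (by simpa using hj)
      · exact k.1.edge_vert (by simpa using hk))
  have hcv : ∀ h : Hexagon G, (h.1.verts.toFinset).card = 6 := fun h => by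
    rw [← Set.ncard_eq_toFinset_card', h.ncard_verts]
  have hce : ∀ h : Hexagon G, (h.1.edgeSet.toFinset).card = 6 := fun h => by
    rw [← Set.ncard_eq_toFinset_card', h.ncard_edgeSet]
  rw [sum_sum_inter_card (dualist G) _ 6 2 hcv (fun i j hij => by
    rw [← Set.toFinset_inter, ← Set.ncard_eq_toFinset_card', hB.ncard_inter_verts hij])
    (fun i j hij hadj => by
      rw [← Set.toFinset_inter, Set.toFinset_eq_empty, ← Set.disjoint_iff_inter_eq_empty]
      exact (disjoint_verts_iff hBb hij).2 hadj)] at hv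
  rw [sum_sum_inter_card (dualist G) _ 6 1 hce (fun i j hij => by
    rw [← Set.toFinset_inter, ← Set.ncard_eq_toFinset_card', hB.ncard_inter_edgeSet hij])
    (fun i j hij hadj => by
      rw [← Set.toFinset_inter, Set.toFinset_eq_empty]
      exact disjoint_edgeSet_of_not_adj hij hadj)] at he
  simp only [hcv, hce, Finset.sum_const, Finset.card_univ, smul_eq_mul] at hv he
  have e1 : Nat.card G.edgeSet = G.edgeFinset.card := by
    rw [Nat.card_eq_fintype_card, SimpleGraph.edgeFinset_card]
  have e2 : Nat.card (dualist G).edgeSet = (dualist G).edgeFinset.card := by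
    rw [Nat.card_eq_fintype_card, SimpleGraph.edgeFinset_card]
  rw [Nat.card_eq_fintype_card (α := V), Nat.card_eq_fintype_card (α := Hexagon G), e1] at hE
  rw [e2, Nat.card_eq_fintype_card]
  omega

/-- The dualist graph of a catacondensed benzenoid graph is a tree. -/
theorem IsCatacondensed.dualist_isTree (hB : IsCatacondensed G) : (dualist G).IsTree := by
  have := hB.isBenzenoid.finite
  exact SimpleGraph.isTree_iff_connected_and_card.2 ⟨hB.dualist_connected, hB.card_edgeSet_dualist⟩

/-- A hexagon with `d` neighbours has `6 - 2d` vertices of degree 2. -/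
theorem IsCatacondensed.ncard_hasDegreeTwo (hB : IsCatacondensed G) (h : Hexagon G) :
    {w | w ∈ h.1.verts ∧ HasDegreeTwo G w}.ncard + 2 * ((dualist G).neighborSet h).ncard = 6 := by
  classical
  have hBb := hB.isBenzenoid
  have := hBb.finite
  have : Fintype V := Fintype.ofFinite V
  have : Fintype (Hexagon G) := Fintype.ofFinite _
  -- The pairs of vertices that `h` shares with different neighbours are disjoint, as no vertex lies
  -- in three hexagons.
  have hU : ((Finset.univ.filter fun k => (dualist G).Adj h k).biUnion
      fun k => (h.1.verts ∩ k.1.verts).toFinset).card =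
      2 * ((dualist G).neighborSet h).ncard := by
    rw [Finset.card_biUnion]
    · rw [Finset.sum_congr rfl (g := fun _ => 2), Finset.sum_const, smul_eq_mul, mul_comm,
        Set.ncard_eq_toFinset_card']
      · congr 2
        ext k
        simp
      · intro k hk
        rw [← Set.ncard_eq_toFinset_card']
        exact hB.ncard_inter_verts (by simpa using hk)
    · intro k hk k' hk' hne
      simp only [Finset.coe_filter, Finset.mem_univ, true_and, Set.mem_ofPred_eq] at hk hk'
      rw [Function.onFun, Finset.disjoint_left]
      intro x hx hx'
      rw [Set.mem_toFinset] at hx hx'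
      rcases hB.eq_or_eq hne hx.2 hx'.2 hx.1 with e | e
      · exact hk.1 e
      · exact hk'.1 e
  rw [← hU]
  refine Eq.trans ?_ h.ncard_verts
  rw [Set.ncard_eq_toFinset_card', Set.ncard_eq_toFinset_card', ← Finset.card_union_of_disjoint]
  · congr 1
    ext x
    simp only [Finset.mem_union, Set.mem_toFinset, Set.mem_ofPred_eq, Finset.mem_biUnion,
      Finset.mem_filter, Finset.mem_univ, true_and, Set.mem_inter_iff]
    constructor
    · rintro (hx | ⟨k, -, hx, -⟩)
      · exact hx.1
      · exact hx
    · intro hx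
      by_cases hu : ∀ k : Hexagon G, x ∈ k.1.verts → k = h
      · exact Or.inl ⟨hx, (hB.hasDegreeTwo_iff hx).2 hu⟩
      · push Not at hu
        obtain ⟨k, hk, hne⟩ := hu
        exact Or.inr ⟨k, dualist_adj_of_mem hBb hne.symm hx hk, hx, hk⟩
  · rw [Finset.disjoint_left]
    intro x hx hx'
    simp only [Set.mem_toFinset, Set.mem_ofPred_eq, Finset.mem_biUnion,
      Finset.mem_filter, Finset.mem_univ, true_and, Set.mem_inter_iff] at hx hx'
    obtain ⟨k, hk, -, hxk⟩ := hx'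
    exact hk.1 ((hB.hasDegreeTwo_iff hx.1).1 hx.2 k hxk).symm

theorem IsCatacondensed.ncard_dualist_neighborSet_le (hB : IsCatacondensed G) (h : Hexagon G) :
    ((dualist G).neighborSet h).ncard ≤ 3 := by
  have := hB.ncard_hasDegreeTwo h
  omega

/-- Every vertex of a hexagon with three neighbours belongs to one of them. -/
theorem IsCatacondensed.exists_adj_mem_of_ncard_eq_three (hB : IsCatacondensed G) {h : Hexagon G}
    (hd : ((dualist G).neighborSet h).ncard = 3) {x : V} (hx : x ∈ h.1.verts) :
    ∃ k, (dualist G).Adj h k ∧ x ∈ k.1.verts := by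
  have := hB.isBenzenoid.finite
  have h1 := hB.ncard_hasDegreeTwo h
  have h2 : {w | w ∈ h.1.verts ∧ HasDegreeTwo G w} = ∅ := by
    rw [← Set.ncard_eq_zero (Set.toFinite _)]
    omega
  by_contra! hcon
  have : x ∈ {w | w ∈ h.1.verts ∧ HasDegreeTwo G w} := by
    refine ⟨hx, (hB.hasDegreeTwo_iff hx).2 fun k hk => ?_⟩
    by_contra hne
    exact hcon k (dualist_adj_of_mem hB.isBenzenoid (Ne.symm hne) hx hk) hk
  rw [h2] at this
  exact this

end Counting

/-! ### Independent sets in trees of maximum degree 3 -/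

section Trees

variable {ι : Type*} {T : SimpleGraph ι}

theorem mem_of_closed (hT : T.Connected) {S : Set ι} {x : ι} (hx : x ∈ S)
    (hS : ∀ a ∈ S, ∀ b, T.Adj a b → b ∈ S) (y : ι) : y ∈ S := by
  obtain ⟨w⟩ := hT.preconnected x y
  induction w with
  | nil => exact hx
  | cons hadj _ ih => exact ih (hS _ hx _ hadj)

variable [Fintype ι] [DecidableRel T.Adj]

theorem sum_degree_of_isTree (hT : T.IsTree) :
    ∑ x, (T.degree x : ℤ) = 2 * (Fintype.card ι : ℤ) - 2 := by
  have h1 := T.sum_degrees_eq_twice_card_edges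
  have h2 := hT.card_edgeFinset
  zify at h1 h2
  rw [h1]
  linarith

/-- The number of leaves adjacent to a vertex. -/
def leafCount (T : SimpleGraph ι) [DecidableRel T.Adj] (x : ι) : ℕ :=
  ((T.neighborFinset x).filter fun y => T.degree y = 1).card

theorem eq_of_leaf {l x y : ι} (hl : T.degree l = 1) (hx : T.Adj l x) (hy : T.Adj l y) : x = y := by
  rw [← T.card_neighborFinset_eq_degree, Finset.card_eq_one] at hl
  obtain ⟨z, hz⟩ := hl
  have h1 : x ∈ T.neighborFinset l := by simpa using hx
  have h2 : y ∈ T.neighborFinset l := by simpa using hy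
  rw [hz, Finset.mem_singleton] at h1 h2
  rw [h1, h2]

theorem exists_leaf_of_leafCount_pos {x : ι} (h : 0 < leafCount T x) :
    ∃ l, T.Adj x l ∧ T.degree l = 1 := by
  obtain ⟨l, hl⟩ := Finset.card_pos.1 h
  rw [Finset.mem_filter, SimpleGraph.mem_neighborFinset] at hl
  exact ⟨l, hl⟩

theorem eq_of_leafCount_eq_one {x l l' : ι} (h : leafCount T x = 1) (hl : T.Adj x l)
    (hl1 : T.degree l = 1) (hl' : T.Adj x l') (hl1' : T.degree l' = 1) : l = l' := by
  obtain ⟨z, hz⟩ := Finset.card_eq_one.1 h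
  have h1 : l ∈ ({z} : Finset ι) := hz ▸ by simp [hl, hl1]
  have h2 : l' ∈ ({z} : Finset ι) := hz ▸ by simp [hl', hl1']
  rw [Finset.mem_singleton] at h1 h2
  rw [h1, h2]

theorem degree_pos_of_isTree (hT : T.IsTree) (hn : 2 ≤ Fintype.card ι) (x : ι) :
    0 < T.degree x := by
  have : Nontrivial ι := Fintype.one_lt_card_iff_nontrivial.1 hn
  exact hT.connected.preconnected.degree_pos_of_nontrivial x

variable [DecidableEq ι]

/-- Twice the contribution of a vertex outside an independent set `C` to the deficiency of `C`. -/
def slack (T : SimpleGraph ι) [DecidableRel T.Adj] (C : Finset ι) (x : ι) : ℤ :=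
  2 * (3 - (T.degree x : ℤ)) + ((T.neighborFinset x).filter (· ∉ C)).card

theorem slack_nonneg (hdeg : ∀ x, T.degree x ≤ 3) (C : Finset ι) (x : ι) : 0 ≤ slack T C x := by
  have := hdeg x
  unfold slack
  omega

theorem sum_card_filter_neighborFinset_comm (A B : Finset ι) :
    ∑ x ∈ A, ((T.neighborFinset x).filter (· ∈ B)).card =
      ∑ y ∈ B, ((T.neighborFinset y).filter (· ∈ A)).card := by
  have h := Finset.sum_card_bipartiteAbove_eq_sum_card_bipartiteBelow (s := A) (t := B) T.Adj
  convert h using 2 with x hx y hy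
  · congr 1
    ext z
    simp [Finset.mem_bipartiteAbove, and_comm]
  · congr 1
    ext z
    simp [Finset.mem_bipartiteBelow, and_comm, T.adj_comm]

/-- An edge between `C` and its complement contributes -2, and one inside the complement -2 - 2 + 1
+ 1 = -2; none lies inside `C`. With n - 1 edges the sum is 6(n - |C|) - 2(n - 1). -/
theorem sum_slack (hT : T.IsTree) (C : Finset ι) (hC : ∀ x ∈ C, ∀ y ∈ C, ¬ T.Adj x y) :
    ∑ x ∈ Cᶜ, slack T C x = 2 * (2 * (Fintype.card ι : ℤ) + 1 - 3 * C.card) := by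
  have hsum := sum_degree_of_isTree hT
  rw [← Finset.sum_add_sum_compl C] at hsum
  have hsplit : ∀ x, (T.degree x : ℤ) = ((T.neighborFinset x).filter (· ∈ C)).card +
      ((T.neighborFinset x).filter (· ∉ C)).card := by
    intro x
    rw [← T.card_neighborFinset_eq_degree, ← Finset.card_filter_add_card_filter_not (· ∈ C)]
    push_cast
    rfl
  have hin : ∀ x ∈ C, (T.degree x : ℤ) = ((T.neighborFinset x).filter (· ∈ Cᶜ)).card := by
    intro x hx
    rw [hsplit]
    have : (T.neighborFinset x).filter (· ∈ C) = ∅ := by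
      rw [Finset.filter_eq_empty_iff]
      intro y hy hyC
      exact hC x hx y hyC (by simpa using hy)
    rw [this]
    simp
  have hcomm := sum_card_filter_neighborFinset_comm (T := T) C Cᶜ
  zify at hcomm
  rw [← Finset.sum_congr rfl hin] at hcomm
  have hcard : (Cᶜ.card : ℤ) = Fintype.card ι - C.card := by
    have := Finset.card_add_card_compl C
    omega
  have h3 : ∑ x ∈ Cᶜ, (T.degree x : ℤ) = ∑ x ∈ Cᶜ, (((T.neighborFinset x).filter (· ∈ C)).card : ℤ)
      + ∑ x ∈ Cᶜ, (((T.neighborFinset x).filter (· ∉ C)).card : ℤ) := by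
    rw [← Finset.sum_add_distrib]
    exact Finset.sum_congr rfl fun x _ => hsplit x
  have h4 : ∑ x ∈ Cᶜ, slack T C x = 6 * (Cᶜ.card : ℤ) - 2 * ∑ x ∈ Cᶜ, (T.degree x : ℤ) +
      ∑ x ∈ Cᶜ, (((T.neighborFinset x).filter (· ∉ C)).card : ℤ) := by
    simp only [slack, Finset.sum_add_distrib, ← Finset.mul_sum, Finset.sum_sub_distrib,
      Finset.sum_const, nsmul_eq_mul]
    ring
  rw [h4, hcard]
  linarith

/-- An independent set of a tree of maximum degree 3 has at most `(2n + 1) / 3` vertices. -/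
theorem three_mul_card_le (hT : T.IsTree) (hdeg : ∀ x, T.degree x ≤ 3) (C : Finset ι)
    (hC : ∀ x ∈ C, ∀ y ∈ C, ¬ T.Adj x y) : 3 * C.card ≤ 2 * Fintype.card ι + 1 := by
  have h1 := sum_slack hT C hC
  have h2 : 0 ≤ ∑ x ∈ Cᶜ, slack T C x := Finset.sum_nonneg fun x _ => slack_nonneg hdeg C x
  omega

theorem not_adj_of_leaves (hT : T.IsTree) (hn : 3 ≤ Fintype.card ι) {x y : ι}
    (hx : T.degree x = 1) (hy : T.degree y = 1) : ¬ T.Adj x y := by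
  intro hadj
  have hS : ∀ z, z ∈ ({x, y} : Set ι) := mem_of_closed hT.connected (Or.inl rfl) (by
    rintro a (rfl | rfl) b hb
    · exact Or.inr (eq_of_leaf hx hb hadj)
    · exact Or.inl (eq_of_leaf hy hb hadj.symm))
  have : Fintype.card ι ≤ 2 := by
    rw [← Finset.card_univ]
    exact (Finset.card_le_card (t := {x, y}) fun z _ => by simpa using hS z).trans
      Finset.card_le_two
  omega

/-- Deleting the leaves of a tree leaves a tree. -/
theorem sum_degree_sub_leafCount (hT : T.IsTree) (hn : 3 ≤ Fintype.card ι) :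
    ∑ x with T.degree x ≠ 1, ((T.degree x : ℤ) - leafCount T x - 2) = -2 := by
  set L := Finset.univ.filter fun x => T.degree x = 1 with hL
  have hsum := sum_degree_of_isTree hT
  have hLc : (Finset.univ.filter fun x => T.degree x ≠ 1) = Lᶜ := by
    ext; simp [hL]
  rw [hLc]
  -- Every leaf is counted once, at its only neighbour, which is not itself a leaf.
  have hcount : ∑ x ∈ Lᶜ, (leafCount T x : ℤ) = L.card := by
    have hcomm := sum_card_filter_neighborFinset_comm (T := T) Lᶜ L
    have h1 : ∀ x, leafCount T x = ((T.neighborFinset x).filter (· ∈ L)).card := by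
      intro x
      unfold leafCount
      congr 1
      ext y
      simp [hL]
    have h2 : ∀ y ∈ L, ((T.neighborFinset y).filter (· ∈ Lᶜ)).card = 1 := by
      intro y hy
      have hy' : T.degree y = 1 := by simpa [hL] using hy
      rw [Finset.filter_true_of_mem, T.card_neighborFinset_eq_degree, hy']
      intro z hz
      rw [SimpleGraph.mem_neighborFinset] at hz
      rw [Finset.mem_compl]
      intro hzL
      exact not_adj_of_leaves hT hn hy' (by simpa [hL] using hzL) hz
    rw [Finset.sum_congr rfl h2, Finset.sum_const, smul_eq_mul, mul_one] at hcomm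
    rw [← hcomm]
    push_cast
    exact Finset.sum_congr rfl fun x _ => by rw [h1]
  rw [← Finset.sum_add_sum_compl L] at hsum
  have hLsum : ∑ x ∈ L, (T.degree x : ℤ) = L.card := by
    rw [Finset.sum_congr rfl (g := fun _ => 1), Finset.sum_const, nsmul_eq_mul, mul_one]
    intro x hx
    have : T.degree x = 1 := by simpa [hL] using hx
    rw [this]
    rfl
  have hcard := Finset.card_add_card_compl L
  simp only [Finset.sum_sub_distrib, Finset.sum_const, nsmul_eq_mul]
  zify at hcard
  linarith

/-- The local structure of a tree of maximum degree 3 that has a large independent set, and in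
which no vertex of degree 3 is adjacent to two leaves. -/
theorem exists_ends (hT : T.IsTree) (hdeg : ∀ x, T.degree x ≤ 3) (hn : 4 ≤ Fintype.card ι)
    (C : Finset ι) (hC : ∀ x ∈ C, ∀ y ∈ C, ¬ T.Adj x y)
    (hs : 2 * Fintype.card ι ≤ 3 * C.card + 1)
    (hirr : ∀ x l l', T.degree x = 3 → T.Adj x l → T.Adj x l' → T.degree l = 1 →
      T.degree l' = 1 → l = l') :
    ∃ p q, p ≠ q ∧ p ∉ C ∧ q ∉ C ∧ T.degree p = 2 ∧ T.degree q = 2 ∧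
      leafCount T p = 1 ∧ leafCount T q = 1 ∧
      (∀ x, x ∉ C → ∀ y, T.Adj x y → y ∈ C) ∧
      (∀ x, x ∉ C → x ≠ p → x ≠ q → T.degree x = 3) ∧
      (∀ x, T.degree x ≠ 1 → x ≠ p → x ≠ q → T.degree x = leafCount T x + 2) := by
  have hpos := degree_pos_of_isTree hT (by omega)
  have hle : ∀ x, leafCount T x ≤ T.degree x := fun x => by
    rw [← T.card_neighborFinset_eq_degree]
    exact Finset.card_filter_le _ _
  have hthree : ∀ x, T.degree x = 3 → leafCount T x ≤ 1 := by
    intro x hx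
    refine Finset.card_le_one.2 fun a ha b hb => ?_
    rw [Finset.mem_filter, SimpleGraph.mem_neighborFinset] at ha hb
    exact hirr x a b hx ha.1 hb.1 ha.2 hb.2
  -- If all neighbours of `x` were leaves, the tree would be a star. Having at least four vertices,
  -- it would have a centre of degree 3 with three leaves, against `hirr`.
  have hlt : ∀ x, T.degree x ≠ 1 → leafCount T x < T.degree x := by
    intro x hx
    by_contra! hcon
    have heq : leafCount T x = T.degree x := le_antisymm (hle x) hcon
    have hall : ∀ y, T.Adj x y → T.degree y = 1 := by
      intro y hy
      unfold leafCount at heq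
      rw [← T.card_neighborFinset_eq_degree, Finset.card_filter_eq_iff] at heq
      exact heq y (by simpa using hy)
    have hS : ∀ z, z ∈ (insert x (T.neighborFinset x : Set ι)) :=
      mem_of_closed hT.connected (Or.inl rfl) (by
        rintro a (rfl | ha) b hb
        · exact Or.inr (by simpa using hb)
        · have ha' : T.Adj x a := by simpa using ha
          exact Or.inl (eq_of_leaf (hall a ha') hb ha'.symm))
    have hcard : Fintype.card ι ≤ T.degree x + 1 := by
      rw [← Finset.card_univ, ← T.card_neighborFinset_eq_degree]
      exact (Finset.card_le_card (t := insert x (T.neighborFinset x)) fun z _ => by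
        have := hS z
        simpa using this).trans (Finset.card_insert_le _ _)
    have h3 := hdeg x
    have h4 : T.degree x = 3 := by omega
    have := hthree x h4
    omega
  set N := Finset.univ.filter fun x => T.degree x ≠ 1 with hN
  have hsum := sum_degree_sub_leafCount hT (by omega)
  rw [← hN] at hsum
  -- `W` consists of the ends of the tree pruned of its leaves. There are at least two, because the
  -- pruned degrees minus 2 sum to -2.
  set W := N.filter fun x => T.degree x = leafCount T x + 1 with hW
  have hWdeg : ∀ x ∈ W, T.degree x = 2 ∧ leafCount T x = 1 := by
    intro x hx
    simp only [hW, hN, Finset.mem_filter, Finset.mem_univ, true_and] at hx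
    have h1 := hthree x
    have h2 := hdeg x
    have h3 := hpos x
    omega
  have hWsplit : ∑ x ∈ N with ¬ T.degree x = leafCount T x + 1,
      ((T.degree x : ℤ) - leafCount T x - 2) = W.card - 2 := by
    rw [← Finset.sum_filter_add_sum_filter_not N (fun x => T.degree x = leafCount T x + 1),
      Finset.sum_congr rfl (g := fun _ => (-1 : ℤ))] at hsum
    · rw [Finset.sum_const, ← hW] at hsum
      simp only [smul_neg, nsmul_eq_mul, mul_one] at hsum
      linarith
    · intro x hx
      rw [Finset.mem_filter] at hx
      rw [hx.2]
      push_cast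
      ring
  have hrest : ∀ x ∈ N.filter (fun x => ¬ T.degree x = leafCount T x + 1),
      0 ≤ ((T.degree x : ℤ) - leafCount T x - 2) := by
    intro x hx
    simp only [hN, Finset.mem_filter, Finset.mem_univ, true_and] at hx
    have := hlt x hx.1
    omega
  have hWcard : 2 ≤ W.card := by
    have := Finset.sum_nonneg hrest
    omega
  have hslack := sum_slack hT C hC
  have hnn : ∀ x ∈ Cᶜ, 0 ≤ slack T C x := fun x _ => slack_nonneg hdeg C x
  have hleafslack : ∀ l, T.degree l = 1 → 4 ≤ slack T C l := by
    intro l hl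
    unfold slack
    rw [hl]
    push_cast
    linarith [Int.natCast_nonneg ((T.neighborFinset l).filter (· ∉ C)).card]
  have hWslack : ∀ x ∈ W, 2 ≤ slack T C x := by
    intro x hx
    unfold slack
    rw [(hWdeg x hx).1]
    push_cast
    linarith [Int.natCast_nonneg ((T.neighborFinset x).filter (· ∉ C)).card]
  -- By `hs` the total slack is at most 4.
  have hpair : ∀ a b, a ≠ b → a ∉ C → b ∉ C → slack T C a + slack T C b ≤ 4 := by
    intro a b hab ha hb
    have : ∑ x ∈ {a, b}, slack T C x ≤ ∑ x ∈ Cᶜ, slack T C x := by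
      refine Finset.sum_le_sum_of_subset_of_nonneg ?_ fun x hx _ => hnn x hx
      intro x hx
      simp only [Finset.mem_insert, Finset.mem_singleton] at hx
      rcases hx with rfl | rfl <;> simpa
    rw [Finset.sum_pair hab] at this
    omega
  -- If an end were in `C`, its leaf would be outside and use up the whole slack of 4. A second end
  -- has positive slack if it is outside `C`, and otherwise its leaf does.
  have hWC : ∀ x ∈ W, x ∉ C := by
    intro x hx hxC
    obtain ⟨l, hxl, hl⟩ := exists_leaf_of_leafCount_pos (T := T) (x := x)
      (by rw [(hWdeg x hx).2]; norm_num)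
    have hlC : l ∉ C := fun h => hC x hxC l h hxl
    obtain ⟨w, hw, hwx⟩ := Finset.exists_mem_ne hWcard x
    have h4 := hleafslack l hl
    by_cases hwC : w ∈ C
    · obtain ⟨l', hwl', hl'⟩ := exists_leaf_of_leafCount_pos (T := T) (x := w)
        (by rw [(hWdeg w hw).2]; norm_num)
      have hlC' : l' ∉ C := fun h => hC w hwC l' h hwl'
      have hne : l ≠ l' := by
        rintro rfl
        exact hwx (eq_of_leaf hl hwl'.symm hxl.symm)
      have := hpair l l' hne hlC hlC'
      have := hleafslack l' hl'
      omega
    · have hne : l ≠ w := by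
        rintro rfl
        have := (hWdeg l hw).1
        omega
      have := hpair l w hne hlC hwC
      have := hWslack w hw
      omega
  have hWsub : W ⊆ Cᶜ := fun x hx => by simpa using hWC x hx
  have hWsum : 2 * (W.card : ℤ) ≤ ∑ x ∈ W, slack T C x := by
    have := Finset.card_nsmul_le_sum W (slack T C) 2 hWslack
    rw [nsmul_eq_mul] at this
    linarith
  have hdiff := Finset.sum_sdiff (f := slack T C) hWsub
  have hdnn : 0 ≤ ∑ x ∈ Cᶜ \ W, slack T C x :=
    Finset.sum_nonneg fun x hx => hnn x (Finset.mem_sdiff.1 hx).1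
  -- Each end takes slack at least 2 out of at most 4. So there are two ends, of slack exactly 2,
  -- and every other vertex outside `C` has slack 0.
  have hW2 : W.card = 2 := by omega
  have hzero : ∀ x, x ∉ C → x ∉ W → slack T C x = 0 := by
    intro x hx hxW
    have h0 : ∑ x ∈ Cᶜ \ W, slack T C x = 0 := by omega
    exact (Finset.sum_eq_zero_iff_of_nonneg fun x hx => hnn x (Finset.mem_sdiff.1 hx).1).1 h0 x
      (by simp [hx, hxW])
  have htwo : ∀ x ∈ W, slack T C x = 2 := by
    have h0 : ∑ x ∈ W, (slack T C x - 2) = 0 := by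
      rw [Finset.sum_sub_distrib, Finset.sum_const, nsmul_eq_mul]
      omega
    intro x hx
    have := (Finset.sum_eq_zero_iff_of_nonneg fun x hx => by
      have := hWslack x hx
      omega).1 h0 x hx
    omega
  obtain ⟨p, q, hpq, hWpq⟩ := Finset.card_eq_two.1 hW2
  have hp : p ∈ W := by simp [hWpq]
  have hq : q ∈ W := by simp [hWpq]
  have hnotW : ∀ x, x ≠ p → x ≠ q → x ∉ W := fun x h1 h2 => by simp [hWpq, h1, h2]
  refine ⟨p, q, hpq, hWC p hp, hWC q hq, (hWdeg p hp).1, (hWdeg q hq).1, (hWdeg p hp).2,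
    (hWdeg q hq).2, ?_, ?_, ?_⟩
  · intro x hx y hy
    by_contra hyC
    have hcard : 0 < ((T.neighborFinset x).filter (· ∉ C)).card :=
      Finset.card_pos.2 ⟨y, by simp [hy, hyC]⟩
    by_cases hxW : x ∈ W
    · have h1 := htwo x hxW
      have h2 := (hWdeg x hxW).1
      unfold slack at h1
      omega
    · have h1 := hzero x hx hxW
      have h2 := hdeg x
      unfold slack at h1
      omega
  · intro x hx hxp hxq
    have h1 := hzero x hx (hnotW x hxp hxq)
    have h2 := hdeg x
    unfold slack at h1
    omega
  · intro x hx hxp hxq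
    -- With only two ends, every other vertex of the pruned tree has degree 2 in it.
    have h0 : ∑ x ∈ N with ¬ T.degree x = leafCount T x + 1,
      ((T.degree x : ℤ) - leafCount T x - 2) = 0 := by omega
    have hxW := hnotW x hxp hxq
    have hxN : x ∈ N := by simp [hN, hx]
    have := (Finset.sum_eq_zero_iff_of_nonneg hrest).1 h0 x (by
      rw [Finset.mem_filter]
      exact ⟨hxN, fun h => hxW (Finset.mem_filter.2 ⟨hxN, h⟩)⟩)
    omega

end Trees

/-! ### Recognising the trees T_k -/

section TreeT

theorem treeT_adj_inl_inl {k : ℕ} (a b : Fin (2 * k + 1)) :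
    (treeT k).Adj (Sum.inl a) (Sum.inl b) ↔ a.val + 1 = b.val ∨ b.val + 1 = a.val := by
  simp only [treeT, SimpleGraph.fromRel_adj, ne_eq, Sum.inl.injEq, Fin.ext_iff]
  omega

theorem treeT_adj_inl_inr {k : ℕ} (a : Fin (2 * k + 1)) (j : Fin (k - 2)) :
    (treeT k).Adj (Sum.inl a) (Sum.inr j) ↔ a.val = 2 * j.val + 3 := by
  simp [treeT, SimpleGraph.fromRel_adj]

theorem treeT_not_adj_inr_inr {k : ℕ} (i j : Fin (k - 2)) :
    ¬ (treeT k).Adj (Sum.inr i) (Sum.inr j) := by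
  simp [treeT, SimpleGraph.fromRel_adj]

variable {ι : Type*} {T : SimpleGraph ι}

/-- A caterpillar with spine `g 0, …, g (2 * k - 2)` and one leaf `l i` at each `g i` with `i` even
is isomorphic to `treeT k`. -/
theorem exists_iso_treeT {k : ℕ} (hk : 2 ≤ k) (g l : ℕ → ι)
    (hg : ∀ i j, i ≤ 2 * k - 2 → j ≤ 2 * k - 2 → g i = g j → i = j)
    (hl : ∀ i j, i ≤ 2 * k - 2 → j ≤ 2 * k - 2 → i % 2 = 0 → j % 2 = 0 → l i = l j → i = j)
    (hgl : ∀ i j, i ≤ 2 * k - 2 → j ≤ 2 * k - 2 → j % 2 = 0 → g i ≠ l j)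
    (hgg : ∀ i j, i ≤ 2 * k - 2 → j ≤ 2 * k - 2 →
      (T.Adj (g i) (g j) ↔ i + 1 = j ∨ j + 1 = i))
    (hgladj : ∀ i j, i ≤ 2 * k - 2 → j ≤ 2 * k - 2 → j % 2 = 0 →
      (T.Adj (g i) (l j) ↔ i = j))
    (hll : ∀ i j, i ≤ 2 * k - 2 → j ≤ 2 * k - 2 → i % 2 = 0 → j % 2 = 0 → ¬ T.Adj (l i) (l j))
    (hsurj : ∀ x, ∃ i ≤ 2 * k - 2, x = g i ∨ i % 2 = 0 ∧ x = l i) :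
    ∃ φ : treeT k ≃g T, φ (Sum.inl ⟨1, by omega⟩) = g 0 ∧
      φ (Sum.inl ⟨2 * k - 1, by omega⟩) = g (2 * k - 2) := by
  -- The spine is shifted: `g i` is v_{i+2}. The leaves at its two ends play v_1 and v_{2k+1}, and
  -- the other leaves are the additional ones of T_k.
  let f : Fin (2 * k + 1) ⊕ Fin (k - 2) → ι := Sum.elim
    (fun a => if a.val = 0 then l 0 else if a.val = 2 * k then l (2 * k - 2) else g (a.val - 1))
    (fun j => l (2 * j.val + 2))
  have hinl : ∀ a : Fin (2 * k + 1), (a.val = 0 ∧ f (Sum.inl a) = l 0) ∨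
      (a.val = 2 * k ∧ f (Sum.inl a) = l (2 * k - 2)) ∨
      ∃ i ≤ 2 * k - 2, a.val = i + 1 ∧ f (Sum.inl a) = g i := by
    intro a
    by_cases h0 : a.val = 0
    · exact Or.inl ⟨h0, if_pos h0⟩
    · by_cases h1 : a.val = 2 * k
      · exact Or.inr (Or.inl ⟨h1, (if_neg h0).trans (if_pos h1)⟩)
      · exact Or.inr (Or.inr ⟨a.val - 1, by omega, by omega,
          (if_neg h0).trans (if_neg h1)⟩)
  have hinr : ∀ j : Fin (k - 2), f (Sum.inr j) = l (2 * j.val + 2) := fun _ => rfl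
  have hinj : Function.Injective f := by
    rintro (a | i) (b | j) heq
    · rcases hinl a with ⟨ha, ea⟩ | ⟨ha, ea⟩ | ⟨i, hi, ha, ea⟩ <;>
      rcases hinl b with ⟨hb, eb⟩ | ⟨hb, eb⟩ | ⟨j, hj, hb, eb⟩ <;>
      rw [ea, eb] at heq <;> refine congrArg Sum.inl (Fin.ext ?_)
      · omega
      · have := hl _ _ (by omega) (by omega) (by omega) (by omega) heq
        omega
      · exact absurd heq.symm (hgl _ _ hj (by omega) (by omega))
      · have := hl _ _ (by omega) (by omega) (by omega) (by omega) heq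
        omega
      · omega
      · exact absurd heq.symm (hgl _ _ hj (by omega) (by omega))
      · exact absurd heq (hgl _ _ hi (by omega) (by omega))
      · exact absurd heq (hgl _ _ hi (by omega) (by omega))
      · have := hg _ _ hi hj heq
        omega
    · have hj := j.2
      rw [hinr] at heq
      rcases hinl a with ⟨ha, ea⟩ | ⟨ha, ea⟩ | ⟨i, hi, ha, ea⟩ <;> rw [ea] at heq
      · have := hl _ _ (by omega) (by omega) (by omega) (by omega) heq
        omega
      · have := hl _ _ (by omega) (by omega) (by omega) (by omega) heq
        omega
      · exact absurd heq (hgl _ _ hi (by omega) (by omega))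
    · have hi := i.2
      rw [hinr] at heq
      rcases hinl b with ⟨ha, ea⟩ | ⟨ha, ea⟩ | ⟨i, hi, ha, ea⟩ <;> rw [ea] at heq
      · have := hl _ _ (by omega) (by omega) (by omega) (by omega) heq
        omega
      · have := hl _ _ (by omega) (by omega) (by omega) (by omega) heq
        omega
      · exact absurd heq.symm (hgl _ _ hi (by omega) (by omega))
    · have hi := i.2
      have hj := j.2
      rw [hinr, hinr] at heq
      have := hl _ _ (by omega) (by omega) (by omega) (by omega) heq
      exact congrArg Sum.inr (Fin.ext (by omega))
  have hsur : Function.Surjective f := by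
    have hl' : ∀ i, i ≤ 2 * k - 2 → i % 2 = 0 → ∃ z, f z = l i := by
      intro i hi hmod
      by_cases h0 : i = 0
      · exact ⟨Sum.inl ⟨0, by omega⟩, by simp [f, h0]⟩
      · by_cases h1 : i = 2 * k - 2
        · refine ⟨Sum.inl ⟨2 * k, by omega⟩, ?_⟩
          have : k ≠ 0 := by omega
          simp [f, h1, this]
        · refine ⟨Sum.inr ⟨(i - 2) / 2, by omega⟩, ?_⟩
          rw [hinr]
          congr 1
          simp only
          omega
    intro x
    obtain ⟨i, hi, rfl | ⟨hmod, rfl⟩⟩ := hsurj x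
    · refine ⟨Sum.inl ⟨i + 1, by omega⟩, ?_⟩
      have : i + 1 ≠ 2 * k := by omega
      simp [f, this]
    · exact hl' i hi hmod
  have hadj_inr : ∀ (a : Fin (2 * k + 1)) (j : Fin (k - 2)),
      T.Adj (f (Sum.inl a)) (f (Sum.inr j)) ↔ a.val = 2 * j.val + 3 := by
    intro a j
    have hj := j.2
    rw [hinr]
    rcases hinl a with ⟨ha, ea⟩ | ⟨ha, ea⟩ | ⟨i, hi, ha, ea⟩ <;> rw [ea]
    · have := hll 0 (2 * j.val + 2) (by omega) (by omega) (by omega) (by omega)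
      constructor
      · exact fun h => absurd h this
      · omega
    · have := hll (2 * k - 2) (2 * j.val + 2) (by omega) (by omega) (by omega) (by omega)
      constructor
      · exact fun h => absurd h this
      · omega
    · rw [hgladj _ _ hi (by omega) (by omega)]
      omega
  have hadj : ∀ x y, T.Adj (f x) (f y) ↔ (treeT k).Adj x y := by
    rintro (a | i) (b | j)
    · rw [treeT_adj_inl_inl]
      rcases hinl a with ⟨ha, ea⟩ | ⟨ha, ea⟩ | ⟨i, hi, ha, ea⟩ <;>
      rcases hinl b with ⟨hb, eb⟩ | ⟨hb, eb⟩ | ⟨j, hj, hb, eb⟩ <;>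
      rw [ea, eb]
      · have := hll 0 0 (by omega) (by omega) (by omega) (by omega)
        constructor
        · exact fun h => absurd h this
        · omega
      · have := hll 0 (2 * k - 2) (by omega) (by omega) (by omega) (by omega)
        constructor
        · exact fun h => absurd h this
        · omega
      · rw [T.adj_comm, hgladj _ _ hj (by omega) (by omega)]
        omega
      · have := hll (2 * k - 2) 0 (by omega) (by omega) (by omega) (by omega)
        constructor
        · exact fun h => absurd h this
        · omega
      · have := hll (2 * k - 2) (2 * k - 2) (by omega) (by omega) (by omega) (by omega)
        constructor
        · exact fun h => absurd h this
        · omega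
      · rw [T.adj_comm, hgladj _ _ hj (by omega) (by omega)]
        omega
      · rw [hgladj _ _ hi (by omega) (by omega)]
        omega
      · rw [hgladj _ _ hi (by omega) (by omega)]
        omega
      · rw [hgg _ _ hi hj]
        omega
    · rw [treeT_adj_inl_inr, hadj_inr]
    · rw [T.adj_comm, (treeT k).adj_comm, treeT_adj_inl_inr, hadj_inr]
    · have hi := i.2
      have hj := j.2
      have h1 := treeT_not_adj_inr_inr i j
      have h2 : ¬ T.Adj (f (Sum.inr i)) (f (Sum.inr j)) := by
        rw [hinr, hinr]
        exact hll _ _ (by omega) (by omega) (by omega) (by omega)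
      tauto
  refine ⟨⟨Equiv.ofBijective f ⟨hinj, hsur⟩, fun {x y} => hadj x y⟩, ?_, ?_⟩
  · have : 1 ≠ 2 * k := by omega
    change f (Sum.inl ⟨1, by omega⟩) = _
    simp [f, this]
  · have h1 : 2 * k - 1 ≠ 0 := by omega
    have h2 : 2 * k - 1 ≠ 2 * k := by omega
    change f (Sum.inl ⟨2 * k - 1, by omega⟩) = _
    simp only [f, Sum.elim_inl, h1, h2, if_false]
    congr 1

variable [Fintype ι] [DecidableRel T.Adj] [DecidableEq ι]

/-- A tree of maximum degree 3 that has a large independent set, and in which no vertex of degree 3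
is adjacent to two leaves, is one of the trees `treeT k`. -/
theorem exists_iso_treeT_of_isTree (hT : T.IsTree) (hdeg : ∀ x, T.degree x ≤ 3)
    (hn : 4 ≤ Fintype.card ι) (C : Finset ι) (hC : ∀ x ∈ C, ∀ y ∈ C, ¬ T.Adj x y)
    (hs : 2 * Fintype.card ι ≤ 3 * C.card + 1)
    (hirr : ∀ x l l', T.degree x = 3 → T.Adj x l → T.Adj x l' → T.degree l = 1 →
      T.degree l' = 1 → l = l') :
    ∃ (k : ℕ) (_ : 2 ≤ k) (φ : treeT k ≃g T), ∀ x,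
      x = φ (Sum.inl ⟨1, by omega⟩) ∨ x = φ (Sum.inl ⟨2 * k - 1, by omega⟩) →
      x ∉ C ∧ T.degree x = 2 ∧ ∀ y, T.Adj x y → y ∈ C := by
  obtain ⟨p, q, hpq, hpC, hqC, hpd, hqd, hpl, hql, hnC, hthree, htwo⟩ :=
    exists_ends hT hdeg hn C hC hs hirr
  -- This path turns out to be the whole pruned tree. Both `C` and its complement are independent,
  -- so membership in `C` alternates along it, and both ends are outside.
  obtain ⟨P, hP⟩ := hT.connected.exists_isPath p q
  set m := P.length with hm
  set g := P.getVert with hg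
  have hg0 : g 0 = p := P.getVert_zero
  have hgm : g m = q := P.getVert_length
  have hinj : ∀ i j, i ≤ m → j ≤ m → g i = g j → i = j := fun i j hi hj h =>
    hP.getVert_injOn hi hj h
  have hstep : ∀ i, i < m → T.Adj (g i) (g (i + 1)) := fun i hi => P.adj_getVert_succ hi
  have hpar : ∀ i, i ≤ m → (g i ∈ C ↔ i % 2 = 1) := by
    intro i
    induction i with
    | zero => intro _; simp [hg0, hpC]
    | succ i ih =>
      intro hi
      have hadj := hstep i (by omega)
      have ih' := ih (by omega)
      by_cases hgi : g i ∈ C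
      · have h1 : g (i + 1) ∉ C := fun h => hC _ hgi _ h hadj
        have h2 := ih'.1 hgi
        simp only [h1, false_iff]
        omega
      · have h1 : g (i + 1) ∈ C := hnC _ hgi _ hadj
        have h2 : ¬ i % 2 = 1 := fun h => hgi (ih'.2 h)
        simp only [h1, true_iff]
        omega
  have hmpos : m ≠ 0 := by
    intro h0
    rw [h0, hg0] at hgm
    exact hpq hgm
  have hmeven : m % 2 = 0 := by
    have := hpar m le_rfl
    rw [hgm] at this
    have h2 : ¬ m % 2 = 1 := fun h => hqC (this.2 h)
    omega
  have hlc : ∀ x, leafCount T x + ((T.neighborFinset x).filter fun y => ¬ T.degree y = 1).card =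
      T.degree x := by
    intro x
    rw [← T.card_neighborFinset_eq_degree]
    exact Finset.card_filter_add_card_filter_not _
  have hnonleaf : ∀ i, i ≤ m → T.degree (g i) ≠ 1 := by
    intro i hi hd
    by_cases h0 : i = 0
    · subst h0
      rw [hg0] at hd
      omega
    · by_cases h1 : i = m
      · rw [h1, hgm] at hd
        omega
      · have e1 := hstep i (by omega)
        have e2 := hstep (i - 1) (by omega)
        rw [Nat.sub_add_cancel (by omega)] at e2
        have := hinj _ _ (by omega) (by omega) (eq_of_leaf hd e1 e2.symm)
        omega
  -- A spine vertex has one non-leaf neighbour if it is an end and two otherwise, and its neighbours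
  -- on the path already account for them.
  have hnbr : ∀ i, i ≤ m → ∀ y, T.Adj (g i) y → T.degree y ≠ 1 →
      (∃ j ≤ m, (i + 1 = j ∨ j + 1 = i) ∧ y = g j) := by
    intro i hi y hy hyd
    have hymem : y ∈ (T.neighborFinset (g i)).filter fun y => ¬ T.degree y = 1 := by
      simp [hy, hyd]
    by_cases h0 : i = 0
    · subst h0
      have hc := hlc (g 0)
      rw [hg0, hpl, hpd] at hc
      rw [hg0] at hymem
      have hc1 : ((T.neighborFinset p).filter fun y => ¬ T.degree y = 1).card ≤ 1 := by omega
      have hmem : g 1 ∈ (T.neighborFinset p).filter fun y => ¬ T.degree y = 1 := by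
        have h1 := hstep 0 (by omega)
        rw [hg0] at h1
        have h2 := hnonleaf 1 (by omega)
        simp only [Finset.mem_filter, SimpleGraph.mem_neighborFinset]
        exact ⟨h1, h2⟩
      exact ⟨1, by omega, Or.inl rfl, Finset.card_le_one.1 hc1 _ hymem _ hmem⟩
    · by_cases h1 : i = m
      · have hc := hlc (g i)
        rw [h1, hgm, hql, hqd] at hc
        rw [h1, hgm] at hymem
        have hc1 : ((T.neighborFinset q).filter fun y => ¬ T.degree y = 1).card ≤ 1 := by omega
        have hmem : g (m - 1) ∈ (T.neighborFinset q).filter fun y => ¬ T.degree y = 1 := by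
          have h1 := hstep (m - 1) (by omega)
          rw [Nat.sub_add_cancel (by omega), hgm] at h1
          have h2 := hnonleaf (m - 1) (by omega)
          simp only [Finset.mem_filter, SimpleGraph.mem_neighborFinset]
          exact ⟨h1.symm, h2⟩
        exact ⟨m - 1, by omega, Or.inr (by omega), Finset.card_le_one.1 hc1 _ hymem _ hmem⟩
      · have hip : g i ≠ p := fun h => h0 (hinj _ _ hi (by omega) (h.trans hg0.symm))
        have hiq : g i ≠ q := fun h => h1 (hinj _ _ hi (by omega) (h.trans hgm.symm))
        have hc := hlc (g i)
        rw [htwo (g i) (hnonleaf i hi) hip hiq] at hc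
        have hc2 : ((T.neighborFinset (g i)).filter fun y => ¬ T.degree y = 1).card = 2 := by
          omega
        have e1 := hstep i (by omega)
        have e2 := hstep (i - 1) (by omega)
        rw [Nat.sub_add_cancel (by omega)] at e2
        have hm1 : g (i + 1) ∈ (T.neighborFinset (g i)).filter fun y => ¬ T.degree y = 1 := by
          simp only [Finset.mem_filter, SimpleGraph.mem_neighborFinset]
          exact ⟨e1, hnonleaf _ (by omega)⟩
        have hm2 : g (i - 1) ∈ (T.neighborFinset (g i)).filter fun y => ¬ T.degree y = 1 := by
          simp only [Finset.mem_filter, SimpleGraph.mem_neighborFinset]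
          exact ⟨e2.symm, hnonleaf _ (by omega)⟩
        have hne : g (i + 1) ≠ g (i - 1) := fun h => by
          have := hinj _ _ (by omega) (by omega) h
          omega
        have hsub : {g (i + 1), g (i - 1)} =
            (T.neighborFinset (g i)).filter fun y => ¬ T.degree y = 1 := by
          refine Finset.eq_of_subset_of_card_le ?_ (by rw [hc2, Finset.card_pair hne])
          intro z hz
          simp only [Finset.mem_insert, Finset.mem_singleton] at hz
          rcases hz with rfl | rfl
          · exact hm1
          · exact hm2
        rw [← hsub] at hymem
        simp only [Finset.mem_insert, Finset.mem_singleton] at hymem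
        rcases hymem with h | h
        · exact ⟨i + 1, by omega, Or.inl rfl, h⟩
        · exact ⟨i - 1, by omega, Or.inr (by omega), h⟩
  have hleafC : ∀ x, T.degree x = 1 → x ∈ C := by
    intro x hx
    by_contra hxC
    have h1 : x ≠ p := by rintro rfl; omega
    have h2 : x ≠ q := by rintro rfl; omega
    have := hthree x hxC h1 h2
    omega
  have hone : ∀ i, i ≤ m → i % 2 = 0 → leafCount T (g i) = 1 := by
    intro i hi hmod
    have hgi : g i ∉ C := fun h => by
      have := (hpar i hi).1 h
      omega
    by_cases h0 : g i = p
    · rw [h0, hpl]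
    · by_cases h1 : g i = q
      · rw [h1, hql]
      · have h3 := hthree _ hgi h0 h1
        have h4 := htwo _ (hnonleaf i hi) h0 h1
        omega
  have hexl : ∀ i, ∃ x, i ≤ m → i % 2 = 0 → T.Adj (g i) x ∧ T.degree x = 1 := by
    intro i
    by_cases h : i ≤ m ∧ i % 2 = 0
    · obtain ⟨x, hx⟩ := exists_leaf_of_leafCount_pos (T := T) (x := g i)
        (by rw [hone i h.1 h.2]; norm_num)
      exact ⟨x, fun _ _ => hx⟩
    -- Only even indices up to `m` matter; for the others `p` is an arbitrary value.
    · exact ⟨p, fun h1 h2 => absurd ⟨h1, h2⟩ h⟩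
  choose l hl using hexl
  -- The spine of T_k runs from v_2 to v_{2k}, so its length 2k - 2 has to be `m`, which is even.
  have hk : 2 * (m / 2 + 1) - 2 = m := by omega
  obtain ⟨φ, hφ1, hφ2⟩ := exists_iso_treeT (T := T) (k := m / 2 + 1) (by omega) g l
    (by rwa [hk])
    (by
      rw [hk]
      intro i j hi hj hmi hmj h
      obtain ⟨h1, h2⟩ := hl i hi hmi
      obtain ⟨h3, h4⟩ := hl j hj hmj
      rw [← h] at h3
      exact hinj _ _ hi hj (eq_of_leaf h2 h1.symm h3.symm))
    (by
      rw [hk]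
      intro i j hi hj hmj h
      exact hnonleaf i hi (h ▸ (hl j hj hmj).2))
    (by
      rw [hk]
      intro i j hi hj
      constructor
      · intro h
        obtain ⟨j', hj', hor, heq⟩ := hnbr i hi (g j) h (hnonleaf j hj)
        have := hinj _ _ hj hj' heq
        omega
      · rintro (rfl | rfl)
        · exact hstep i (by omega)
        · exact (hstep j (by omega)).symm)
    (by
      rw [hk]
      intro i j hi hj hmj
      obtain ⟨h1, h2⟩ := hl j hj hmj
      constructor
      · intro h
        exact hinj _ _ hi hj (eq_of_leaf h2 h.symm h1.symm)
      · rintro rfl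
        exact h1)
    (by
      rw [hk]
      intro i j hi hj hmi hmj
      exact not_adj_of_leaves hT (by omega) (hl i hi hmi).2 (hl j hj hmj).2)
    (by
      rw [hk]
      refine mem_of_closed hT.connected (S := {x | ∃ i ≤ m, x = g i ∨ i % 2 = 0 ∧ x = l i})
        (x := g 0) ⟨0, by omega, Or.inl rfl⟩ ?_
      rintro a ⟨i, hi, rfl | ⟨hmod, rfl⟩⟩ b hb
      · by_cases hbd : T.degree b = 1
        -- All leaves are in `C`, as are the spine vertices of odd index, so the latter carry no
        -- leaf.
        · have hmod : i % 2 = 0 := by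
            have h1 := hpar i hi
            have h2 : g i ∉ C := fun h => hC _ h _ (hleafC b hbd) hb
            rw [h1] at h2
            omega
          obtain ⟨h1, h2⟩ := hl i hi hmod
          exact ⟨i, hi, Or.inr ⟨hmod, eq_of_leafCount_eq_one (hone i hi hmod) hb hbd h1 h2⟩⟩
        · obtain ⟨j, hj, -, rfl⟩ := hnbr i hi b hb hbd
          exact ⟨j, hj, Or.inl rfl⟩
      · obtain ⟨h1, h2⟩ := hl i hi hmod
        exact ⟨i, hi, Or.inl (eq_of_leaf h2 hb h1.symm)⟩)
  refine ⟨m / 2 + 1, by omega, φ, ?_⟩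
  rintro x (rfl | rfl)
  · rw [hφ1, hg0]
    exact ⟨hpC, hpd, hnC p hpC⟩
  · rw [hφ2, hk, hgm]
    exact ⟨hqC, hqd, hnC q hqC⟩

end TreeT

/-! ### Resonant sets and the upper bound -/

section Matchings

variable {V : Type u} {G : SimpleGraph V}

/-- A hexagon is alternating for a matching if and only if the matching covers its vertices by its
edges. -/
theorem isAlternating_iff {M : G.Subgraph} (hM : M.IsMatching) (h : Hexagon G) :
    IsAlternating M h ↔ ∀ x ∈ h.1.verts, ∃ y, h.1.Adj x y ∧ M.Adj x y := by
  classical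
  obtain ⟨p, hp, hv, ha⟩ := exists_labelling h.2
  set S : Finset (Fin 6) := Finset.univ.filter fun i => M.Adj (p i) (p (i + 1)) with hS
  have hmem : ∀ i, i ∈ S ↔ M.Adj (p i) (p (i + 1)) := by simp [hS]
  have hcard : (M.edgeSet ∩ h.1.edgeSet).ncard = S.card := by
    have : M.edgeSet ∩ h.1.edgeSet = (fun i => s(p i, p (i + 1))) '' (S : Set (Fin 6)) := by
      rw [edgeSet_eq_range_of_labelling hv ha]
      ext e
      constructor
      · rintro ⟨he, i, rfl⟩
        exact ⟨i, by simpa [hS] using he, rfl⟩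
      · rintro ⟨i, hi, rfl⟩
        exact ⟨by simpa [hS] using hi, i, rfl⟩
    rw [this, Set.ncard_image_of_injective _ (injective_edge_of_labelling hp),
      Set.ncard_coe_finset]
  have hindep : ∀ i ∈ S, i + 1 ∉ S := by
    intro i hi hi'
    rw [hmem] at hi hi'
    have := hp (hM.eq_of_adj_left hi.symm hi')
    exact (by decide : ∀ i : Fin 6, i ≠ i + 1 + 1) i this
  have key : (∀ x ∈ h.1.verts, ∃ y, h.1.Adj x y ∧ M.Adj x y) ↔ ∀ i, i ∈ S ∨ i - 1 ∈ S := by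
    have hsub : ∀ i : Fin 6, i - 1 + 1 = i := by decide
    constructor
    · intro hx i
      obtain ⟨y, hy, hMy⟩ := hx (p i) (hv ▸ ⟨i, rfl⟩)
      obtain ⟨j, rfl⟩ := hv ▸ h.1.edge_vert hy.symm
      rcases (ha _ _).1 hy with rfl | rfl
      · exact Or.inl ((hmem _).2 hMy)
      · refine Or.inr ((hmem _).2 ?_)
        rw [(by decide : ∀ j : Fin 6, j + 1 - 1 = j) j]
        exact hMy.symm
    · intro hi x hx
      obtain ⟨i, rfl⟩ := hv ▸ hx
      rcases hi i with h1 | h1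
      · exact ⟨_, (ha _ _).2 (Or.inl rfl), (hmem _).1 h1⟩
      · have h2 := (hmem _).1 h1
        rw [hsub] at h2
        exact ⟨p (i - 1), (ha _ _).2 (Or.inr (hsub i).symm), h2.symm⟩
  unfold IsAlternating
  rw [hcard, key]
  -- What remains is a finite check: a set `S` of pairwise non-consecutive edges of the 6-cycle has
  -- three elements exactly when it covers all vertices.
  revert hindep
  clear_value S
  clear * -
  revert S
  decide

/-- A perfect matching of a hexagon that contains a given edge of it. -/
theorem Hexagon.exists_matching (h : Hexagon G) {x y : V} (hxy : h.1.Adj x y) :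
    ∃ A : G.Subgraph, A.IsMatching ∧ A.verts = h.1.verts ∧ A.Adj x y ∧
      ∀ u v, A.Adj u v → h.1.Adj u v := by
  obtain ⟨p, hp, hv, ha⟩ := exists_labelling h.2
  have hcongr : ∀ u v a b, s(a, b) = s(u, v) → h.1.Adj a b → h.1.Adj u v := by
    intro u v a b hs hab
    have h1 : s(a, b) ∈ h.1.edgeSet := hab
    rw [hs] at h1
    exact h1
  -- The predicate `r` selects every other edge of the cycle.
  have main : ∀ r : Fin 6 → Prop, (∀ i, r i ↔ ¬ r (i + 1)) →
      ∃ A : G.Subgraph, A.IsMatching ∧ A.verts = h.1.verts ∧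
        (∀ i, r i → A.Adj (p i) (p (i + 1))) ∧ ∀ u v, A.Adj u v → h.1.Adj u v := by
    intro r hr
    have hsub : ∀ u v, (∃ i, r i ∧ s(p i, p (i + 1)) = s(u, v)) → h.1.Adj u v := by
      rintro u v ⟨i, -, hi⟩
      exact hcongr _ _ _ _ hi ((ha _ _).2 (Or.inl rfl))
    refine ⟨⟨h.1.verts, fun u v => ∃ i, r i ∧ s(p i, p (i + 1)) = s(u, v),
      fun huv => (hsub _ _ huv).adj_sub, fun huv => h.1.edge_vert (hsub _ _ huv),
      ⟨fun u v ⟨i, hi, hs⟩ => ⟨i, hi, hs.trans Sym2.eq_swap⟩⟩⟩, ?_, rfl,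
      fun i hi => ⟨i, hi, rfl⟩, hsub⟩
    intro v hvv
    obtain ⟨i, rfl⟩ := hv ▸ hvv
    have hsub1 : ∀ i : Fin 6, i - 1 + 1 = i := by decide
    by_cases hi : r i
    · refine ⟨p (i + 1), ⟨i, hi, rfl⟩, ?_⟩
      rintro w ⟨j, hj, hs⟩
      rcases Sym2.eq_iff.1 hs with ⟨h1, h2⟩ | ⟨h1, h2⟩
      · rw [← h2, hp h1]
      · exact absurd ((hp h2) ▸ hi) ((hr j).1 hj)
    · have hi' : r (i - 1) := by rw [hr, hsub1]; exact hi
      refine ⟨p (i - 1), ⟨i - 1, hi', by rw [hsub1]; exact Sym2.eq_swap⟩, ?_⟩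
      rintro w ⟨j, hj, hs⟩
      rcases Sym2.eq_iff.1 hs with ⟨h1, h2⟩ | ⟨h1, h2⟩
      · exact absurd (hp h1 ▸ hj) hi
      · rw [← h1, ← hp h2, (by decide : ∀ j : Fin 6, j + 1 - 1 = j) j]
  obtain ⟨i, rfl⟩ := hv ▸ h.1.edge_vert hxy
  obtain ⟨j, rfl⟩ := hv ▸ h.1.edge_vert hxy.symm
  have hex : ∀ i : Fin 6, ∃ A : G.Subgraph, A.IsMatching ∧ A.verts = h.1.verts ∧
      A.Adj (p i) (p (i + 1)) ∧ ∀ u v, A.Adj u v → h.1.Adj u v := by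
    intro i
    obtain ⟨A, h1, h2, h3, h4⟩ := main (fun j => j.val % 2 = i.val % 2)
      ((by decide : ∀ i j : Fin 6, (j.val % 2 = i.val % 2 ↔ ¬ (j + 1).val % 2 = i.val % 2)) i)
    exact ⟨A, h1, h2, h3 i rfl, h4⟩
  rcases (ha _ _).1 hxy with rfl | rfl
  · exact hex i
  · obtain ⟨A, h1, h2, h3, h4⟩ := hex j
    exact ⟨A, h1, h2, h3.symm, h4⟩

theorem Hexagon.exists_perfect (h : Hexagon G) :
    ∃ A : G.Subgraph, A.IsMatching ∧ A.verts = h.1.verts ∧ ∀ u v, A.Adj u v → h.1.Adj u v := by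
  obtain ⟨x, hx⟩ := h.nonempty_verts
  obtain ⟨y, hy⟩ := h.exists_adj hx
  obtain ⟨A, h1, h2, -, h3⟩ := h.exists_matching hy
  exact ⟨A, h1, h2, h3⟩

/-- A matching `M₀` extends by perfect matchings of disjoint hexagons that cover the other
vertices. -/
theorem isResonant_of_cover {M₀ : G.Subgraph} (hM₀ : M₀.IsMatching) (D : Set (Hexagon G))
    (hD : ∀ h ∈ D, ∀ h' ∈ D, h ≠ h' → Disjoint h.1.verts h'.1.verts)
    (hcov : ∀ x, x ∈ M₀.verts ↔ ∀ h ∈ D, x ∉ h.1.verts) (C : Finset (Hexagon G))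
    (hC : ∀ h ∈ C, ∀ h' ∈ C, h ≠ h' → Disjoint h.1.verts h'.1.verts)
    (halt : ∀ h ∈ C, h ∈ D ∨ ∀ x ∈ h.1.verts, ∃ y, h.1.Adj x y ∧ M₀.Adj x y) :
    IsResonant C := by
  choose A hAm hAv hAle using fun h : Hexagon G => h.exists_perfect
  let M : G.Subgraph :=
    { verts := Set.univ
      Adj := fun u v => M₀.Adj u v ∨ ∃ h ∈ D, (A h).Adj u v
      adj_sub := by
        rintro u v (huv | ⟨h, -, huv⟩)
        · exact huv.adj_sub
        · exact huv.adj_sub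
      edge_vert := fun _ => Set.mem_univ _
      symm := ⟨by
        rintro u v (huv | ⟨h, hh, huv⟩)
        · exact Or.inl huv.symm
        · exact Or.inr ⟨h, hh, huv.symm⟩⟩ }
  have hperf : M.IsPerfectMatching := by
    rw [SimpleGraph.Subgraph.isPerfectMatching_iff]
    intro v
    by_cases hv : v ∈ M₀.verts
    · obtain ⟨w, hw, huniq⟩ := hM₀ hv
      refine ⟨w, Or.inl hw, ?_⟩
      rintro z (hz | ⟨h, hh, hz⟩)
      · exact huniq z hz
      · exact absurd ((hAle h _ _ hz).fst_mem) ((hcov v).1 hv h hh)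
    · have := hv
      rw [hcov] at this
      push Not at this
      obtain ⟨h, hh, hvh⟩ := this
      obtain ⟨w, hw, huniq⟩ := hAm h (hAv h ▸ hvh)
      refine ⟨w, Or.inr ⟨h, hh, hw⟩, ?_⟩
      rintro z (hz | ⟨h', hh', hz⟩)
      · exact absurd hz.fst_mem hv
      · have heq : h' = h := by
          by_contra hne
          exact Set.disjoint_left.1 (hD h' hh' h hh hne) (hAle h' _ _ hz).fst_mem hvh
        subst heq
        exact huniq z hz
  refine ⟨hC, M, hperf, fun h hh => ?_⟩
  rw [isAlternating_iff hperf.1]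
  intro x hx
  rcases halt h hh with hhD | hhM
  · obtain ⟨w, hw, -⟩ := hAm h (hAv h ▸ hx)
    exact ⟨w, hAle h _ _ hw, Or.inr ⟨h, hhD, hw⟩⟩
  · obtain ⟨y, hy, hy'⟩ := hhM x hx
    exact ⟨y, hy, Or.inl hy'⟩

theorem IsResonant.not_adj (hB : IsBenzenoid G) {C : Finset (Hexagon G)} (hC : IsResonant C) :
    ∀ h ∈ C, ∀ h' ∈ C, ¬ (dualist G).Adj h h' := by
  intro h hh h' hh' hadj
  exact (disjoint_verts_iff hB hadj.1).1 (hC.1 h hh h' hh' hadj.1) hadj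

/-- An independent set of hexagons is resonant if every other hexagon has all its neighbours in
the set, and has three neighbours or is angular. -/
theorem IsCatacondensed.isResonant_of_angular (hB : IsCatacondensed G) (C : Finset (Hexagon G))
    (hind : ∀ h ∈ C, ∀ h' ∈ C, ¬ (dualist G).Adj h h')
    (hout : ∀ h, h ∉ C → (∀ k, (dualist G).Adj h k → k ∈ C) ∧
      (((dualist G).neighborSet h).ncard = 3 ∨ IsAngular G h)) : IsResonant C := by
  have hBb := hB.isBenzenoid
  have hdisj : ∀ h ∈ C, ∀ h' ∈ C, h ≠ h' → Disjoint h.1.verts h'.1.verts :=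
    fun h hh h' hh' hne => (disjoint_verts_iff hBb hne).2 (hind h hh h' hh')
  set S : Set V := {x | ∀ h ∈ C, x ∉ h.1.verts} with hS
  -- The subgraph induced on the vertices missed by `C` is itself a matching. A hexagon outside `C`
  -- with three neighbours is entirely covered by them, and an angular one misses just its two
  -- vertices of degree 2, which are adjacent.
  let M₀ : G.Subgraph :=
    { verts := S
      Adj := fun u v => G.Adj u v ∧ u ∈ S ∧ v ∈ S
      adj_sub := fun huv => huv.1
      edge_vert := fun huv => huv.2.1
      symm := ⟨fun u v huv => ⟨huv.1.symm, huv.2.2, huv.2.1⟩⟩ }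
  refine isResonant_of_cover (M₀ := M₀) ?_ (C : Set (Hexagon G)) hdisj (fun x => Iff.rfl) C hdisj
    fun h hh => Or.inl hh
  intro x (hx : x ∈ S)
  obtain ⟨h, hxh⟩ := hBb.exists_hexagon_mem x
  have hhC : h ∉ C := fun hh => hx h hh hxh
  obtain ⟨hnb, hcase⟩ := hout h hhC
  have huniq : ∀ z ∈ S, z ∈ h.1.verts → ∀ k : Hexagon G, z ∈ k.1.verts → k = h := by
    intro z hz hzh k hk
    by_contra hne
    exact hz k (hnb k (dualist_adj_of_mem hBb (Ne.symm hne) hzh hk)) hk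
  rcases hcase with h3 | ⟨-, a, b, hab, hadj⟩
  · obtain ⟨k, hk, hxk⟩ := hB.exists_adj_mem_of_ncard_eq_three h3 hxh
    exact absurd hxk (hx k (hnb k hk))
  · have hmem : ∀ z ∈ h.1.verts, z ∈ S ↔ z = a ∨ z = b := by
      intro z hz
      have h1 : z ∈ {w | w ∈ h.1.verts ∧ HasDegreeTwo G w} ↔ z = a ∨ z = b := by
        rw [hab]
        rfl
      rw [← h1]
      constructor
      · intro hzS
        exact ⟨hz, (hB.hasDegreeTwo_iff hz).2 (huniq z hzS hz)⟩
      · rintro ⟨-, hd⟩ k hk hzk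
        exact hhC ((hB.hasDegreeTwo_iff hz).1 hd k hzk ▸ hk)
    have hah : a ∈ h.1.verts := by
      have : a ∈ ({a, b} : Set V) := Or.inl rfl
      rw [← hab] at this
      exact this.1
    have hbh : b ∈ h.1.verts := by
      have : b ∈ ({a, b} : Set V) := Or.inr rfl
      rw [← hab] at this
      exact this.1
    have hnbr : ∀ w, M₀.Adj x w → w = a ∨ w = b := by
      intro w hw
      obtain ⟨k, hk⟩ := hBb.exists_hexagon_adj hw.1
      rw [huniq x hx hxh k hk.fst_mem] at hk
      exact (hmem w hk.snd_mem).1 hw.2.2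
    have haS := (hmem a hah).2 (Or.inl rfl)
    have hbS := (hmem b hbh).2 (Or.inr rfl)
    rcases (hmem x hxh).1 hx with rfl | rfl
    · exact ⟨b, ⟨hadj, haS, hbS⟩, fun w hw => (hnbr w hw).resolve_left hw.1.ne'⟩
    · exact ⟨a, ⟨hadj.symm, hbS, haS⟩, fun w hw => (hnbr w hw).resolve_right hw.1.ne'⟩

/-- With respect to a resonant set, a hexagon whose two neighbours are chosen is angular. -/
theorem IsCatacondensed.isAngular_of_isResonant (hB : IsCatacondensed G)
    {C : Finset (Hexagon G)} (hC : IsResonant C) {h : Hexagon G}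
    (h2 : ((dualist G).neighborSet h).ncard = 2)
    (hnb : ∀ k, (dualist G).Adj h k → k ∈ C) : IsAngular G h := by
  have hBb := hB.isBenzenoid
  have hcard := hB.ncard_hasDegreeTwo h
  rw [h2] at hcard
  obtain ⟨u, v, huv, hset⟩ := Set.ncard_eq_two.1
    (show {w | w ∈ h.1.verts ∧ HasDegreeTwo G w}.ncard = 2 by omega)
  refine ⟨h2, u, v, hset, ?_⟩
  have hu : u ∈ h.1.verts ∧ HasDegreeTwo G u := by
    have : u ∈ ({u, v} : Set V) := Or.inl rfl
    rwa [← hset] at this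
  have huniq := (hB.hasDegreeTwo_iff hu.1).1 hu.2
  obtain ⟨-, M, hM, halt⟩ := hC
  obtain ⟨w, hw, -⟩ := SimpleGraph.Subgraph.isPerfectMatching_iff.1 hM u
  obtain ⟨k, hk⟩ := hBb.exists_hexagon_adj hw.adj_sub
  rw [huniq k hk.fst_mem] at hk
  -- If the partner `w` of `u` lay in a second hexagon, that hexagon would be in `C`. Being
  -- alternating, it would contain the matching edge `wu`, although `u` lies only in `h`.
  have hwdeg : HasDegreeTwo G w := by
    rw [hB.hasDegreeTwo_iff hk.snd_mem]
    intro k' hk'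
    by_contra hne
    have hC' := hnb k' (dualist_adj_of_mem hBb (Ne.symm hne) hk.snd_mem hk')
    obtain ⟨y, hy, hMy⟩ := (isAlternating_iff hM.1 k').1 (halt k' hC') w hk'
    have : y = u := hM.1.eq_of_adj_left hMy hw.symm
    rw [this] at hy
    exact hne (huniq k' hy.snd_mem)
  have hwm : w ∈ ({u, v} : Set V) := by
    rw [← hset]
    exact ⟨hk.snd_mem, hwdeg⟩
  rcases hwm with rfl | rfl
  · exact absurd rfl hw.adj_sub.ne
  · exact hw.adj_sub

theorem bddAbove_resonant [Finite V] :
    BddAbove {k | ∃ C : Finset (Hexagon G), IsResonant C ∧ C.card = k} := by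
  have : Fintype (Hexagon G) := Fintype.ofFinite _
  refine ⟨Fintype.card (Hexagon G), ?_⟩
  rintro k ⟨C, -, rfl⟩
  exact C.card_le_univ

theorem IsResonant.card_le_clarNumber [Finite V] {C : Finset (Hexagon G)} (hC : IsResonant C) :
    C.card ≤ clarNumber G :=
  le_csSup bddAbove_resonant ⟨C, hC, rfl⟩

/-- Positivity excludes the case that there is no resonant set at all, in which `sSup` has the
default value 0. -/
theorem exists_isResonant_card_eq [Finite V] (h : 0 < clarNumber G) :
    ∃ C : Finset (Hexagon G), IsResonant C ∧ C.card = clarNumber G := by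
  refine Nat.sSup_mem ?_ bddAbove_resonant
  by_contra hne
  rw [Set.not_nonempty_iff_eq_empty] at hne
  unfold clarNumber at h
  rw [hne] at h
  simp at h

theorem IsCatacondensed.three_mul_card_le (hB : IsCatacondensed G) {C : Finset (Hexagon G)}
    (hC : IsResonant C) : 3 * C.card ≤ 2 * numHexagons G + 1 := by
  classical
  have := hB.isBenzenoid.finite
  have : Fintype (Hexagon G) := Fintype.ofFinite _
  unfold numHexagons
  rw [Nat.card_eq_fintype_card]
  refine Benzenoid.three_mul_card_le hB.dualist_isTree (fun h => ?_) C
    (hC.not_adj hB.isBenzenoid)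
  have := hB.ncard_dualist_neighborSet_le h
  rwa [Set.ncard_eq_toFinset_card', ← SimpleGraph.neighborFinset,
    SimpleGraph.card_neighborFinset_eq_degree] at this

theorem IsCatacondensed.clarNumber_le (hB : IsCatacondensed G) :
    clarNumber G ≤ (2 * numHexagons G + 1) / 3 := by
  have := hB.isBenzenoid.finite
  rcases Nat.eq_zero_or_pos (clarNumber G) with h0 | hpos
  · omega
  · obtain ⟨C, hC, hcard⟩ := exists_isResonant_card_eq hpos
    have := hB.three_mul_card_le hC
    omega

/-- The inequality says without division that `C.card` is at least the rounded bound. -/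
theorem IsCatacondensed.clarNumber_eq_of_le (hB : IsCatacondensed G) {C : Finset (Hexagon G)}
    (hC : IsResonant C) (hcard : 2 * numHexagons G ≤ 3 * C.card + 1) :
    clarNumber G = (2 * numHexagons G + 1) / 3 := by
  have := hB.isBenzenoid.finite
  have h1 := hB.clarNumber_le
  have h2 := hC.card_le_clarNumber
  omega

theorem IsCatacondensed.numHexagons_pos (hB : IsCatacondensed G) : 0 < numHexagons G := by
  have := hB.isBenzenoid.finite
  obtain ⟨h⟩ := hB.dualist_connected.nonempty
  exact Nat.card_pos_iff.2 ⟨⟨h⟩, inferInstance⟩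

end Matchings

/-- The image of a hexagon under an injective homomorphism. -/
def Hexagon.map {V : Type u} {W : Type u} {G : SimpleGraph V} {G' : SimpleGraph W} (f : G →g G')
    (hf : Function.Injective f) (h : Hexagon G) : Hexagon G' :=
  ⟨h.1.map f, by
    obtain ⟨p, hp, hv, ha⟩ := exists_labelling h.2
    refine nonempty_iso_cycleGraph_six (f ∘ p) (hf.comp hp) ?_ ?_
    · rw [SimpleGraph.Subgraph.map_verts, hv, Set.range_comp]
    · intro i j
      rw [← ha, SimpleGraph.Subgraph.map_adj]
      constructor
      · rintro ⟨x, y, hxy, hx, hy⟩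
        rw [← hf hx, ← hf hy]
        exact hxy
      · intro h
        exact ⟨_, _, h, rfl, rfl⟩⟩

/-! ### Gluing along an edge -/

section Gluing

variable {V W : Type u} {G : SimpleGraph V} {G' : SimpleGraph W}

theorem Hexagon.verts_map (f : G →g G') (hf : Function.Injective f) (h : Hexagon G) :
    (h.map f hf).1.verts = f '' h.1.verts := rfl

theorem Hexagon.map_adj (f : G →g G') (hf : Function.Injective f) {h : Hexagon G} {x y : V}
    (hxy : h.1.Adj x y) : (h.map f hf).1.Adj (f x) (f y) := ⟨x, y, hxy, rfl, rfl⟩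

theorem Hexagon.adj_of_map_adj (f : G →g G') (hf : Function.Injective f) {h : Hexagon G} {x y : V}
    (hxy : (h.map f hf).1.Adj (f x) (f y)) : h.1.Adj x y := by
  obtain ⟨a, b, hab, ha, hb⟩ := hxy
  rw [← hf ha, ← hf hb]
  exact hab

theorem Hexagon.map_injective (f : G →g G') (hf : Function.Injective f) :
    Function.Injective (Hexagon.map f hf) := by
  intro h h' heq
  have hv : f '' h.1.verts = f '' h'.1.verts := by
    rw [← Hexagon.verts_map f hf, ← Hexagon.verts_map f hf, heq]
  apply Hexagon.ext
  refine SimpleGraph.Subgraph.ext (hf.image_injective hv) ?_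
  ext x y
  constructor
  · intro hxy
    have := Hexagon.map_adj f hf hxy
    rw [heq] at this
    exact Hexagon.adj_of_map_adj f hf this
  · intro hxy
    have := Hexagon.map_adj f hf hxy
    rw [← heq] at this
    exact Hexagon.adj_of_map_adj f hf this

variable {U : Type u} {B' : SimpleGraph U} {B₁ : SimpleGraph W} {B : SimpleGraph V} {a b : U}
  {c d : W}

theorem IsEdgeGluing.finite [Finite U] [Finite W] (h : IsEdgeGluing B' a b B₁ c d B) :
    Finite V := by
  obtain ⟨f, g, -, -, hun, -⟩ := h
  have : (Set.univ : Set V).Finite := by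
    rw [← hun]
    exact (Set.finite_range f).union (Set.finite_range g)
  exact Set.finite_univ_iff.1 this

theorem IsEdgeGluing.card_vert [Finite U] [Finite W] (h : IsEdgeGluing B' a b B₁ c d B)
    (hab : a ≠ b) : Nat.card V + 2 = Nat.card U + Nat.card W := by
  have := h.finite
  obtain ⟨f, g, -, -, hun, hin, -⟩ := h
  have h1 := Set.ncard_union_add_ncard_inter (Set.range f) (Set.range g)
  rw [hun, hin, Set.ncard_univ, Set.ncard_pair (f.injective.ne hab)] at h1
  rw [h1, ← Set.image_univ, ← Set.image_univ, Set.ncard_image_of_injective _ f.injective,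
    Set.ncard_image_of_injective _ g.injective, Set.ncard_univ, Set.ncard_univ]

theorem IsEdgeGluing.card_edgeSet [Finite U] [Finite W] (h : IsEdgeGluing B' a b B₁ c d B)
    (hab : B'.Adj a b) (hcd : B₁.Adj c d) :
    Nat.card B.edgeSet + 1 = Nat.card B'.edgeSet + Nat.card B₁.edgeSet := by
  have := h.finite
  obtain ⟨f, g, hac, hbd, hun, hin, rfl⟩ := h
  have h1 := Set.ncard_union_add_ncard_inter (B'.map f).edgeSet (B₁.map g).edgeSet
  have h2 : (B'.map f).edgeSet ∩ (B₁.map g).edgeSet = {s(f a, f b)} := by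
    ext e
    induction e with | _ x y => ?_
    simp only [Set.mem_inter_iff, SimpleGraph.mem_edgeSet, Set.mem_singleton_iff]
    constructor
    · rintro ⟨hx, hy⟩
      have hne := hx.ne
      obtain ⟨x', y', -, rfl, rfl⟩ := (SimpleGraph.map_adj _ _ _ _).1 hx
      obtain ⟨x'', y'', -, ex, ey⟩ := (SimpleGraph.map_adj _ _ _ _).1 hy
      have m1 : f x' ∈ Set.range f ∩ Set.range g := ⟨⟨_, rfl⟩, ⟨_, ex⟩⟩
      have m2 : f y' ∈ Set.range f ∩ Set.range g := ⟨⟨_, rfl⟩, ⟨_, ey⟩⟩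
      rw [hin] at m1 m2
      simp only [Set.mem_insert_iff, Set.mem_singleton_iff] at m1 m2
      rw [Sym2.eq_iff]
      grind
    · intro heq
      have e1 : (B'.map f).Adj (f a) (f b) := (SimpleGraph.map_adj _ _ _ _).2 ⟨a, b, hab, rfl, rfl⟩
      have e2 : (B₁.map g).Adj (f a) (f b) :=
        (SimpleGraph.map_adj _ _ _ _).2 ⟨c, d, hcd, hac.symm, hbd.symm⟩
      rw [← SimpleGraph.mem_edgeSet, ← heq] at e1 e2
      exact ⟨e1, e2⟩
  rw [← SimpleGraph.edgeSet_sup, h2, Set.ncard_singleton, SimpleGraph.edgeSet_map,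
    SimpleGraph.edgeSet_map, Set.ncard_image_of_injective _ f.sym2Map.injective,
    Set.ncard_image_of_injective _ g.sym2Map.injective] at h1
  exact h1

/-- In all three graphs the number of hexagons is E - V + 1, which is additive when one edge and two
vertices are identified. The hexagons themselves need not be compared. -/
theorem IsEdgeGluing.numHexagons_eq (h : IsEdgeGluing B' a b B₁ c d B) (hab : B'.Adj a b)
    (hcd : B₁.Adj c d) (hB' : IsBenzenoid B') (hB₁ : IsBenzenoid B₁) (hB : IsBenzenoid B) :
    numHexagons B = numHexagons B' + numHexagons B₁ := by
  have := hB'.finite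
  have := hB₁.finite
  have h1 := hB'.card_edgeSet_add_one
  have h2 := hB₁.card_edgeSet_add_one
  have h3 := hB.card_edgeSet_add_one
  have h4 := h.card_vert hab.ne
  have h5 := h.card_edgeSet hab hcd
  omega

theorem not_triangle {ι : Type*} {T : SimpleGraph ι} (hT : T.IsAcyclic) {x y z : ι}
    (hxy : T.Adj x y) (hyz : T.Adj y z) : ¬ T.Adj x z := by
  classical
  intro hxz
  have : ∃ s : Finset ι, T.IsNClique 3 s :=
    ⟨{x, y, z}, SimpleGraph.is3Clique_triple_iff.2 ⟨hxy, hxz, hyz⟩⟩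
  obtain ⟨u, w, hw, -⟩ := (SimpleGraph.is3Clique_iff_exists_cycle_length_three).1 this
  exact hT w hw

/-- The hexagons of an angular triple. -/
theorem IsAngularTriple.exists_leaves {h : Hexagon G} (hG : IsAngularTriple G h) :
    ∃ l l' : Hexagon G, l ≠ l' ∧ (∀ k, k = h ∨ k = l ∨ k = l') ∧ (dualist G).Adj h l ∧
      (dualist G).Adj h l' ∧ ¬ (dualist G).Adj l l' := by
  obtain ⟨hB, hn, hang, -⟩ := hG
  have := hB.isBenzenoid.finite
  obtain ⟨l, l', hne, hset⟩ := Set.ncard_eq_two.1 hang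
  have hl : l ∈ (dualist G).neighborSet h := by rw [hset]; exact Or.inl rfl
  have hl' : l' ∈ (dualist G).neighborSet h := by rw [hset]; exact Or.inr rfl
  refine ⟨l, l', hne, ?_, hl, hl', not_triangle hB.dualist_isTree.2 hl.symm hl'⟩
  have h3 : ({h, l, l'} : Set (Hexagon G)).ncard = 3 :=
    Set.ncard_eq_three.2 ⟨h, l, l', hl.1, hl'.1, hne, rfl⟩
  have huniv : ({h, l, l'} : Set (Hexagon G)) = Set.univ := by
    refine Set.eq_of_subset_of_ncard_le (Set.subset_univ _) ?_
    rw [h3, Set.ncard_univ]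
    exact hn.le
  intro k
  have : k ∈ ({h, l, l'} : Set (Hexagon G)) := huniv ▸ Set.mem_univ k
  simpa using this

end Gluing

/-! ### Members of the family attain the bound -/

section LowerBounds

variable {V : Type u} {B : SimpleGraph V}

theorem clarNumber_eq_of_one (hB : IsCatacondensed B) (hn : numHexagons B = 1) :
    clarNumber B = (2 * numHexagons B + 1) / 3 := by
  have := hB.isBenzenoid.finite
  have : Fintype (Hexagon B) := Fintype.ofFinite _
  have hsub : Subsingleton (Hexagon B) := Finite.card_le_one_iff_subsingleton.1 hn.le
  refine hB.clarNumber_eq_of_le (C := Finset.univ) (hB.isResonant_of_angular _ ?_ ?_) ?_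
  · intro h _ h' _ hadj
    exact hadj.1 (Subsingleton.elim _ _)
  · intro h hh
    exact absurd (Finset.mem_univ h) hh
  · rw [Finset.card_univ, ← Nat.card_eq_fintype_card]
    unfold numHexagons at *
    omega

theorem clarNumber_eq_of_two (hB : IsCatacondensed B) (hn : numHexagons B = 2) :
    clarNumber B = (2 * numHexagons B + 1) / 3 := by
  have hBb := hB.isBenzenoid
  have := hBb.finite
  obtain ⟨h, k, hne, hall⟩ := Nat.card_eq_two_iff.1 hn
  have hall' : ∀ t : Hexagon B, t = h ∨ t = k := fun t => by
    have : t ∈ ({h, k} : Set (Hexagon B)) := hall ▸ Set.mem_univ t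
    simpa using this
  have hadj : (dualist B).Adj h k := by
    have : Nontrivial (Hexagon B) := ⟨h, k, hne⟩
    obtain ⟨t, ht⟩ := hB.dualist_connected.preconnected.exists_adj_of_nontrivial h
    rcases hall' t with rfl | rfl
    · exact absurd rfl ht.1
    · exact ht
  obtain ⟨x, y, hx, hx'⟩ := exists_adj_of_dualist_adj hadj
  obtain ⟨z, hz, hz', hinter, -⟩ := hB.exists_inter_eq hne hx.fst_mem hx'.fst_mem
  -- From a perfect matching of `k` through the common edge, dropping this edge leaves a matching of
  -- exactly the vertices outside `h`.
  obtain ⟨A, hAm, hAv, hAadj, hAle⟩ := k.exists_matching hz'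
  have hmem : ∀ w, w ∈ k.1.verts → (w ∈ h.1.verts ↔ w = x ∨ w = z) := by
    intro w hw
    have : w ∈ h.1.verts ∩ k.1.verts ↔ w = x ∨ w = z := by
      rw [hinter]
      rfl
    rw [← this]
    exact ⟨fun hwh => ⟨hwh, hw⟩, fun h => h.1⟩
  have hM : (A.deleteVerts {x, z}).IsMatching := by
    intro w hw
    rw [SimpleGraph.Subgraph.deleteVerts_verts] at hw
    obtain ⟨t, ht, huniq⟩ := hAm hw.1
    have hwx : w ≠ x ∧ w ≠ z := by simpa using hw.2
    refine ⟨t, ?_, ?_⟩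
    · refine SimpleGraph.Subgraph.deleteVerts_adj.2 ?_
      refine ⟨hw.1, hw.2, ht.snd_mem, ?_, ht⟩
      rintro (rfl | rfl)
      · exact hwx.2 (hAm.eq_of_adj_left ht.symm hAadj)
      · exact hwx.1 (hAm.eq_of_adj_left ht.symm hAadj.symm)
    · intro s hs
      exact huniq s (SimpleGraph.Subgraph.deleteVerts_adj.1 hs).2.2.2.2
  refine hB.clarNumber_eq_of_le (C := {h}) (isResonant_of_cover hM {h} ?_ ?_ _ ?_ ?_) ?_
  · intro t ht t' ht' htt
    exact absurd (ht.trans ht'.symm) htt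
  · intro w
    rw [SimpleGraph.Subgraph.deleteVerts_verts, hAv]
    constructor
    · rintro ⟨hwk, hw⟩ t rfl hwt
      exact hw ((hmem w hwk).1 hwt)
    · intro hw
      have hwh := hw h rfl
      obtain ⟨t, ht⟩ := hBb.exists_hexagon_mem w
      rcases hall' t with rfl | rfl
      · exact absurd ht hwh
      · exact ⟨ht, fun hw' => hwh ((hmem w ht).2 hw')⟩
  · intro t ht t' ht' htt
    rw [Finset.mem_singleton] at ht ht'
    exact absurd (ht.trans ht'.symm) htt
  · intro t ht
    exact Or.inl (Finset.mem_singleton.1 ht)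
  · rw [hn]
    simp

theorem clarNumber_eq_of_isAngularTriple {h : Hexagon B} (hh : IsAngularTriple B h) :
    clarNumber B = (2 * numHexagons B + 1) / 3 := by
  classical
  have hB := hh.1
  have hn := hh.2.1
  obtain ⟨l, l', hne, hall, hl, hl', hnot⟩ := hh.exists_leaves
  refine hB.clarNumber_eq_of_le (C := {l, l'}) (hB.isResonant_of_angular _ ?_ ?_) ?_
  · intro t ht t' ht'
    simp only [Finset.mem_insert, Finset.mem_singleton] at ht ht'
    rcases ht with rfl | rfl <;> rcases ht' with rfl | rfl
    · exact SimpleGraph.irrefl _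
    · exact hnot
    · exact fun h => hnot h.symm
    · exact SimpleGraph.irrefl _
  · intro t ht
    have hth : t = h := by
      rcases hall t with e | rfl | rfl
      · exact e
      · simp at ht
      · simp at ht
    subst hth
    refine ⟨fun k hk => ?_, Or.inr hh.2.2⟩
    rcases hall k with rfl | rfl | rfl
    · exact absurd hk (SimpleGraph.irrefl _)
    · simp
    · simp
  · rw [hn, Finset.card_pair hne]
    norm_num

theorem neighborSet_treeT {k : ℕ} {a : Fin (2 * k + 1)} (hodd : a.val % 2 = 1) (h1 : a.val ≠ 1)
    (h2 : a.val ≠ 2 * k - 1) : ((treeT k).neighborSet (Sum.inl a)).ncard = 3 := by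
  have ha := a.2
  rw [Set.ncard_eq_three]
  refine ⟨Sum.inl ⟨a.val - 1, by omega⟩, Sum.inl ⟨a.val + 1, by omega⟩,
    Sum.inr ⟨(a.val - 3) / 2, by omega⟩, ?_, by simp, by simp, ?_⟩
  · simp only [ne_eq, Sum.inl.injEq, Fin.mk.injEq]
    omega
  · ext x
    rcases x with b | j
    · simp only [SimpleGraph.mem_neighborSet, treeT_adj_inl_inl, Set.mem_insert_iff,
        Set.mem_singleton_iff, Sum.inl.injEq, Fin.ext_iff, reduceCtorEq, or_false]
      omega
    · simp only [SimpleGraph.mem_neighborSet, treeT_adj_inl_inr, Set.mem_insert_iff,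
        Set.mem_singleton_iff, Sum.inr.injEq, Fin.ext_iff, reduceCtorEq, false_or]
      omega

theorem clarNumber_eq_of_treeT (hB : IsCatacondensed B) {k : ℕ} (hk : 2 ≤ k)
    (φ : treeT k ≃g dualist B) (h_first : IsAngular B (φ (Sum.inl ⟨1, by omega⟩)))
    (h_last : IsAngular B (φ (Sum.inl ⟨2 * k - 1, by omega⟩))) :
    clarNumber B = (2 * numHexagons B + 1) / 3 := by
  classical
  have := hB.isBenzenoid.finite
  have : Fintype (Hexagon B) := Fintype.ofFinite _
  -- `N` is {v_2, v_4, …, v_{2k}}. Its complement has 2k - 1 of the 3k - 1 hexagons, which is the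
  -- bound rounded down.
  let N : Finset (Hexagon B) :=
    Finset.univ.image fun j : Fin k => φ (Sum.inl ⟨2 * j.val + 1, by omega⟩)
  have hmemN : ∀ x, φ x ∈ N ↔ ∃ a : Fin (2 * k + 1), x = Sum.inl a ∧ a.val % 2 = 1 := by
    intro x
    simp only [N, Finset.mem_image, Finset.mem_univ, true_and, EmbeddingLike.apply_eq_iff_eq]
    constructor
    · rintro ⟨j, rfl⟩
      exact ⟨_, rfl, by simp⟩
    · rintro ⟨a, rfl, ha⟩
      have := a.2
      refine ⟨⟨a.val / 2, by omega⟩, congrArg Sum.inl (Fin.ext ?_)⟩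
      simp only
      omega
  have hNcard : N.card = k := by
    rw [Finset.card_image_of_injective, Finset.card_univ, Fintype.card_fin]
    intro i j hij
    have := φ.injective hij
    simp only [Sum.inl.injEq, Fin.mk.injEq] at this
    exact Fin.ext (by omega)
  have hcard : numHexagons B = 2 * k + 1 + (k - 2) := by
    unfold numHexagons
    rw [← Nat.card_congr φ.toEquiv, Nat.card_eq_fintype_card, Fintype.card_sum, Fintype.card_fin,
      Fintype.card_fin]
  refine hB.clarNumber_eq_of_le (C := Nᶜ) (hB.isResonant_of_angular _ ?_ ?_) ?_
  · intro h hh h' hh' hadj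
    obtain ⟨x, rfl⟩ := φ.surjective h
    obtain ⟨y, rfl⟩ := φ.surjective h'
    rw [Finset.mem_compl, hmemN] at hh hh'
    rw [φ.map_adj_iff] at hadj
    rcases x with a | i <;> rcases y with b | j
    · rw [treeT_adj_inl_inl] at hadj
      have h1 : ¬ a.val % 2 = 1 := fun h => hh ⟨a, rfl, h⟩
      have h2 : ¬ b.val % 2 = 1 := fun h => hh' ⟨b, rfl, h⟩
      omega
    · rw [treeT_adj_inl_inr] at hadj
      exact hh ⟨a, rfl, by omega⟩
    · rw [SimpleGraph.adj_comm, treeT_adj_inl_inr] at hadj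
      exact hh' ⟨b, rfl, by omega⟩
    · exact treeT_not_adj_inr_inr i j hadj
  · intro h hh
    obtain ⟨x, rfl⟩ := φ.surjective h
    rw [Finset.mem_compl, not_not, hmemN] at hh
    obtain ⟨a, rfl, ha⟩ := hh
    constructor
    · intro t ht
      obtain ⟨y, rfl⟩ := φ.surjective t
      rw [φ.map_adj_iff] at ht
      rw [Finset.mem_compl, hmemN]
      rintro ⟨b, rfl, hb⟩
      rw [treeT_adj_inl_inl] at ht
      omega
    · by_cases h1 : a.val = 1
      · right
        rwa [show a = ⟨1, by omega⟩ from Fin.ext h1]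
      · by_cases h2 : a.val = 2 * k - 1
        · right
          rwa [show a = ⟨2 * k - 1, by omega⟩ from Fin.ext h2]
        · left
          rw [← neighborSet_treeT ha h1 h2, ← Nat.card_coe_set_eq, ← Nat.card_coe_set_eq]
          exact (Nat.card_congr (φ.mapNeighborSet _)).symm
  · have := Finset.card_add_card_compl N
    rw [← Nat.card_eq_fintype_card] at this
    change _ = numHexagons B at this
    omega

/-- The two outer hexagons of the triple cover all its vertices except the ends of the glued edge.
Together with an optimal resonant set of `B'` and its matching they give a resonant set with two
more members; the bound also rises by 2, as n rises by 3. -/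
theorem clarNumber_eq_of_gluing {U W : Type u} {B' : SimpleGraph U} {B₁ : SimpleGraph W}
    (hB' : IsCatacondensed B') (hclar : clarNumber B' = (2 * numHexagons B' + 1) / 3)
    {a b : U} (hab : B'.Adj a b) {h : Hexagon B₁} (hB₁ : IsAngularTriple B₁ h)
    {c d : W} (hcd : h.1.Adj c d) (hc : HasDegreeTwo B₁ c) (hd : HasDegreeTwo B₁ d)
    (hglue : IsEdgeGluing B' a b B₁ c d B) (hB : IsCatacondensed B) :
    clarNumber B = (2 * numHexagons B + 1) / 3 := by
  classical
  have := hB'.isBenzenoid.finite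
  have hn := hglue.numHexagons_eq hab hcd.adj_sub hB'.isBenzenoid hB₁.1.isBenzenoid hB.isBenzenoid
  have hn1 := hB₁.2.1
  have hpos := hB'.numHexagons_pos
  obtain ⟨C', hC', hcard'⟩ := exists_isResonant_card_eq (G := B') (by omega)
  obtain ⟨hCd, M', hM', halt'⟩ := hC'
  obtain ⟨l, l', hne, hall, hl, hl', hnot⟩ := hB₁.exists_leaves
  obtain ⟨f, g, hac, hbd, hun, hin, rfl⟩ := hglue
  set f' : B' →g (B'.map f ⊔ B₁.map g) :=
    ⟨f, fun {x y} hxy => Or.inl ((SimpleGraph.map_adj _ _ _ _).2 ⟨x, y, hxy, rfl, rfl⟩)⟩ with hf'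
  set g' : B₁ →g (B'.map f ⊔ B₁.map g) :=
    ⟨g, fun {x y} hxy => Or.inr ((SimpleGraph.map_adj _ _ _ _).2 ⟨x, y, hxy, rfl, rfl⟩)⟩ with hg'
  have hfi : Function.Injective f' := f.injective
  have hgi : Function.Injective g' := g.injective
  have hcu := (hB₁.1.hasDegreeTwo_iff hcd.fst_mem).1 hc
  have hdu := (hB₁.1.hasDegreeTwo_iff hcd.snd_mem).1 hd
  have hset : {w | w ∈ h.1.verts ∧ HasDegreeTwo B₁ w} = {c, d} := by
    obtain ⟨-, u, v, huv, -⟩ := hB₁.2.2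
    have h1 : c ∈ ({u, v} : Set W) := huv ▸ ⟨hcd.fst_mem, hc⟩
    have h2 : d ∈ ({u, v} : Set W) := huv ▸ ⟨hcd.snd_mem, hd⟩
    have h3 := hcd.ne
    rw [huv]
    ext t
    simp only [Set.mem_insert_iff, Set.mem_singleton_iff] at *
    grind
  have hleaf : ∀ w, w ≠ c → w ≠ d → w ∈ l.1.verts ∨ w ∈ l'.1.verts := by
    intro w hwc hwd
    by_contra! hcon
    obtain ⟨k, hk⟩ := hB₁.1.isBenzenoid.exists_hexagon_mem w
    have hu : ∀ k : Hexagon B₁, w ∈ k.1.verts → k = h := by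
      intro k hk
      rcases hall k with e | rfl | rfl
      · exact e
      · exact absurd hk hcon.1
      · exact absurd hk hcon.2
    have hkh := hu k hk
    subst hkh
    have : w ∈ ({c, d} : Set W) := by
      rw [← hset]
      exact ⟨hk, (hB₁.1.hasDegreeTwo_iff hk).2 hu⟩
    rcases this with e | e
    · exact hwc e
    · exact hwd e
  have hnotmem : ∀ t : Hexagon B₁, t = l ∨ t = l' → ∀ x ∈ (t.map g' hgi).1.verts,
      x ∉ Set.range f := by
    rintro t ht x ⟨w, hw, rfl⟩ hxf
    have hw' : g w ∈ ({f a, f b} : Set V) := hin ▸ ⟨hxf, w, rfl⟩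
    have hth : t ≠ h := by
      rcases ht with rfl | rfl
      · exact hl.1.symm
      · exact hl'.1.symm
    rw [hac, hbd] at hw'
    rcases hw' with e | e
    · rw [g.injective e] at hw
      exact hth (hcu t hw)
    · rw [g.injective e] at hw
      exact hth (hdu t hw)
  have hll : Disjoint (l.map g' hgi).1.verts (l'.map g' hgi).1.verts := by
    rw [Hexagon.verts_map, Hexagon.verts_map, Set.disjoint_image_iff hgi]
    exact (disjoint_verts_iff hB₁.1.isBenzenoid hne).2 hnot
  set D : Finset (Hexagon (B'.map f ⊔ B₁.map g)) := {l.map g' hgi, l'.map g' hgi} with hD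
  have hDd : ∀ t ∈ D, ∀ t' ∈ D, t ≠ t' → Disjoint t.1.verts t'.1.verts := by
    intro t ht t' ht' htt
    simp only [hD, Finset.mem_insert, Finset.mem_singleton] at ht ht'
    rcases ht with rfl | rfl <;> rcases ht' with rfl | rfl
    · exact absurd rfl htt
    · exact hll
    · exact hll.symm
    · exact absurd rfl htt
  have hDf : ∀ t ∈ D, ∀ x ∈ t.1.verts, x ∉ Set.range f := by
    intro t ht
    simp only [hD, Finset.mem_insert, Finset.mem_singleton] at ht
    rcases ht with rfl | rfl
    · exact hnotmem l (Or.inl rfl)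
    · exact hnotmem l' (Or.inr rfl)
  have hCf : ∀ t ∈ C'.image (Hexagon.map f' hfi), ∀ x ∈ t.1.verts, x ∈ Set.range f := by
    intro t ht x hx
    obtain ⟨t', -, rfl⟩ := Finset.mem_image.1 ht
    obtain ⟨w, -, rfl⟩ := hx
    exact ⟨w, rfl⟩
  have hCD : Disjoint (C'.image (Hexagon.map f' hfi)) D := by
    rw [Finset.disjoint_left]
    intro t ht ht'
    obtain ⟨x, hx⟩ := t.nonempty_verts
    exact hDf t ht' x hx (hCf t ht x hx)
  have hM : (M'.map f').IsMatching := hM'.1.map f' hfi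
  have hMv : (M'.map f').verts = Set.range f := by
    rw [SimpleGraph.Subgraph.map_verts, hM'.2.verts_eq_univ, Set.image_univ]
    rfl
  refine hB.clarNumber_eq_of_le (C := C'.image (Hexagon.map f' hfi) ∪ D)
    (isResonant_of_cover hM (D : Set _) hDd ?_ _ ?_ ?_) ?_
  · intro x
    rw [hMv]
    constructor
    · exact fun hx t ht hxt => hDf t ht x hxt hx
    · intro hx
      by_contra hxf
      have hxu : x ∈ Set.range f ∪ Set.range g := hun ▸ Set.mem_univ x
      obtain ⟨w, rfl⟩ := hxu.resolve_left hxf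
      rcases hleaf w (fun e => hxf ⟨a, by rw [hac, e]⟩) (fun e => hxf ⟨b, by rw [hbd, e]⟩) with
        hw | hw
      · exact hx (l.map g' hgi) (by simp [hD]) ⟨w, hw, rfl⟩
      · exact hx (l'.map g' hgi) (by simp [hD]) ⟨w, hw, rfl⟩
  · intro t ht t' ht' htt
    rw [Finset.mem_union] at ht ht'
    rcases ht with ht | ht <;> rcases ht' with ht' | ht'
    · obtain ⟨s, hs, rfl⟩ := Finset.mem_image.1 ht
      obtain ⟨s', hs', rfl⟩ := Finset.mem_image.1 ht'
      rw [Hexagon.verts_map, Hexagon.verts_map, Set.disjoint_image_iff hfi]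
      exact hCd s hs s' hs' (fun e => htt (by rw [e]))
    · exact Set.disjoint_left.2 fun x hx hx' => hDf t' ht' x hx' (hCf t ht x hx)
    · exact Set.disjoint_left.2 fun x hx hx' => hDf t ht x hx (hCf t' ht' x hx')
    · exact hDd t ht t' ht' htt
  · intro t ht
    rw [Finset.mem_union] at ht
    rcases ht with ht | ht
    · right
      obtain ⟨s, hs, rfl⟩ := Finset.mem_image.1 ht
      rintro x ⟨w, hw, rfl⟩
      obtain ⟨y, hy, hMy⟩ := (isAlternating_iff hM'.1 s).1 (halt' s hs) w hw
      exact ⟨f' y, Hexagon.map_adj f' hfi hy, ⟨w, y, hMy, rfl, rfl⟩⟩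
    · exact Or.inl ht
  · rw [Finset.card_union_of_disjoint hCD,
      Finset.card_image_of_injective _ (Hexagon.map_injective f' hfi), hD,
      Finset.card_pair (fun e => hne (Hexagon.map_injective g' hgi e))]
    omega

/-- The members of the family attain the bound. -/
theorem InFamily.clarNumber_eq (h : InFamily B) (hB : IsCatacondensed B) :
    clarNumber B = (2 * numHexagons B + 1) / 3 := by
  induction h with
  | one B _ hn => exact clarNumber_eq_of_one hB hn
  | two B _ hn => exact clarNumber_eq_of_two hB hn
  | three B h hh => exact clarNumber_eq_of_isAngularTriple hh
  | tree B _ k hk φ h1 h2 => exact clarNumber_eq_of_treeT hB hk φ h1 h2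
  | glue B' hB' _ a b hab _ _ B₁ h hB₁ c d hcd hc hd B hglue ih =>
    exact clarNumber_eq_of_gluing hB' (ih hB') hab hB₁ hcd hc hd hglue hB

end LowerBounds

/-! ### Embeddings of induced subgraphs -/

section Induced

variable {V : Type u} {G : SimpleGraph V}

instance [Finite V] : Finite G.Dart :=
  Finite.of_injective _ SimpleGraph.Dart.toProd_injective

/-- If all degrees are at most 3, at most three darts start at a vertex. -/
theorem RotationSystem.eq_or_eq_next [Finite V] (R : RotationSystem G)
    (hnext : ∀ d, R.next d ≠ d) {x : V} (hx : (G.neighborSet x).ncard ≤ 3) {d e : G.Dart}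
    (hd : d.fst = x) (he : e.fst = x) :
    e = d ∨ e = R.next d ∨ e = R.next (R.next d) := by
  have hfst : ∀ d : G.Dart, d.fst = x → (R.next d).fst = x := fun d h => (R.fst_next d).trans h
  by_cases h2 : R.next (R.next d) = d
  · obtain ⟨n, rfl⟩ := Equiv.Perm.SameCycle.exists_nat_pow_eq (R.sameCycle_of_fst_eq d e (hd.trans he.symm))
    have : ∀ n : ℕ, (R.next ^ n) d = d ∨ (R.next ^ n) d = R.next d := by
      intro n
      induction n with
      | zero => exact Or.inl rfl
      | succ n ih =>
        rw [pow_succ', Equiv.Perm.mul_apply]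
        rcases ih with ih | ih
        · rw [ih]; exact Or.inr rfl
        · rw [ih]; exact Or.inl h2
    rcases this n with h | h
    · exact Or.inl h
    · exact Or.inr (Or.inl h)
  · have hext : ∀ d e : G.Dart, d.fst = x → e.fst = x → d.snd = e.snd → d = e :=
      fun d e h1 h2 h3 => SimpleGraph.Dart.ext _ _ (Prod.ext (h1.trans h2.symm) h3)
    have hd1 := hfst d hd
    have hd2 := hfst _ hd1
    have hmem : ∀ d : G.Dart, d.fst = x → d.snd ∈ G.neighborSet x := fun d h => h ▸ d.adj
    have h3 : ({d.snd, (R.next d).snd, (R.next (R.next d)).snd} : Set V).ncard = 3 :=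
      Set.ncard_eq_three.2 ⟨_, _, _, fun h => hnext d (hext _ _ hd1 hd h.symm),
        fun h => h2 (hext _ _ hd2 hd h.symm),
        fun h => hnext (R.next d) (hext _ _ hd2 hd1 h.symm), rfl⟩
    have hset : ({d.snd, (R.next d).snd, (R.next (R.next d)).snd} : Set V) = G.neighborSet x := by
      refine Set.eq_of_subset_of_ncard_le ?_ (by rw [h3]; exact hx) (Set.toFinite _)
      rintro w (rfl | rfl | rfl)
      · exact hmem _ hd
      · exact hmem _ hd1
      · exact hmem _ hd2
    have := hmem e he
    rw [← hset] at this
    rcases this with h | h | h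
    · exact Or.inl (hext _ _ he hd h)
    · exact Or.inr (Or.inl (hext _ _ he hd1 h))
    · exact Or.inr (Or.inr (hext _ _ he hd2 h))

/-- The dart of the ambient graph given by a dart of an induced subgraph. -/
def dartVal (A : Set V) (d : (G.induce A).Dart) : G.Dart := ⟨(d.fst, d.snd), d.adj⟩

/-- A dart with both ends in `A`, as a dart of the induced subgraph. -/
def dartLift {A : Set V} (d : G.Dart) (h1 : d.fst ∈ A) (h2 : d.snd ∈ A) : (G.induce A).Dart :=
  ⟨(⟨d.fst, h1⟩, ⟨d.snd, h2⟩), d.adj⟩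

theorem dartVal_injective (A : Set V) : Function.Injective (dartVal (G := G) A) := by
  intro d e h
  have h1 : (d.fst : V) = e.fst := congrArg (fun d : G.Dart => d.fst) h
  have h2 : (d.snd : V) = e.snd := congrArg (fun d : G.Dart => d.snd) h
  exact SimpleGraph.Dart.ext _ _ (Prod.ext (Subtype.ext h1) (Subtype.ext h2))

theorem dartVal_dartLift {A : Set V} (d : G.Dart) (h1 : d.fst ∈ A) (h2 : d.snd ∈ A) :
    dartVal A (dartLift d h1 h2) = d := rfl

theorem dartVal_symm {A : Set V} (d : (G.induce A).Dart) :
    dartVal A d.symm = (dartVal A d).symm := rfl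

/-- The rotation system of an induced 2-connected subgraph of a graph with degrees at most 3. -/
theorem RotationSystem.exists_induce [Finite V] (R : RotationSystem G)
    (hnext : ∀ d, R.next d ≠ d) (hdeg : ∀ x, (G.neighborSet x).ncard ≤ 3) {A : Set V}
    (hA : IsTwoConnected (G.induce A)) :
    ∃ R' : RotationSystem (G.induce A), ∀ d, (R.next (dartVal A d)).snd ∈ A →
      dartVal A (R'.next d) = R.next (dartVal A d) := by
  have hfst : ∀ d : (G.induce A).Dart, (R.next (dartVal A d)).fst ∈ A := fun d => by
    rw [R.fst_next]
    exact d.fst.2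
  have hfst2 : ∀ d : (G.induce A).Dart, (R.next (R.next (dartVal A d))).fst ∈ A := fun d => by
    rw [R.fst_next]
    exact hfst d
  have hsnd2 : ∀ d : (G.induce A).Dart, (R.next (dartVal A d)).snd ∉ A →
      (R.next (R.next (dartVal A d))).snd ∈ A := by
    intro d hd
    obtain ⟨y, hy, hadj⟩ := hA.exists_adj_ne d.fst_ne_snd
    set e : (G.induce A).Dart := ⟨(d.fst, y), hadj⟩
    rcases R.eq_or_eq_next hnext (hdeg d.fst) (d := dartVal A d) (e := dartVal A e) rfl rfl with
      h | h | h
    · exact absurd (congrArg (fun d : (G.induce A).Dart => d.snd) (dartVal_injective A h)) hy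
    · exact absurd (h ▸ e.snd.2) hd
    · rw [← h]
      exact e.snd.2
  classical
  -- Darts that leave `A` are skipped. Each vertex loses at most one dart, its degree being at most
  -- 3 before and at least 2 after, so one skip is enough.
  let N : (G.induce A).Dart → (G.induce A).Dart := fun d =>
    if h : (R.next (dartVal A d)).snd ∈ A then dartLift _ (hfst d) h
    else dartLift _ (hfst2 d) (hsnd2 d h)
  have hN1 : ∀ d, (R.next (dartVal A d)).snd ∈ A → dartVal A (N d) = R.next (dartVal A d) := by
    intro d h
    simp only [N, h, dif_pos, dartVal_dartLift]
  have hN2 : ∀ d, (R.next (dartVal A d)).snd ∉ A →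
      dartVal A (N d) = R.next (R.next (dartVal A d)) := by
    intro d h
    simp only [N, h, dif_neg, not_false_iff, dartVal_dartLift]
  have hmix : ∀ d d', (R.next (dartVal A d)).snd ∉ A →
      R.next (dartVal A d') ≠ R.next (R.next (dartVal A d)) := by
    intro d d' h heq
    have := R.next.injective heq
    rw [← this] at h
    exact h d'.snd.2
  have hinj : Function.Injective N := by
    intro d d' heq
    have hv := congrArg (dartVal A) heq
    apply dartVal_injective A
    by_cases h : (R.next (dartVal A d)).snd ∈ A <;> by_cases h' : (R.next (dartVal A d')).snd ∈ A
    · rw [hN1 d h, hN1 d' h'] at hv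
      exact R.next.injective hv
    · rw [hN1 d h, hN2 d' h'] at hv
      exact absurd hv (hmix d' d h')
    · rw [hN2 d h, hN1 d' h'] at hv
      exact absurd hv.symm (hmix d d' h)
    · rw [hN2 d h, hN2 d' h'] at hv
      exact R.next.injective (R.next.injective hv)
  let σ : Equiv.Perm (G.induce A).Dart :=
    Equiv.ofBijective N (Finite.injective_iff_bijective.1 hinj)
  have hσ : ∀ d, σ d = N d := fun _ => rfl
  refine ⟨⟨σ, ?_, ?_⟩, fun d h => hN1 d h⟩
  · intro d
    apply Subtype.ext
    change (dartVal A (N d)).fst = (dartVal A d).fst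
    by_cases h : (R.next (dartVal A d)).snd ∈ A
    · rw [hN1 d h, R.fst_next]
    · rw [hN2 d h, R.fst_next, R.fst_next]
  · intro d e hde
    have hfe : (dartVal A e).fst = (dartVal A d).fst := congrArg Subtype.val hde.symm
    rcases R.eq_or_eq_next hnext (hdeg d.fst) (d := dartVal A d) (e := dartVal A e) rfl hfe with
      h | h | h
    · rw [dartVal_injective A h]
    · have : σ d = e := dartVal_injective A (by rw [hσ, hN1 d (h ▸ e.snd.2), h])
      exact ⟨1, by rwa [zpow_one]⟩
    · by_cases hmem : (R.next (dartVal A d)).snd ∈ A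
      · have h1 : dartVal A (N d) = R.next (dartVal A d) := hN1 d hmem
        have h2 : (R.next (dartVal A (N d))).snd ∈ A := by
          rw [h1, ← h]
          exact e.snd.2
        have : σ (σ d) = e := dartVal_injective A (by rw [hσ, hσ, hN1 _ h2, h1, h])
        exact ⟨2, by rw [zpow_two, Equiv.Perm.mul_apply, this]⟩
      · have : σ d = e := dartVal_injective A (by rw [hσ, hN2 d hmem, h])
        exact ⟨1, by rwa [zpow_one]⟩

/-- The image in `G` of a hexagon of an induced subgraph. -/
def Hexagon.val {A : Set V} (h : Hexagon (G.induce A)) : Hexagon G :=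
  h.map (SimpleGraph.Embedding.induce A).toHom Subtype.val_injective

theorem Hexagon.val_injective (A : Set V) : Function.Injective (Hexagon.val (G := G) (A := A)) :=
  Hexagon.map_injective _ Subtype.val_injective

theorem Hexagon.mem_verts_val {A : Set V} {h : Hexagon (G.induce A)} {x : V} :
    x ∈ h.val.1.verts ↔ ∃ hx : x ∈ A, (⟨x, hx⟩ : A) ∈ h.1.verts := by
  constructor
  · rintro ⟨y, hy, rfl⟩
    exact ⟨y.2, hy⟩
  · rintro ⟨hx, h⟩
    exact ⟨_, h, rfl⟩

theorem Hexagon.val_adj {A : Set V} {h : Hexagon (G.induce A)} {x y : A} :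
    h.val.1.Adj x y ↔ h.1.Adj x y :=
  ⟨Hexagon.adj_of_map_adj (SimpleGraph.Embedding.induce A).toHom Subtype.val_injective,
    Hexagon.map_adj (SimpleGraph.Embedding.induce A).toHom Subtype.val_injective⟩

theorem Hexagon.val_verts_subset {A : Set V} (h : Hexagon (G.induce A)) : h.val.1.verts ⊆ A := by
  intro x hx
  exact (Hexagon.mem_verts_val.1 hx).1

/-- A hexagon with all vertices in `A` is a hexagon of the induced subgraph. -/
theorem Hexagon.exists_val_eq {A : Set V} (h : Hexagon G) (hA : h.1.verts ⊆ A) :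
    ∃ h' : Hexagon (G.induce A), h'.val = h := by
  obtain ⟨p, hp, hv, ha⟩ := exists_labelling h.2
  have hpA : ∀ i, p i ∈ A := fun i => hA (hv ▸ ⟨i, rfl⟩)
  let H : (G.induce A).Subgraph :=
    { verts := Subtype.val ⁻¹' h.1.verts
      Adj := fun x y => h.1.Adj x y
      adj_sub := fun hxy => h.1.adj_sub hxy
      edge_vert := fun hxy => h.1.edge_vert hxy
      symm := ⟨fun _ _ hxy => hxy.symm⟩ }
  have hH : Nonempty (H.coe ≃g SimpleGraph.cycleGraph 6) := by
    refine nonempty_iso_cycleGraph_six (fun i => ⟨p i, hpA i⟩) ?_ ?_ ?_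
    · intro i j hij
      exact hp (congrArg Subtype.val hij)
    · ext x
      change (x : V) ∈ h.1.verts ↔ _
      rw [hv]
      simp [Subtype.ext_iff]
    · intro i j
      exact ha i j
  refine ⟨⟨H, hH⟩, Hexagon.ext (SimpleGraph.Subgraph.ext ?_ ?_)⟩
  · ext x
    exact Hexagon.mem_verts_val.trans ⟨fun ⟨_, hx⟩ => hx, fun hx => ⟨hA hx, hx⟩⟩
  · ext x y
    constructor
    · rintro ⟨x', y', hxy, rfl, rfl⟩
      exact hxy
    · intro hxy
      exact ⟨⟨x, hA hxy.fst_mem⟩, ⟨y, hA hxy.snd_mem⟩, hxy, rfl, rfl⟩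

/-- At each of its vertices, a hexagon has an edge that belongs to no other hexagon. -/
theorem IsCatacondensed.exists_unshared_adj (hB : IsCatacondensed G) {h : Hexagon G} {x : V}
    (hx : x ∈ h.1.verts) : ∃ w, h.1.Adj x w ∧ ∀ k : Hexagon G, k.1.Adj x w → k = h := by
  obtain ⟨y, z, hyz, hnb⟩ := h.exists_neighbors hx
  have hy := (hnb y).2 (Or.inl rfl)
  have hz := (hnb z).2 (Or.inr rfl)
  by_contra! hcon
  obtain ⟨k, hk, hkne⟩ := hcon y hy
  obtain ⟨k', hk', hkne'⟩ := hcon z hz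
  rcases hB.eq_or_eq hkne hk.fst_mem hx hk'.fst_mem with rfl | rfl
  · have huniq := (hB.isBenzenoid.disjoint_or_common_edge _ _ hkne).resolve_left
      (Set.not_disjoint_iff.2 ⟨x, hk.fst_mem, hx⟩)
    have : s(x, y) = s(x, z) := huniq.unique ⟨hk, hy⟩ ⟨hk', hz⟩
    exact hyz (Sym2.congr_right.1 this)
  · exact hkne' rfl

/-- A 2-connected induced subgraph has at most as many hexagons as its cycle space has dimensions;
if it has that many, it is a catacondensed benzenoid graph. -/
theorem IsCatacondensed.induce (hB : IsCatacondensed G) {A : Set V}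
    (hA : IsTwoConnected (G.induce A)) :
    numHexagons (G.induce A) + Nat.card A ≤ Nat.card (G.induce A).edgeSet + 1 ∧
    (Nat.card (G.induce A).edgeSet + 1 ≤ numHexagons (G.induce A) + Nat.card A →
      IsCatacondensed (G.induce A)) := by
  have hBb := hB.isBenzenoid
  have hfin := hBb.finite
  obtain ⟨R, outer, F, -, -, hFr, hFb, hFs⟩ := hBb.exists_faces
  obtain ⟨R', hR'⟩ := R.exists_induce (R.next_ne hBb.twoConnected) hB.ncard_neighborSet_le hA
  -- Tracing a face bounded by a hexagon inside `A` never meets a deleted dart, so the face survives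
  -- unchanged.
  have hstep : ∀ (h : Hexagon (G.induce A)) (d : (G.induce A).Dart),
      R.faceOf (dartVal A d) = F h.val →
      dartVal A (R'.facePerm d) = R.facePerm (dartVal A d) := by
    intro h d hd
    have h1 : R.faceOf (R.facePerm (dartVal A d)) = F h.val := (R.faceOf_facePerm _).trans hd
    have h2 := (R.mem_edgeSet_boundary _ _).2 (Or.inl h1)
    rw [hFb] at h2
    have h3 : h.val.1.Adj (R.facePerm (dartVal A d)).fst (R.facePerm (dartVal A d)).snd := h2
    rw [R'.facePerm_apply, R.facePerm_apply, ← dartVal_symm]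
    exact hR' d.symm (h.val_verts_subset h3.snd_mem)
  have hpow : ∀ (h : Hexagon (G.induce A)) (d : (G.induce A).Dart),
      R.faceOf (dartVal A d) = F h.val → ∀ n : ℕ,
      dartVal A ((R'.facePerm ^ n) d) = (R.facePerm ^ n) (dartVal A d) ∧
      R.faceOf (dartVal A ((R'.facePerm ^ n) d)) = F h.val := by
    intro h d hd n
    induction n with
    | zero => exact ⟨rfl, hd⟩
    | succ n ih =>
      have h1 := hstep h _ ih.2
      rw [pow_succ', Equiv.Perm.mul_apply, pow_succ', Equiv.Perm.mul_apply, h1, ih.1]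
      refine ⟨rfl, ?_⟩
      rw [R.faceOf_facePerm, ← ih.1, ih.2]
  have hex : ∀ h : Hexagon (G.induce A), ∃ f : R'.Face, ∀ d,
      R'.faceOf d = f ↔ R.faceOf (dartVal A d) = F h.val := by
    intro h
    obtain ⟨x, hx⟩ := h.nonempty_verts
    obtain ⟨y, hy⟩ := h.exists_adj hx
    have hd₀ : ∃ d₀ : (G.induce A).Dart, R.faceOf (dartVal A d₀) = F h.val := by
      set d₁ : (G.induce A).Dart := ⟨(x, y), hy.adj_sub⟩
      have h1 : (dartVal A d₁).edge ∈ (R.boundary (F h.val)).edgeSet := by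
        rw [hFb]
        exact Hexagon.val_adj.2 hy
      rcases (R.mem_edgeSet_boundary _ _).1 h1 with h2 | h2
      · exact ⟨d₁, h2⟩
      · exact ⟨d₁.symm, h2⟩
    obtain ⟨d₀, hd₀⟩ := hd₀
    refine ⟨R'.faceOf d₀, fun d => ⟨fun h1 => ?_, fun h1 => ?_⟩⟩
    · obtain ⟨n, rfl⟩ := Equiv.Perm.SameCycle.exists_nat_pow_eq
        (Quotient.exact (s := Equiv.Perm.SameCycle.setoid R'.facePerm) h1.symm)
      exact (hpow h d₀ hd₀ n).2
    · obtain ⟨n, hn⟩ := Equiv.Perm.SameCycle.exists_nat_pow_eq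
        (Quotient.exact (s := Equiv.Perm.SameCycle.setoid R.facePerm) (hd₀.trans h1.symm))
      rw [← (hpow h d₀ hd₀ n).1] at hn
      rw [← dartVal_injective A hn]
      exact Quotient.sound (s := Equiv.Perm.SameCycle.setoid R'.facePerm)
        (Equiv.Perm.sameCycle_pow_left.2 (Equiv.Perm.SameCycle.refl _ _))
  choose F' hF' using hex
  have hadj' : ∀ h x y, (R'.boundary (F' h)).Adj x y ↔ h.1.Adj x y := by
    intro h x y
    rw [← Hexagon.val_adj, ← hFb]
    constructor
    · rintro ⟨d, hd, he⟩
      refine ⟨dartVal A d, (hF' h d).1 hd, ?_⟩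
      rcases SimpleGraph.dart_edge_eq_mk'_iff'.1 he with ⟨h1, h2⟩ | ⟨h1, h2⟩
      · rw [← h1, ← h2]
        rfl
      · rw [← h1, ← h2]
        exact Sym2.eq_swap
    · rintro ⟨d, hd, he⟩
      rcases SimpleGraph.dart_edge_eq_mk'_iff'.1 he with ⟨h1, h2⟩ | ⟨h1, h2⟩
      · refine ⟨dartLift d (h1 ▸ x.2) (h2 ▸ y.2), (hF' h _).2 hd, ?_⟩
        exact SimpleGraph.dart_edge_eq_mk'_iff'.2 (Or.inl ⟨Subtype.ext h1, Subtype.ext h2⟩)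
      · refine ⟨dartLift d (h1 ▸ y.2) (h2 ▸ x.2), (hF' h _).2 hd, ?_⟩
        exact SimpleGraph.dart_edge_eq_mk'_iff'.2 (Or.inr ⟨Subtype.ext h1, Subtype.ext h2⟩)
  have hbound : ∀ h, R'.boundary (F' h) = h.1 := by
    intro h
    refine SimpleGraph.Subgraph.ext ?_ ?_
    · ext x
      constructor
      · rintro ⟨d, hd, hx⟩
        obtain ⟨y, hy⟩ := hx
        exact ((hadj' h x y).1 ⟨d, hd, hy⟩).fst_mem
      · intro hx
        obtain ⟨y, hy⟩ := h.exists_adj hx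
        exact ((hadj' h x y).2 hy).fst_mem
    · ext x y
      exact hadj' h x y
  have hF'inj : Function.Injective F' := by
    intro h h' heq
    apply Hexagon.ext
    rw [← hbound, ← hbound, heq]
  -- If all faces came from hexagons, an edge that lies in a single hexagon would have the same face
  -- on both sides.
  have houter : ∃ f : R'.Face, ∀ h, F' h ≠ f := by
    by_contra! hcon
    obtain ⟨x⟩ := hA.2.1.nonempty
    obtain ⟨y, hxy⟩ := hA.exists_adj x
    obtain ⟨h, hh⟩ := hcon (R'.faceOf ⟨(x, y), hxy⟩)
    have hx : x ∈ h.1.verts := ((hadj' h x y).1 ⟨_, hh.symm, rfl⟩).fst_mem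
    obtain ⟨w, hw, huniq⟩ := hB.exists_unshared_adj
      (Hexagon.mem_verts_val.2 ⟨x.2, hx⟩ : (x : V) ∈ h.val.1.verts)
    set d : (G.induce A).Dart := ⟨(x, ⟨w, h.val_verts_subset hw.snd_mem⟩), hw.adj_sub⟩
    have hface : ∀ e : (G.induce A).Dart, e.edge = d.edge →
        R.faceOf (dartVal A e) = F h.val := by
      intro e he
      obtain ⟨k, hk⟩ := hcon (R'.faceOf e)
      have hk1 := (hF' k e).1 hk.symm
      have hk2 : k.1.Adj d.fst d.snd := (hadj' k _ _).1 ⟨e, hk.symm, he⟩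
      rw [← huniq k.val (Hexagon.val_adj.2 hk2)]
      exact hk1
    exact hFs h.val (dartVal A d) (hface d rfl) (hface d.symm d.edge_symm)
  obtain ⟨outer', hout'⟩ := houter
  have hinj : Function.Injective (fun o : Option (Hexagon (G.induce A)) => o.elim outer' F') := by
    rintro (_ | h) (_ | h') heq
    · rfl
    · exact absurd heq.symm (hout' h')
    · exact absurd heq (hout' h)
    · exact congrArg some (hF'inj heq)
  have hle1 : numHexagons (G.induce A) + 1 ≤ Nat.card R'.Face := by
    have := Nat.card_le_card_of_injective _ hinj
    rwa [Finite.card_option] at this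
  have hle2 := R'.card_face_add_card_le hA.2.1
  -- The chain is H + 1 ≤ F ≤ E - V + 2. When its ends agree, the embedding is spherical and has one
  -- face besides those of the hexagons.
  refine ⟨by omega, fun hge => ?_⟩
  have hface : Nat.card R'.Face = numHexagons (G.induce A) + 1 := by omega
  have hsurj : ∀ f, f ≠ outer' → ∃ h, F' h = f := by
    have hbij := (Nat.bijective_iff_injective_and_card _).2 ⟨hinj, by
      rw [Finite.card_option, hface]
      rfl⟩
    intro f hf
    obtain ⟨o, ho⟩ := hbij.2 f
    rcases o with _ | h
    · exact absurd ho.symm hf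
    · exact ⟨h, ho⟩
  have hvalne : ∀ {h h' : Hexagon (G.induce A)}, h ≠ h' → h.val ≠ h'.val :=
    fun hne => (Hexagon.val_injective A).ne hne
  refine ⟨⟨inferInstance, hA, ⟨R', outer', ?_, ?_, ?_⟩, ?_, ?_⟩, ?_⟩
  · unfold RotationSystem.IsSpherical
    omega
  · intro f hf
    obtain ⟨h, rfl⟩ := hsurj f hf
    rw [hbound]
    exact h.2
  · intro h
    exact ⟨F' h, hout' h, hbound h⟩
  · intro h h' hne
    by_cases hd : Disjoint h.1.verts h'.1.verts
    · exact Or.inl hd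
    · right
      obtain ⟨x, hx, hx'⟩ := Set.not_disjoint_iff.1 hd
      obtain ⟨y, hy, hy', -, hE⟩ := hB.exists_inter_eq (hvalne hne)
        (Hexagon.mem_verts_val.2 ⟨x.2, hx⟩ : (x : V) ∈ h.val.1.verts)
        (Hexagon.mem_verts_val.2 ⟨x.2, hx'⟩ : (x : V) ∈ h'.val.1.verts)
      have hyA := h.val_verts_subset hy.snd_mem
      refine ⟨s(x, ⟨y, hyA⟩), ⟨Hexagon.val_adj.1 hy, Hexagon.val_adj.1 hy'⟩, ?_⟩
      rintro e ⟨he, he'⟩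
      induction e with | _ u v => ?_
      have : s((u : V), (v : V)) ∈ h.val.1.edgeSet ∩ h'.val.1.edgeSet :=
        ⟨Hexagon.val_adj.2 he, Hexagon.val_adj.2 he'⟩
      rw [hE, Set.mem_singleton_iff] at this
      apply Sym2.map.injective Subtype.val_injective
      exact this
  · rintro ⟨h₁, h₂, h₃, e, h12, h13, h23, he1, he2, he3⟩
    induction e with | _ u v => ?_
    exact hBb.no_three_common_edge ⟨h₁.val, h₂.val, h₃.val, s((u : V), (v : V)), hvalne h12,
      hvalne h13, hvalne h23, Hexagon.val_adj.2 he1, Hexagon.val_adj.2 he2, Hexagon.val_adj.2 he3⟩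
  · rintro v ⟨h₁, h₂, h₃, h12, h13, h23, hv1, hv2, hv3⟩
    exact hB.no_internal v ⟨h₁.val, h₂.val, h₃.val, hvalne h12, hvalne h13, hvalne h23,
      Hexagon.mem_verts_val.2 ⟨v.2, hv1⟩, Hexagon.mem_verts_val.2 ⟨v.2, hv2⟩,
      Hexagon.mem_verts_val.2 ⟨v.2, hv3⟩⟩

end Induced

/-! ### Splitting along an edge -/

section Split

variable {V : Type u} {G : SimpleGraph V}

/-- The image of a connected graph under a map that contracts or preserves edges is connected. -/
theorem connected_of_retraction {W : Type*} {H : SimpleGraph W} (hG : G.Connected) (ρ : V → W)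
    (hsurj : Function.Surjective ρ)
    (hadj : ∀ x y, G.Adj x y → ρ x = ρ y ∨ H.Adj (ρ x) (ρ y)) : H.Connected := by
  have key : ∀ x y, G.Reachable x y → H.Reachable (ρ x) (ρ y) := by
    rintro x y ⟨w⟩
    induction w with
    | nil => exact SimpleGraph.Reachable.refl _
    | cons h _ ih =>
      rcases hadj _ _ h with h1 | h1
      · rw [h1]
        exact ih
      · exact h1.reachable.trans ih
  have : Nonempty W := hG.nonempty.map ρ
  refine ⟨fun u v => ?_⟩
  obtain ⟨x, rfl⟩ := hsurj u
  obtain ⟨y, rfl⟩ := hsurj v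
  exact key x y (hG.preconnected x y)

/-- A 2-connected graph that splits along an edge has 2-connected sides. -/
theorem IsTwoConnected.induce_of_split (hG : IsTwoConnected G) {A A' : Set V} {a b : V}
    (hab : G.Adj a b) (hinter : A ∩ A' = {a, b})
    (hedge : ∀ x y, G.Adj x y → (x ∈ A ∧ y ∈ A) ∨ (x ∈ A' ∧ y ∈ A')) (hcard : 3 ≤ Nat.card A) :
    IsTwoConnected (G.induce A) := by
  classical
  have haA : a ∈ A := (hinter.symm ▸ Or.inl rfl : a ∈ A ∩ A').1
  have hbA : b ∈ A := (hinter.symm ▸ Or.inr rfl : b ∈ A ∩ A').1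
  have hpair : ∀ x y : A, (x : V) = a ∨ (x : V) = b → (y : V) = a ∨ (y : V) = b →
      x = y ∨ (G.induce A).Adj x y := by
    rintro ⟨x, hx⟩ ⟨y, hy⟩ (h1 | h1) (h2 | h2)
    · exact Or.inl (Subtype.ext (h1.trans h2.symm))
    · right
      change G.Adj x y
      simp only at h1 h2
      rwa [h1, h2]
    · right
      change G.Adj x y
      simp only at h1 h2
      rw [h1, h2]
      exact hab.symm
    · exact Or.inl (Subtype.ext (h1.trans h2.symm))
  -- For `t` in {a, b}, the map `ρ t` fixes `A` and collapses `A'` onto the edge `ab`, so it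
  -- preserves or contracts edges. After deletion of a vertex `v`, the end `t` is chosen different
  -- from `v`.
  let ρ : A → V → A := fun t x => if h : x ∈ A then ⟨x, h⟩ else t
  have hρA : ∀ t x (h : x ∈ A), ρ t x = ⟨x, h⟩ := fun t x h => dif_pos h
  have hρA' : ∀ (t : A) x, ((t : V) = a ∨ (t : V) = b) → x ∈ A' →
      ((ρ t x : V) = a ∨ (ρ t x : V) = b) := by
    intro t x ht hx
    by_cases h : x ∈ A
    · rw [hρA t x h]
      have : x ∈ ({a, b} : Set V) := hinter ▸ ⟨h, hx⟩
      exact this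
    · simp only [ρ, h, dif_neg, not_false_iff]
      exact ht
  have hstep : ∀ (t : A), ((t : V) = a ∨ (t : V) = b) → ∀ x y, G.Adj x y →
      ρ t x = ρ t y ∨ (G.induce A).Adj (ρ t x) (ρ t y) := by
    intro t ht x y hxy
    rcases hedge x y hxy with ⟨hx, hy⟩ | ⟨hx, hy⟩
    · right
      rw [hρA t x hx, hρA t y hy]
      exact hxy
    · exact hpair _ _ (hρA' t x ht hx) (hρA' t y ht hy)
  refine ⟨hcard, ?_, ?_⟩
  · refine connected_of_retraction hG.2.1 (ρ ⟨a, haA⟩) (fun x => ⟨x, hρA _ _ x.2⟩) ?_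
    exact hstep _ (Or.inl rfl)
  · intro v
    obtain ⟨t, ht, htv⟩ : ∃ t : A, ((t : V) = a ∨ (t : V) = b) ∧ t ≠ v := by
      by_cases hv : (⟨a, haA⟩ : A) = v
      · refine ⟨⟨b, hbA⟩, Or.inr rfl, ?_⟩
        rw [← hv]
        intro h
        exact hab.ne (congrArg Subtype.val h).symm
      · exact ⟨⟨a, haA⟩, Or.inl rfl, hv⟩
    have hne : ∀ x : ({(v : V)}ᶜ : Set V), ρ t x ∈ ({v}ᶜ : Set A) := by
      rintro ⟨x, hx⟩ h
      rw [Set.mem_singleton_iff] at h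
      by_cases hxA : x ∈ A
      · rw [hρA t x hxA] at h
        exact hx (congrArg Subtype.val h)
      · simp only [ρ, hxA, dif_neg, not_false_iff] at h
        exact htv h
    refine connected_of_retraction (hG.2.2 v) (fun x => ⟨ρ t x, hne x⟩) ?_ ?_
    · rintro ⟨x, hx⟩
      refine ⟨⟨x, fun h => hx (Subtype.ext h)⟩, Subtype.ext ?_⟩
      exact hρA t x x.2
    · intro x y hxy
      rcases hstep t ht x y hxy with h | h
      · exact Or.inl (Subtype.ext h)
      · exact Or.inr h

theorem isEdgeGluing_of_split {A A' : Set V} {a b : V} (haA : a ∈ A) (hbA : b ∈ A) (haA' : a ∈ A')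
    (hbA' : b ∈ A') (hunion : A ∪ A' = Set.univ) (hinter : A ∩ A' = {a, b})
    (hedge : ∀ x y, G.Adj x y → (x ∈ A ∧ y ∈ A) ∨ (x ∈ A' ∧ y ∈ A')) :
    IsEdgeGluing (G.induce A) ⟨a, haA⟩ ⟨b, hbA⟩ (G.induce A') ⟨a, haA'⟩ ⟨b, hbA'⟩ G := by
  refine ⟨Function.Embedding.subtype _, Function.Embedding.subtype _, rfl, rfl, ?_, ?_, ?_⟩
  · simpa using hunion
  · simpa using hinter
  · ext x y
    rw [SimpleGraph.sup_adj, SimpleGraph.map_adj, SimpleGraph.map_adj]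
    constructor
    · intro hxy
      rcases hedge x y hxy with ⟨hx, hy⟩ | ⟨hx, hy⟩
      · exact Or.inl ⟨⟨x, hx⟩, ⟨y, hy⟩, hxy, rfl, rfl⟩
      · exact Or.inr ⟨⟨x, hx⟩, ⟨y, hy⟩, hxy, rfl, rfl⟩
    · rintro (⟨x', y', hxy, rfl, rfl⟩ | ⟨x', y', hxy, rfl, rfl⟩)
      · exact hxy
      · exact hxy

theorem Hexagon.three_le_card {A : Set V} [Finite V] (h : Hexagon G) (hA : h.1.verts ⊆ A) :
    3 ≤ Nat.card A := by
  have h1 := Set.ncard_le_ncard hA (Set.toFinite _)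
  rw [h.ncard_verts] at h1
  rw [Nat.card_coe_set_eq]
  omega

/-- The sides of a catacondensed benzenoid graph that splits along an edge are catacondensed
benzenoid graphs. -/
theorem IsCatacondensed.split (hB : IsCatacondensed G) {A A' : Set V} {a b : V}
    (hab : G.Adj a b) (hunion : A ∪ A' = Set.univ) (hinter : A ∩ A' = {a, b})
    (hedge : ∀ x y, G.Adj x y → (x ∈ A ∧ y ∈ A) ∨ (x ∈ A' ∧ y ∈ A'))
    (hhex : ∀ h : Hexagon G, h.1.verts ⊆ A ∨ h.1.verts ⊆ A')
    (hcard : 3 ≤ Nat.card A) (hcard' : 3 ≤ Nat.card A') :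
    IsCatacondensed (G.induce A) ∧ IsCatacondensed (G.induce A') := by
  have hBb := hB.isBenzenoid
  have := hBb.finite
  have haA : a ∈ A ∩ A' := hinter.symm ▸ Or.inl rfl
  have hbA : b ∈ A ∩ A' := hinter.symm ▸ Or.inr rfl
  have hA := hBb.twoConnected.induce_of_split hab hinter hedge hcard
  have hA' := hBb.twoConnected.induce_of_split hab ((Set.inter_comm _ _).trans hinter)
    (fun x y hxy => (hedge x y hxy).symm) hcard'
  have hglue := isEdgeGluing_of_split haA.1 hbA.1 haA.2 hbA.2 hunion hinter hedge
  have h1 := hglue.card_vert (fun h => hab.ne (congrArg Subtype.val h))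
  have h2 := hglue.card_edgeSet hab hab
  have h3 := hBb.card_edgeSet_add_one
  obtain ⟨h4, h4'⟩ := hB.induce hA
  obtain ⟨h5, h5'⟩ := hB.induce hA'
  have h6 : numHexagons G ≤ numHexagons (G.induce A) + numHexagons (G.induce A') := by
    have hsurj : Function.Surjective
        (Sum.elim Hexagon.val Hexagon.val : Hexagon (G.induce A) ⊕ Hexagon (G.induce A') →
          Hexagon G) := by
      intro h
      rcases hhex h with hh | hh
      · obtain ⟨h', rfl⟩ := h.exists_val_eq hh
        exact ⟨Sum.inl h', rfl⟩
      · obtain ⟨h', rfl⟩ := h.exists_val_eq hh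
        exact ⟨Sum.inr h', rfl⟩
    have := Nat.card_le_card_of_surjective _ hsurj
    rwa [Nat.card_sum] at this
  -- The bounds E - V + 1 of the two sides add up to the number of hexagons of `G`, each of which
  -- lies in one of the sides. Hence both bounds are attained.
  exact ⟨h4' (by omega), h5' (by omega)⟩

/-- If all edges leaving an even set `P` end in `a` or `b`, a perfect matching that joins `a` to
`P` joins `b` to `P`. -/
theorem exists_adj_of_even [Finite V] {M : G.Subgraph} (hM : M.IsPerfectMatching) {P : Set V}
    (hP : Even P.ncard) {a b : V} (ha : a ∉ P)
    (hnb : ∀ w ∈ P, ∀ z, G.Adj w z → z ∈ P ∨ z = a ∨ z = b) (hex : ∃ w ∈ P, M.Adj a w) :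
    ∃ w ∈ P, M.Adj b w := by
  classical
  have : Fintype V := Fintype.ofFinite V
  obtain ⟨w₀, hw₀, haw⟩ := hex
  by_contra! hcon
  -- If `b` were not matched into `P`, the matching would pair off the odd set `P \ {w₀}` within
  -- itself.
  set Q : Set V := P \ {w₀} with hQ
  have hmatch : (M.induce Q).IsMatching := by
    intro v hv
    obtain ⟨w, hw, huniq⟩ := SimpleGraph.Subgraph.isPerfectMatching_iff.1 hM v
    have hvQ : v ∈ Q := hv
    refine ⟨w, ⟨hvQ, ?_, hw⟩, fun y hy => huniq y hy.2.2⟩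
    have hwP : w ∈ P := by
      rcases hnb v hvQ.1 w hw.adj_sub with h | rfl | rfl
      · exact h
      · exact absurd (hM.1.eq_of_adj_left hw.symm haw) hvQ.2
      · exact absurd hw.symm (hcon v hvQ.1)
    refine ⟨hwP, ?_⟩
    rintro rfl
    have := hM.1.eq_of_adj_left hw.symm haw.symm
    exact ha (this ▸ hvQ.1)
  have heven := hmatch.even_card
  rw [← Set.ncard_eq_toFinset_card'] at heven
  change Even Q.ncard at heven
  have hc := Set.ncard_sdiff_singleton_add_one hw₀ (Set.toFinite _)
  rw [← hQ] at hc
  rw [← hc, Nat.even_add_one] at hP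
  exact hP heven

/-- A resonant set restricts to a side of a split along an edge. -/
theorem IsResonant.restrict [Finite V] {C : Finset (Hexagon G)} (hC : IsResonant C)
    {A P : Set V} {a b : V} (hab : G.Adj a b) (haA : a ∈ A) (hbA : b ∈ A) (hAP : P = Aᶜ)
    (hP : Even P.ncard) (hnb : ∀ w ∈ P, ∀ z, G.Adj w z → z ∈ P ∨ z = a ∨ z = b)
    (C' : Finset (Hexagon (G.induce A))) (hC' : ∀ h ∈ C', h.val ∈ C) : IsResonant C' := by
  obtain ⟨hdisj, M, hM, halt⟩ := hC
  have haP : a ∉ P := by rw [hAP]; exact fun h => h haA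
  have hbP : b ∉ P := by rw [hAP]; exact fun h => h hbA
  have hswap : (∃ w ∈ P, M.Adj a w) ↔ ∃ w ∈ P, M.Adj b w :=
    ⟨exists_adj_of_even hM hP haP hnb,
      exists_adj_of_even hM hP hbP fun w hw z hz => (hnb w hw z hz).imp_right Or.symm⟩
  -- Inside `A` the matching is kept; if `a` is matched into `P`, then by parity so is `b`, and the
  -- edge `ab` replaces these two matching edges.
  let M' : (G.induce A).Subgraph :=
    { verts := Set.univ
      Adj := fun u v => M.Adj u v ∨ (s((u : V), (v : V)) = s(a, b) ∧ ∃ w ∈ P, M.Adj a w)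
      adj_sub := by
        rintro u v (h | ⟨h, -⟩)
        · exact h.adj_sub
        · change G.Adj u v
          rw [← SimpleGraph.mem_edgeSet, h]
          exact hab
      edge_vert := fun _ => Set.mem_univ _
      symm := ⟨by
        rintro u v (h | ⟨h, h'⟩)
        · exact Or.inl h.symm
        · exact Or.inr ⟨Sym2.eq_swap.trans h, h'⟩⟩ }
  have hperf : M'.IsPerfectMatching := by
    rw [SimpleGraph.Subgraph.isPerfectMatching_iff]
    intro v
    obtain ⟨w, hw, huniq⟩ := SimpleGraph.Subgraph.isPerfectMatching_iff.1 hM v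
    by_cases hwA : w ∈ A
    · have hwP : w ∉ P := by rw [hAP]; exact fun h => h hwA
      refine ⟨⟨w, hwA⟩, Or.inl hw, ?_⟩
      rintro z (hz | ⟨hz, hex⟩)
      · exact Subtype.ext (huniq z hz)
      · exfalso
        rcases Sym2.eq_iff.1 hz with ⟨h1, -⟩ | ⟨h1, -⟩
        · obtain ⟨y, hyP, hy⟩ := hex
          rw [← h1] at hy
          exact hwP (huniq y hy ▸ hyP)
        · obtain ⟨y, hyP, hy⟩ := hswap.1 hex
          rw [← h1] at hy
          exact hwP (huniq y hy ▸ hyP)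
    · have hwP : w ∈ P := by rw [hAP]; exact hwA
      have hvP : (v : V) ∉ P := by rw [hAP]; exact fun h => h v.2
      rcases (hnb w hwP v hw.adj_sub.symm).resolve_left hvP with hv | hv
      · refine ⟨⟨b, hbA⟩, Or.inr ⟨by rw [hv], w, hwP, hv ▸ hw⟩, ?_⟩
        rintro z (hz | ⟨hz, -⟩)
        · exact absurd (huniq z hz ▸ z.2) hwA
        · rw [hv, Sym2.congr_right] at hz
          exact Subtype.ext hz
      · refine ⟨⟨a, haA⟩, Or.inr ⟨by rw [hv]; exact Sym2.eq_swap,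
          hswap.2 ⟨w, hwP, hv ▸ hw⟩⟩, ?_⟩
        rintro z (hz | ⟨hz, -⟩)
        · exact absurd (huniq z hz ▸ z.2) hwA
        · rw [hv, Sym2.eq_swap (a := a), Sym2.congr_right] at hz
          exact Subtype.ext hz
  refine ⟨?_, M', hperf, ?_⟩
  · intro h hh h' hh' hne
    have := hdisj h.val (hC' h hh) h'.val (hC' h' hh') ((Hexagon.val_injective A).ne hne)
    rw [Set.disjoint_left] at this ⊢
    intro x hx hx'
    exact this (Hexagon.mem_verts_val.2 ⟨x.2, hx⟩) (Hexagon.mem_verts_val.2 ⟨x.2, hx'⟩)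
  · intro h hh
    rw [isAlternating_iff hperf.1]
    intro x hx
    obtain ⟨y, hy, hMy⟩ := (isAlternating_iff hM.1 h.val).1 (halt _ (hC' h hh)) x
      (Hexagon.mem_verts_val.2 ⟨x.2, hx⟩)
    have hyA := h.val_verts_subset hy.snd_mem
    exact ⟨⟨y, hyA⟩, Hexagon.val_adj.1 hy, Or.inl hMy⟩

theorem dualist_val_adj {A : Set V} (hB : IsBenzenoid G) (hA : IsBenzenoid (G.induce A))
    {h h' : Hexagon (G.induce A)} :
    (dualist G).Adj h.val h'.val ↔ (dualist (G.induce A)).Adj h h' := by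
  rw [dualist_adj_iff hB, dualist_adj_iff hA]
  constructor
  · rintro ⟨hne, x, hx, hx'⟩
    obtain ⟨hxA, hx⟩ := Hexagon.mem_verts_val.1 hx
    obtain ⟨_, hxB⟩ := Hexagon.mem_verts_val.1 hx'
    exact ⟨fun e => hne (congrArg _ e), ⟨x, hxA⟩, hx, hxB⟩
  · rintro ⟨hne, x, hx, hx'⟩
    exact ⟨(Hexagon.val_injective A).ne hne, x, Hexagon.mem_verts_val.2 ⟨x.2, hx⟩,
      Hexagon.mem_verts_val.2 ⟨x.2, hx'⟩⟩

/-- A hexagon with three neighbours, two of which have no other neighbour, can be split off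
together with these two. The other side inherits a resonant set. -/
theorem IsCatacondensed.exists_gluing (hB : IsCatacondensed G) {c l l' : Hexagon G}
    (hc : ((dualist G).neighborSet c).ncard = 3) (hl : (dualist G).Adj c l)
    (hl' : (dualist G).Adj c l') (hne : l ≠ l')
    (hleaf : ∀ k, (dualist G).Adj l k → k = c) (hleaf' : ∀ k, (dualist G).Adj l' k → k = c)
    {C : Finset (Hexagon G)} (hC : IsResonant C) :
    ∃ (U W : Type u) (B' : SimpleGraph U) (B₁ : SimpleGraph W) (a b : U) (h : Hexagon B₁)
      (p q : W) (C' : Finset (Hexagon B')),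
      IsCatacondensed B' ∧ B'.Adj a b ∧ HasDegreeTwo B' a ∧ HasDegreeTwo B' b ∧
      IsAngularTriple B₁ h ∧ h.1.Adj p q ∧ HasDegreeTwo B₁ p ∧ HasDegreeTwo B₁ q ∧
      IsEdgeGluing B' a b B₁ p q G ∧ IsResonant C' ∧ C.card ≤ C'.card + 2 := by
  classical
  have hBb := hB.isBenzenoid
  have hfin := hBb.finite
  have hllnot : ¬ (dualist G).Adj l l' := fun h => hl'.1 (hleaf l' h).symm
  obtain ⟨x, hx, hxl, hxl', hnbx⟩ : ∃ x, (dualist G).Adj c x ∧ x ≠ l ∧ x ≠ l' ∧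
      ∀ k, (dualist G).Adj c k → k = l ∨ k = l' ∨ k = x := by
    have h1 : ({l, l'} : Set (Hexagon G)) ⊆ (dualist G).neighborSet c := by
      rintro k (rfl | rfl)
      · exact hl
      · exact hl'
    have h2 : ((dualist G).neighborSet c \ {l, l'}).ncard = 1 := by
      rw [Set.ncard_sdiff h1 (Set.toFinite _), hc, Set.ncard_pair hne]
    obtain ⟨x, hx⟩ := Set.ncard_eq_one.1 h2
    have hxm : x ∈ (dualist G).neighborSet c \ {l, l'} := hx ▸ rfl
    refine ⟨x, hxm.1, fun e => hxm.2 (Or.inl e), fun e => hxm.2 (Or.inr e), fun k hk => ?_⟩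
    by_contra! hcon
    have : k ∈ (dualist G).neighborSet c \ {l, l'} :=
      ⟨hk, by rintro (e | e); exacts [hcon.1 e, hcon.2.1 e]⟩
    rw [hx] at this
    exact hcon.2.2 this
  obtain ⟨a, b₀, hab₀, hab₀'⟩ := exists_adj_of_dualist_adj hx
  obtain ⟨b, hab, habx, hcx, -⟩ := hB.exists_inter_eq hx.1 hab₀.fst_mem hab₀'.fst_mem
  have hmemcx : ∀ w, w ∈ c.1.verts → w ∈ x.1.verts → w = a ∨ w = b := by
    intro w h1 h2
    have : w ∈ ({a, b} : Set V) := hcx ▸ ⟨h1, h2⟩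
    exact this
  -- the vertices of the two leaves
  set P : Set V := l.1.verts ∪ l'.1.verts with hPdef
  have hPhex : ∀ w ∈ P, ∀ k : Hexagon G, w ∈ k.1.verts → k = c ∨ k = l ∨ k = l' := by
    rintro w (hw | hw) k hk
    · by_cases hkl : k = l
      · exact Or.inr (Or.inl hkl)
      · exact Or.inl (hleaf k (dualist_adj_of_mem hBb (Ne.symm hkl) hw hk))
    · by_cases hkl : k = l'
      · exact Or.inr (Or.inr hkl)
      · exact Or.inl (hleaf' k (dualist_adj_of_mem hBb (Ne.symm hkl) hw hk))
  have hxP : ∀ w ∈ x.1.verts, w ∉ P := by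
    intro w hw hwP
    rcases hPhex w hwP x hw with e | e | e
    · exact hx.1 e.symm
    · exact hxl e
    · exact hxl' e
  have haP : a ∉ P := hxP a habx.fst_mem
  have hbP : b ∉ P := hxP b habx.snd_mem
  have hcP : ∀ w ∈ c.1.verts, w ∈ P ∨ w = a ∨ w = b := by
    intro w hw
    obtain ⟨k, hk, hwk⟩ := hB.exists_adj_mem_of_ncard_eq_three hc hw
    rcases hnbx k hk with rfl | rfl | rfl
    · exact Or.inl (Or.inl hwk)
    · exact Or.inl (Or.inr hwk)
    · exact Or.inr (hmemcx w hw hwk)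
  have hPeven : Even P.ncard := by
    rw [hPdef, Set.ncard_union_eq ((disjoint_verts_iff hBb hne).2 hllnot) (Set.toFinite _)
      (Set.toFinite _), l.ncard_verts, l'.ncard_verts]
    decide
  have hPnb : ∀ w ∈ P, ∀ z, G.Adj w z → z ∈ P ∨ z = a ∨ z = b := by
    intro w hw z hz
    obtain ⟨k, hk⟩ := hBb.exists_hexagon_adj hz
    rcases hPhex w hw k hk.fst_mem with rfl | rfl | rfl
    · exact hcP z hk.snd_mem
    · exact Or.inl (Or.inl hk.snd_mem)
    · exact Or.inl (Or.inr hk.snd_mem)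
  -- The cut runs along the edge `ab` shared by `c` and `x`. The other four vertices of `c` are in
  -- `P`, so `P ∪ {a, b}` consists of the vertices of `c`, `l` and `l'`.
  set A : Set V := Pᶜ with hA
  set A' : Set V := P ∪ {a, b} with hA'
  have haA : a ∈ A := haP
  have hbA : b ∈ A := hbP
  have haA' : a ∈ A' := Or.inr (Or.inl rfl)
  have hbA' : b ∈ A' := Or.inr (Or.inr rfl)
  have hunion : A ∪ A' = Set.univ := by
    ext w
    simp only [hA, hA', Set.mem_union, Set.mem_compl_iff, Set.mem_univ, iff_true]
    tauto
  have hinter : A ∩ A' = {a, b} := by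
    ext w
    constructor
    · rintro ⟨h1, h2⟩
      exact h2.resolve_left h1
    · rintro (rfl | rfl)
      · exact ⟨haA, haA'⟩
      · exact ⟨hbA, hbA'⟩
  have hedge : ∀ y z, G.Adj y z → (y ∈ A ∧ z ∈ A) ∨ (y ∈ A' ∧ z ∈ A') := by
    intro y z hyz
    by_cases hy : y ∈ P
    · exact Or.inr ⟨Or.inl hy, hPnb y hy z hyz⟩
    · by_cases hz : z ∈ P
      · exact Or.inr ⟨hPnb z hz y hyz.symm, Or.inl hz⟩
      · exact Or.inl ⟨hy, hz⟩
  have hcA' : c.1.verts ⊆ A' := hcP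
  have hlA' : l.1.verts ⊆ A' := fun w hw => Or.inl (Or.inl hw)
  have hlA'' : l'.1.verts ⊆ A' := fun w hw => Or.inl (Or.inr hw)
  have hother : ∀ k : Hexagon G, k ≠ c → k ≠ l → k ≠ l' → k.1.verts ⊆ A := by
    intro k h1 h2 h3 w hw hwP
    rcases hPhex w hwP k hw with e | e | e
    · exact h1 e
    · exact h2 e
    · exact h3 e
  have hhex : ∀ k : Hexagon G, k.1.verts ⊆ A ∨ k.1.verts ⊆ A' := by
    intro k
    by_cases h1 : k = c
    · exact Or.inr (h1 ▸ hcA')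
    · by_cases h2 : k = l
      · exact Or.inr (h2 ▸ hlA')
      · by_cases h3 : k = l'
        · exact Or.inr (h3 ▸ hlA'')
        · exact Or.inl (hother k h1 h2 h3)
  have hnotboth : ∀ k : Hexagon G, k.1.verts ⊆ A → ¬ k.1.verts ⊆ A' := by
    intro k h1 h2
    exact k.not_verts_subset_pair (hinter ▸ Set.subset_inter h1 h2)
  have hxA : x.1.verts ⊆ A := hxP
  obtain ⟨hcat, hcat'⟩ := hB.split hab.adj_sub hunion hinter hedge hhex
    (x.three_le_card hxA) (c.three_le_card hcA')
  obtain ⟨x₁, hx₁⟩ := x.exists_val_eq hxA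
  obtain ⟨c₁, hc₁⟩ := c.exists_val_eq hcA'
  obtain ⟨l₁, hl₁⟩ := l.exists_val_eq hlA'
  obtain ⟨l₂, hl₂⟩ := l'.exists_val_eq hlA''
  have hmemab : ∀ w, w = a ∨ w = b → ∀ k : Hexagon G, w ∈ k.1.verts → k = c ∨ k = x := by
    rintro w (rfl | rfl) k hk
    · exact hB.eq_or_eq hx.1 hab.fst_mem habx.fst_mem hk
    · exact hB.eq_or_eq hx.1 hab.snd_mem habx.snd_mem hk
  have hdegA : ∀ (w : V) (hw : w = a ∨ w = b) (hwA : w ∈ A),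
      HasDegreeTwo (G.induce A) ⟨w, hwA⟩ := by
    intro w hw hwA
    have hwx : w ∈ x.1.verts := by
      rcases hw with rfl | rfl
      · exact habx.fst_mem
      · exact habx.snd_mem
    rw [← hx₁] at hwx
    obtain ⟨_, hwxA⟩ := Hexagon.mem_verts_val.1 hwx
    rw [hcat.hasDegreeTwo_iff hwxA]
    intro k hk
    apply Hexagon.val_injective A
    rcases hmemab w hw k.val (Hexagon.mem_verts_val.2 ⟨hwA, hk⟩) with e | e
    · exact absurd hcA' (hnotboth c (e ▸ k.val_verts_subset))
    · rw [e, hx₁]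
  have hdegA' : ∀ (w : V) (hw : w = a ∨ w = b) (hwA : w ∈ A'),
      (⟨w, hwA⟩ : A') ∈ c₁.1.verts ∧ HasDegreeTwo (G.induce A') ⟨w, hwA⟩ := by
    intro w hw hwA
    have hwc : w ∈ c.1.verts := by
      rcases hw with rfl | rfl
      · exact hab.fst_mem
      · exact hab.snd_mem
    rw [← hc₁] at hwc
    obtain ⟨_, hwcA⟩ := Hexagon.mem_verts_val.1 hwc
    refine ⟨hwcA, ?_⟩
    rw [hcat'.hasDegreeTwo_iff hwcA]
    intro k hk
    apply Hexagon.val_injective A'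
    rcases hmemab w hw k.val (Hexagon.mem_verts_val.2 ⟨hwA, hk⟩) with e | e
    · rw [e, hc₁]
    · exact absurd (e ▸ k.val_verts_subset) (hnotboth x hxA)
  have hall : ∀ k : Hexagon (G.induce A'), k = c₁ ∨ k = l₁ ∨ k = l₂ := by
    intro k
    by_contra! hcon
    have hinj := Hexagon.val_injective (G := G) A'
    refine hnotboth k.val (hother k.val ?_ ?_ ?_) k.val_verts_subset
    · exact fun e => hcon.1 (hinj (e.trans hc₁.symm))
    · exact fun e => hcon.2.1 (hinj (e.trans hl₁.symm))
    · exact fun e => hcon.2.2 (hinj (e.trans hl₂.symm))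
  have hadj1 : (dualist (G.induce A')).Adj c₁ l₁ := by
    rw [← dualist_val_adj hBb hcat'.isBenzenoid, hc₁, hl₁]
    exact hl
  have hadj2 : (dualist (G.induce A')).Adj c₁ l₂ := by
    rw [← dualist_val_adj hBb hcat'.isBenzenoid, hc₁, hl₂]
    exact hl'
  have hne12 : l₁ ≠ l₂ := fun e => hne (by rw [← hl₁, ← hl₂, e])
  have hnbc : (dualist (G.induce A')).neighborSet c₁ = {l₁, l₂} := by
    ext k
    constructor
    · intro hk
      rcases hall k with rfl | h
      · exact absurd rfl ((SimpleGraph.mem_neighborSet _ _ _).1 hk).ne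
      · exact h
    · rintro (rfl | rfl)
      · exact hadj1
      · exact hadj2
  have hncard : ((dualist (G.induce A')).neighborSet c₁).ncard = 2 := by
    rw [hnbc, Set.ncard_pair hne12]
  have hnum : numHexagons (G.induce A') = 3 := by
    have huniv : (Set.univ : Set (Hexagon (G.induce A'))) = {c₁, l₁, l₂} := by
      ext k
      simpa using hall k
    unfold numHexagons
    rw [← Set.ncard_univ, huniv]
    exact Set.ncard_eq_three.2 ⟨_, _, _, hadj1.1, hadj2.1, hne12, rfl⟩
  have hang : IsAngularTriple (G.induce A') c₁ := by
    refine ⟨hcat', hnum, hncard, ⟨a, haA'⟩, ⟨b, hbA'⟩, ?_, hab.adj_sub⟩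
    have hcount := hcat'.ncard_hasDegreeTwo c₁
    rw [hncard] at hcount
    symm
    refine Set.eq_of_subset_of_ncard_le ?_ ?_ (Set.toFinite _)
    · rintro w (rfl | rfl)
      · exact hdegA' a (Or.inl rfl) haA'
      · exact hdegA' b (Or.inr rfl) hbA'
    · rw [Set.ncard_pair (fun e => hab.ne (congrArg Subtype.val e))]
      omega
  have : Fintype (Hexagon (G.induce A)) := Fintype.ofFinite _
  set C' : Finset (Hexagon (G.induce A)) := Finset.univ.filter fun k => k.val ∈ C with hC'
  have hCcard : C.card ≤ C'.card + 2 := by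
    have hsub : C ⊆ C'.image Hexagon.val ∪ C.filter (fun k => k = c ∨ k = l ∨ k = l') := by
      intro k hk
      rw [Finset.mem_union]
      by_cases hk' : k = c ∨ k = l ∨ k = l'
      · exact Or.inr (Finset.mem_filter.2 ⟨hk, hk'⟩)
      · left
        push Not at hk'
        obtain ⟨k₁, rfl⟩ := k.exists_val_eq (hother k hk'.1 hk'.2.1 hk'.2.2)
        exact Finset.mem_image.2 ⟨k₁, by simpa [hC'] using hk, rfl⟩
    -- As `c` is adjacent to `l` and `l'`, an independent set that contains `c` contains neither of
    -- them.
    have h2 : (C.filter (fun k => k = c ∨ k = l ∨ k = l')).card ≤ 2 := by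
      have hind := hC.not_adj hBb
      by_cases hcC : c ∈ C
      · refine le_trans (Finset.card_le_card (t := {c}) ?_) (by simp)
        intro k hk
        rw [Finset.mem_filter] at hk
        rcases hk.2 with rfl | rfl | rfl
        · simp
        · exact absurd hl (hind _ hcC _ hk.1)
        · exact absurd hl' (hind _ hcC _ hk.1)
      · refine le_trans (Finset.card_le_card (t := {l, l'}) ?_) Finset.card_le_two
        intro k hk
        rw [Finset.mem_filter] at hk
        rcases hk.2 with rfl | rfl | rfl
        · exact absurd hk.1 hcC
        · simp
        · simp
    have h3 := Finset.card_le_card hsub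
    have h4 := Finset.card_union_le (C'.image Hexagon.val)
      (C.filter (fun k => k = c ∨ k = l ∨ k = l'))
    have h5 : (C'.image Hexagon.val).card ≤ C'.card := Finset.card_image_le
    omega
  refine ⟨A, A', G.induce A, G.induce A', ⟨a, haA⟩, ⟨b, hbA⟩, c₁, ⟨a, haA'⟩, ⟨b, hbA'⟩, C', hcat,
    hab.adj_sub, hdegA a (Or.inl rfl) haA, hdegA b (Or.inr rfl) hbA, hang, ?_,
    (hdegA' a (Or.inl rfl) haA').2, (hdegA' b (Or.inr rfl) hbA').2,
    isEdgeGluing_of_split haA hbA haA' hbA' hunion hinter hedge, ?_, hCcard⟩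
  · rw [← Hexagon.val_adj, hc₁]
    exact hab
  · exact hC.restrict hab.adj_sub haA hbA (compl_compl P).symm hPeven hPnb C'
      fun h hh => by simpa [hC'] using hh

end Split

/-! ### Extremal graphs belong to the family -/

section Extremal

theorem degree_dualist {V : Type u} {G : SimpleGraph V} [Fintype (Hexagon G)]
    [DecidableRel (dualist G).Adj] (h : Hexagon G) :
    (dualist G).degree h = ((dualist G).neighborSet h).ncard := by
  rw [Set.ncard_eq_toFinset_card', ← SimpleGraph.neighborFinset,
    SimpleGraph.card_neighborFinset_eq_degree]

/-- A catacondensed benzenoid graph with a resonant set that attains the bound belongs to the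
family. -/
theorem inFamily_of_isResonant (n : ℕ) : ∀ {V : Type u} (B : SimpleGraph V),
    IsCatacondensed B → numHexagons B = n → ∀ C : Finset (Hexagon B), IsResonant C →
    2 * n ≤ 3 * C.card + 1 → InFamily B := by
  induction n using Nat.strong_induction_on with | _ n ih => ?_
  intro V B hB hn C hC hcard
  classical
  have hBb := hB.isBenzenoid
  have hfin := hBb.finite
  have hfint : Fintype (Hexagon B) := Fintype.ofFinite _
  have hpos := hB.numHexagons_pos
  have hup := hB.three_mul_card_le hC
  have hind := hC.not_adj hBb
  have hnF : Fintype.card (Hexagon B) = n := by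
    rw [← Nat.card_eq_fintype_card]
    exact hn
  have hdeg : ∀ h, (dualist B).degree h ≤ 3 := fun h => by
    rw [degree_dualist]
    exact hB.ncard_dualist_neighborSet_le h
  rcases (by omega : n = 1 ∨ n = 2 ∨ n = 3 ∨ 4 ≤ n) with h1 | h2 | h3 | h4
  · exact InFamily.one B hB (hn.trans h1)
  · exact InFamily.two B hB (hn.trans h2)
  -- For three hexagons, `C` has two members and the total slack is 2. The only hexagon outside `C`
  -- has all its neighbours in `C`, so it has degree 2.
  · have hslack := sum_slack hB.dualist_isTree C hind
    have hC2 : C.card = 2 := by omega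
    have hcompl : Cᶜ.card = 1 := by
      have := Finset.card_add_card_compl C
      omega
    obtain ⟨h, hh⟩ := Finset.card_eq_one.1 hcompl
    have hmem : ∀ k, k ∉ C ↔ k = h := by
      intro k
      rw [← Finset.mem_compl, hh, Finset.mem_singleton]
    have hnb : ∀ k, (dualist B).Adj h k → k ∈ C := by
      intro k hk
      by_contra hkC
      exact hk.1 ((hmem k).1 hkC).symm
    have hempty : ((dualist B).neighborFinset h).filter (· ∉ C) = ∅ := by
      rw [Finset.filter_eq_empty_iff]
      intro k hk hkC
      exact hkC (hnb k (by simpa using hk))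
    have hdeg2 : (dualist B).degree h = 2 := by
      rw [hh, Finset.sum_singleton, slack, hempty, Finset.card_empty, hC2, hnF, h3] at hslack
      push_cast at hslack
      omega
    rw [degree_dualist] at hdeg2
    exact InFamily.three B h ⟨hB, hn.trans h3, hB.isAngular_of_isResonant hC hdeg2 hnb⟩
  · by_cases hred : ∃ c l l', (dualist B).degree c = 3 ∧ (dualist B).Adj c l ∧
      (dualist B).Adj c l' ∧ (dualist B).degree l = 1 ∧ (dualist B).degree l' = 1 ∧ l ≠ l'
    · obtain ⟨c, l, l', hc, hl, hl', hld, hld', hne⟩ := hred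
      rw [degree_dualist] at hc
      obtain ⟨U, W, B', B₁, a, b, h, p, q, C', hB', hab, ha, hb, hB₁, hpq, hp, hq, hglue, hC',
        hCC'⟩ := hB.exists_gluing hc hl hl' hne (fun k hk => eq_of_leaf hld hk hl.symm)
          (fun k hk => eq_of_leaf hld' hk hl'.symm) hC
      have hnum := hglue.numHexagons_eq hab hpq.adj_sub hB'.isBenzenoid hB₁.1.isBenzenoid hBb
      have hn1 := hB₁.2.1
      -- Three hexagons fewer and at most two members of the resonant set fewer: the inequality
      -- persists.
      have hmem : InFamily B' := ih (numHexagons B') (by omega) B' hB' rfl C' hC' (by omega)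
      exact InFamily.glue B' hB' hmem a b hab ha hb B₁ h hB₁ p q hpq hp hq B hglue
    · push Not at hred
      obtain ⟨k, hk, φ, hφ⟩ := exists_iso_treeT_of_isTree hB.dualist_isTree hdeg
        (by omega) C hind (by omega)
        (fun x l l' hx hl hl' hld hld' => hred x l l' hx hl hl' hld hld')
      have hang : ∀ x, (x = φ (Sum.inl ⟨1, by omega⟩) ∨
          x = φ (Sum.inl ⟨2 * k - 1, by omega⟩)) → IsAngular B x := by
        intro x hx
        obtain ⟨-, hd, hnb⟩ := hφ x hx
        rw [degree_dualist] at hd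
        exact hB.isAngular_of_isResonant hC hd hnb
      exact InFamily.tree B hB k hk φ (hang _ (Or.inl rfl)) (hang _ (Or.inr rfl))

end Extremal

end Benzenoid

theorem mainTheorem1 {V : Type u} (B : SimpleGraph V) (hB : Benzenoid.IsCatacondensed B)
    (n : ℕ) (hn : Benzenoid.numHexagons B = n) :
    Benzenoid.clarNumber B ≤ (2 * n + 1) / 3 ∧
    (Benzenoid.clarNumber B = (2 * n + 1) / 3 ↔ Benzenoid.InFamily B) := by
  subst hn
  refine ⟨hB.clarNumber_le, fun h => ?_, fun h => h.clarNumber_eq hB⟩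
  have := hB.isBenzenoid.finite
  have hpos := hB.numHexagons_pos
  -- There is at least one hexagon, so the bound is positive and the supremum is attained by a
  -- resonant set.
  obtain ⟨C, hC, hcard⟩ := Benzenoid.exists_isResonant_card_eq (G := B) (by omega)
  exact Benzenoid.inFamily_of_isResonant _ B hB rfl C hC (by omega)
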